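/- Work over $\mathbb C$. For a vector space $X$ of dimension $n$, a complete flag $F_1\subset F_2\subset\cdots\subset F_n=X$ ($\dim F_j=j$) and a partition $\lambda$ for $\mathrm{Gr}(k,n)$ (a weakly decreasing sequence of nonnegative integers with $\lambda_1\le n-k$ and $\lambda_{k+1}=0$), let $\Omega_\lambda F_\bullet$ be the set of $k$-planes $H\subset X$ with $\dim(H\cap F_{n-k+j-\lambda_j})\ge j$ for $j=1,\dots,k$. A Schubert problem in $\mathrm{Gr}(k,n)$ is a list $\boldsymbol\lambda=(\lambda^1,\dots,\lambda^s)$ of partitions for $\mathrm{Gr}(k,n)$, some possibly $0$, with $\sum_i|\lambda^i|=k(n-k)$. An instance of it is an $s$-tuple $\mathcal F_\bullet=(F^1_\bullet,\dots,F^s_\bullet)$ of flags in $X$, with solution set $\Omega_{\boldsymbol\lambda}\mathcal F_\bullet=\bigcap_i\Omega_{\lambda^i}F^i_\bullet$. "General" means: in some non-empty (hence dense) Zariski open subset of the variety of all such tuples of flags. We write $\boldsymbol\lambda=d$ if a general instance has exactly $d$ solutions. Let $\boldsymbol\lambda,\boldsymbol\mu,\boldsymbol\nu$ be Schubert problems in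 $\mathrm{Gr}(k+a,n+b)$, $\mathrm{Gr}(k,n)$, $\mathrm{Gr}(a,b)$. Then $\boldsymbol\lambda$ is fibered over $\boldsymbol\mu$ with fiber $\boldsymbol\nu$ if there is a non-empty Zariski open set $\mathcal U$ of instances of $\boldsymbol\lambda$ in $\mathbb C^{n+b}$ and a choice, for each $\mathcal F_\bullet\in\mathcal U$, of a subspace $V\subset\mathbb C^{n+b}$ of dimension $n$, an instance $\mathcal E_\bullet$ of $\boldsymbol\mu$ in $\mathrm{Gr}(k,V)$ and, for every $h\in\Omega_{\boldsymbol\mu}\mathcal E_\bullet$, an instance $\mathcal G_\bullet(h)$ of $\boldsymbol\nu$ in $\mathrm{Gr}(a,W)$, $W=\mathbb C^{n+b}/V$, such that: 1. for every $\mathcal F_\bullet\in\mathcal U$ and every $H\in\Omega_{\boldsymbol\lambda}\mathcal F_\bullet$, $H\cap V\in\Omega_{\boldsymbol\mu}\mathcal E_\bullet$; 2. if $\mathcal F_\bullet\in\mathcal U$, $H\in\Omega_{\boldsymbol\lambda}\mathcal F_\bullet$ and $h=H\cap V$, then $H/h\subset W$ lies in $\Omega_{\boldsymbol\nu}\mathcal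 G_\bullet(h)$; 3. for every $\mathcal F_\bullet\in\mathcal U$, $H\mapsto(h,H/h)$ with $h=H\cap V$ is a bijection from $\Omega_{\boldsymbol\lambda}\mathcal F_\bullet$ onto the set of pairs $(h,K)$ with $h\in\Omega_{\boldsymbol\mu}\mathcal E_\bullet$ and $K\in\Omega_{\boldsymbol\nu}\mathcal G_\bullet(h)$; 4. for every given $V\subset\mathbb C^{n+b}$ of dimension $n$, every general tuple $\mathcal E_\bullet$ of flags in $V$ is, together with $V$, the choice made for some $\mathcal F_\bullet\in\mathcal U$; moreover, for $\mathcal E_\bullet$ general and any $h\in\Omega_{\boldsymbol\mu}\mathcal E_\bullet$, every general tuple of flags in $\mathbb C^{n+b}/V$ is $\mathcal G_\bullet(h)$ for some $\mathcal F_\bullet\in\mathcal U$ with this $V$ and $\mathcal E_\bullet$; and the instances $\mathcal G_\bullet(h)$ are themselves general: for every non-empty Zariski open set $\mathcal O$ of tuples of flags in $\mathbb C^b$ there is a non-empty Zariski open $\mathcal U'\subset\mathcal U$ such that for $\mathcal F_\bullet\in\mathcal U'$ and every $h\in\Omega_{\boldsymbol\mu}\mathcal E_\bullet$, some linear isomorphism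 $W\simeq\mathbb C^b$ carries $\mathcal G_\bullet(h)$ into $\mathcal O$. For a partition $\lambda$ and integers $r\ge r'\ge\lambda_1$, write $(r',\lambda)$, $(r,r',\lambda)$ for the partitions with parts $r',\lambda_1,\lambda_2,\dots$ and $r,r',\lambda_1,\lambda_2,\dots$. Write $1^m+\lambda$ for the result of adding $1$ to each of $\lambda_1,\dots,\lambda_m$, and $\square$ for the partition $(1)$. **Theorem.** Let $0<a<b$ and let $\boldsymbol\nu=(\nu^1,\dots,\nu^s)$ be a Schubert problem in $\mathrm{Gr}(a,b)$. (i) If $s\ge4$, then $$\boldsymbol\lambda=\bigl((b-a+2,\,b-a+1,\,\nu^1),\ 1^{a+1}+\nu^2,\ 1^{a+1}+\nu^3,\ 1^{a+1}+\nu^4,\ \nu^5,\dots,\nu^s\bigr)$$ is a Schubert problem in $\mathrm{Gr}(2+a,5+b)$ that is fibered over $(2,1)\cdot\square^3=2$ in $\mathrm{Gr}(2,5)$ with fiber $\boldsymbol\nu$. (ii) If $s\ge5$, then $$\boldsymbol\lambda=\bigl((b-a+2,\,\nu^1),\ (b-a+1,\,\nu^2),\ 1^{a+1}+\nu^3,\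 1^{a+1}+\nu^4,\ 1^{a+1}+\nu^5,\ \nu^6,\dots,\nu^s\bigr)$$ is a Schubert problem in $\mathrm{Gr}(2+a,5+b)$ that is fibered over $(2)\cdot\square^4=3$ in $\mathrm{Gr}(2,5)$ with fiber $\boldsymbol\nu$. -/

import Mathlib

/-- A complete flag `F₁ ⊂ F₂ ⊂ ⋯ ⊂ Fₙ = X` of linear subspaces of a complex vector space `X` of
dimension `n`, with `dim Fⱼ = j`. For convenience it is indexed by all natural numbers:
`F₀ = 0`, and `Fⱼ = X` for `j ≥ n`. -/
@[ext]
structure CompleteFlag (X : Type*) [AddCommGroup X] [Module ℂ X] where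
  space : ℕ → Submodule ℂ X
  mono : Monotone space
  finrank_space : ∀ j, Module.finrank ℂ (space j) = min j (Module.finrank ℂ X)

section Flags

variable {X : Type*} [AddCommGroup X] [Module ℂ X]

/-- The basis `v` is adapted to the flag `F`: `Fⱼ` is spanned by the first `j` basis vectors. -/
def IsAdapted (v : Module.Basis (Fin (Module.finrank ℂ X)) ℂ X) (F : CompleteFlag X) : Prop :=
  ∀ j : ℕ, F.space j = Submodule.span ℂ (v '' {i | (i : ℕ) < j})

/-- The value of a polynomial function at a tuple of bases of `X`. A polynomial function is a
polynomial in the quantities `φ (v i j)`, where `v i j` is the `j`-th vector of the `i`-th basis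
and `φ` runs over the linear functionals on `X` (no choice of coordinates is needed). -/
noncomputable def evalBases {ι : Type*}
    (p : MvPolynomial (ι × Fin (Module.finrank ℂ X) × Module.Dual ℂ X) ℂ)
    (v : ι → Module.Basis (Fin (Module.finrank ℂ X)) ℂ X) : ℂ :=
  MvPolynomial.eval (fun x => x.2.2 (v x.1 x.2.1)) p

/-- Zariski open subsets of the product `∏_{i ∈ ι} 𝔽ℓ(X)` of flag varieties. The topology is the
quotient of the Zariski topology under `GL(X)^ι → 𝔽ℓ(X)^ι`, which sends a tuple of bases to
the tuple of flags that they span: around each point of `U` there is an adapted tuple of bases and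
a polynomial `p` that is non-zero there, such that all tuples of bases at which `p` is non-zero
span tuples of flags in `U`. -/
def IsZariskiOpen {ι : Type*} (U : Set (ι → CompleteFlag X)) : Prop :=
  ∀ F ∈ U, ∃ p : MvPolynomial (ι × Fin (Module.finrank ℂ X) × Module.Dual ℂ X) ℂ,
    (∃ v : ι → Module.Basis (Fin (Module.finrank ℂ X)) ℂ X,
      (∀ i, IsAdapted (v i) (F i)) ∧ evalBases p v ≠ 0) ∧
    ∀ (v : ι → Module.Basis (Fin (Module.finrank ℂ X)) ℂ X) (F' : ι → CompleteFlag X),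
      (∀ i, IsAdapted (v i) (F' i)) → evalBases p v ≠ 0 → F' ∈ U

/-- The Schubert variety `Ω_λ F` in `Gr(k, X)`: the `k`-planes `H` with
`dim (H ∩ F_{n-k+j-λⱼ}) ≥ j` for `j = 1, …, k`, where `n = dim X`. The parts of the partition are
`λ₁ = lam 0`, `λ₂ = lam 1`, and so on. -/
def schubertVariety (k : ℕ) (lam : ℕ → ℕ) (F : CompleteFlag X) : Set (Submodule ℂ X) :=
  {H | Module.finrank ℂ H = k ∧ ∀ j < k, j + 1 ≤
    Module.finrank ℂ
      (H ⊓ F.space (Module.finrank ℂ X - k + (j + 1) - lam j) : Submodule ℂ X)}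

/-- The set `Ω_λ F` of solutions in `Gr(k, X)` of the instance of the Schubert problem
`λ = (λ¹, …, λˢ)` given by the flags `F = (F¹, …, Fˢ)`. -/
def schubertSolutions {ι : Type*} (k : ℕ) (lam : ι → ℕ → ℕ) (F : ι → CompleteFlag X) :
    Set (Submodule ℂ X) :=
  {H | Module.finrank ℂ H = k ∧ ∀ i, H ∈ schubertVariety k (lam i) (F i)}

end Flags

/-- `lam` is a partition for `Gr(k, n)`: a weakly decreasing sequence with `λ₁ ≤ n - k` and
`λ_{k+1} = 0`. -/
def IsPartitionFor (k n : ℕ) (lam : ℕ → ℕ) : Prop :=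
  Antitone lam ∧ lam 0 ≤ n - k ∧ lam k = 0

/-- A Schubert problem in `Gr(k, n)`: a list of partitions for `Gr(k, n)` whose sizes add up to
`k (n - k)`. Partitions equal to `0` are allowed. -/
def IsSchubertProblem {s : ℕ} (k n : ℕ) (lam : Fin s → ℕ → ℕ) : Prop :=
  (∀ i, IsPartitionFor k n (lam i)) ∧
    ∑ i, ∑ j ∈ Finset.range k, lam i j = k * (n - k)

/-- `d(λ) = d`: a general instance of `λ` in `Gr(k, n)` has exactly `d` solutions. -/
def HasSchubertNumber {s : ℕ} (k n : ℕ) (lam : Fin s → ℕ → ℕ) (d : ℕ) : Prop :=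
  ∃ U : Set (Fin s → CompleteFlag (Fin n → ℂ)), U.Nonempty ∧ IsZariskiOpen U ∧
    ∀ F ∈ U, (schubertSolutions k lam F).encard = d

/-- The data attached to an instance of a fibered Schubert problem in `ℂᴺ`: a subspace `V`, an
`r`-tuple `E` of flags in `V`, and for `h ⊆ V` a `t`-tuple `G h` of flags in `W = ℂᴺ / V`. -/
structure FibrationDatum (N r t : ℕ) where
  V : Submodule ℂ (Fin N → ℂ)
  E : Fin r → CompleteFlag V
  G : Submodule ℂ V → Fin t → CompleteFlag ((Fin N → ℂ) ⧸ V)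

/-- The datum `D` decomposes the solutions of the instance `F` of `lam` in `Gr(k + a, n + b)` into
those of an instance of `mu` in `Gr(k, V)` and instances of `nu` in `Gr(a, ℂⁿ⁺ᵇ / V)`.
For a subspace `H`, the subspace `h = H ∩ V` of `V` is `H.comap D.V.subtype`, and `H / h`, as a
subspace of `ℂⁿ⁺ᵇ / V`, is the image `H.map D.V.mkQ` of `H`. -/
structure IsFiberDecomposition {s r t : ℕ} (k n a b : ℕ) (lam : Fin s → ℕ → ℕ)
    (mu : Fin r → ℕ → ℕ) (nu : Fin t → ℕ → ℕ) (F : Fin s → CompleteFlag (Fin (n + b) → ℂ))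
    (D : FibrationDatum (n + b) r t) : Prop where
  finrank_V : Module.finrank ℂ D.V = n
  base : ∀ H ∈ schubertSolutions (k + a) lam F,
    H.comap D.V.subtype ∈ schubertSolutions k mu D.E
  fiber : ∀ h ∈ schubertSolutions k mu D.E, ∀ H ∈ schubertSolutions (k + a) lam F,
    H.comap D.V.subtype = h → H.map D.V.mkQ ∈ schubertSolutions a nu (D.G h)
  bijOn : Set.BijOn (fun H => (H.comap D.V.subtype, H.map D.V.mkQ))
    (schubertSolutions (k + a) lam F)
    {q : Submodule ℂ D.V × Submodule ℂ ((Fin (n + b) → ℂ) ⧸ D.V) |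
      q.1 ∈ schubertSolutions k mu D.E ∧ q.2 ∈ schubertSolutions a nu (D.G q.1)}

/-- The Schubert problem `lam` in `Gr(k + a, n + b)` is fibered over `mu` in `Gr(k, n)` with fiber
`nu` in `Gr(a, b)`. There are a dense Zariski open set `U` of instances of `lam` (non-empty
suffices, the variety of instances is irreducible) and a datum `D F` for each instance `F` with:
* for `F ∈ U` the datum `D F` decomposes the solutions of `F`;
* for a given `V`, all general instances `E` of `mu` in `V` are obtained from some `F ∈ U`, and
  then, given also a solution `h` of `E`, all general instances of `nu` in `ℂⁿ⁺ᵇ / V` are obtained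
  as the instance attached to `h` by some `F ∈ U` inducing `V` and `E`;
* for general `F ∈ U` the instances `(D F).G h` of `nu` are general: up to a linear isomorphism
  with `ℂᵇ` they lie in any prescribed non-empty Zariski open set. -/
def IsFiberedOver {s r t : ℕ} (k n a b : ℕ) (lam : Fin s → ℕ → ℕ)
    (mu : Fin r → ℕ → ℕ) (nu : Fin t → ℕ → ℕ) : Prop :=
  IsSchubertProblem (k + a) (n + b) lam ∧ IsSchubertProblem k n mu ∧ IsSchubertProblem a b nu ∧
  ∃ (U : Set (Fin s → CompleteFlag (Fin (n + b) → ℂ)))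
    (D : (Fin s → CompleteFlag (Fin (n + b) → ℂ)) → FibrationDatum (n + b) r t),
    U.Nonempty ∧ IsZariskiOpen U ∧
    (∀ F ∈ U, IsFiberDecomposition k n a b lam mu nu F (D F)) ∧
    (∀ V : Submodule ℂ (Fin (n + b) → ℂ), Module.finrank ℂ V = n →
      ∃ O : Set (Fin r → CompleteFlag V), O.Nonempty ∧ IsZariskiOpen O ∧ ∀ E ∈ O,
        (∃ F ∈ U, ∃ G, D F = ⟨V, E, G⟩) ∧
        ∀ h ∈ schubertSolutions k mu E,
          ∃ O' : Set (Fin t → CompleteFlag ((Fin (n + b) → ℂ) ⧸ V)),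
            O'.Nonempty ∧ IsZariskiOpen O' ∧
            ∀ G₀ ∈ O', ∃ F ∈ U, ∃ G, D F = ⟨V, E, G⟩ ∧ G h = G₀) ∧
    (∀ O : Set (Fin t → CompleteFlag (Fin b → ℂ)), O.Nonempty → IsZariskiOpen O →
      ∃ U' ⊆ U, U'.Nonempty ∧ IsZariskiOpen U' ∧
        ∀ F ∈ U', ∀ h ∈ schubertSolutions k mu (D F).E,
          ∃ e : ((Fin (n + b) → ℂ) ⧸ (D F).V) ≃ₗ[ℂ] (Fin b → ℂ), ∃ G₀ ∈ O,
            ∀ i j, (G₀ i).space j = (((D F).G h i).space j).map e.toLinearMap)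

/-- The partition with the listed parts, followed by zeros. -/
def partition (l : List ℕ) : ℕ → ℕ := fun j => l.getD j 0

/-- The partition `(r, λ)` with rows `r, λ₁, λ₂, …` (used for `r ≥ λ₁`). -/
def consRow (r : ℕ) (lam : ℕ → ℕ) : ℕ → ℕ
  | 0 => r
  | j + 1 => lam j

/-- The partition `1ᵐ + λ`. -/
def addColumn (m : ℕ) (lam : ℕ → ℕ) : ℕ → ℕ := fun j => (if j < m then 1 else 0) + lam j

/-- The list `((b-a+2, b-a+1, ν¹), 1ᵃ⁺¹+ν², 1ᵃ⁺¹+ν³, 1ᵃ⁺¹+ν⁴, ν⁵, …, νˢ)`; the index `i : Fin s`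
stands for the superscript `i + 1`. -/
def familyOne {s : ℕ} (a b : ℕ) (nu : Fin s → ℕ → ℕ) (i : Fin s) : ℕ → ℕ :=
  if (i : ℕ) = 0 then consRow (b - a + 2) (consRow (b - a + 1) (nu i))
  else if (i : ℕ) ≤ 3 then addColumn (a + 1) (nu i)
  else nu i

/-- The list `((b-a+2, ν¹), (b-a+1, ν²), 1ᵃ⁺¹+ν³, 1ᵃ⁺¹+ν⁴, 1ᵃ⁺¹+ν⁵, ν⁶, …, νˢ)`. -/
def familyTwo {s : ℕ} (a b : ℕ) (nu : Fin s → ℕ → ℕ) (i : Fin s) : ℕ → ℕ :=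
  if (i : ℕ) = 0 then consRow (b - a + 2) (nu i)
  else if (i : ℕ) = 1 then consRow (b - a + 1) (nu i)
  else if (i : ℕ) ≤ 4 then addColumn (a + 1) (nu i)
  else nu i

/-- The Schubert problem `(2,1)·□³` in `Gr(2, 5)`. -/
def baseOne : Fin 4 → ℕ → ℕ :=
  ![partition [2, 1], partition [1], partition [1], partition [1]]

/-- The Schubert problem `(2)·□⁴` in `Gr(2, 5)`. -/
def baseTwo : Fin 5 → ℕ → ℕ :=
  ![partition [2], partition [1], partition [1], partition [1], partition [1]]

noncomputable section

open Module

/-! ### Polynomial functions on a complex vector space -/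

section PolyFun

variable {M M' : Type*} [AddCommGroup M] [Module ℂ M] [AddCommGroup M'] [Module ℂ M']

/-- The algebra of polynomial functions on a complex vector space. -/
def polyFun (M : Type*) [AddCommGroup M] [Module ℂ M] : Subalgebra ℂ (M → ℂ) :=
  Algebra.adjoin ℂ (Set.range fun φ : Module.Dual ℂ M => (φ : M → ℂ))

lemma dual_mem_polyFun (φ : Module.Dual ℂ M) : (fun x => φ x) ∈ polyFun M :=
  Algebra.subset_adjoin ⟨φ, rfl⟩

lemma const_mem_polyFun (c : ℂ) : (fun _ => c) ∈ polyFun M :=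
  (polyFun M).algebraMap_mem c

lemma add_mem_polyFun {f g : M → ℂ} (hf : f ∈ polyFun M) (hg : g ∈ polyFun M) :
    (fun x => f x + g x) ∈ polyFun M := (polyFun M).add_mem hf hg

lemma sub_mem_polyFun {f g : M → ℂ} (hf : f ∈ polyFun M) (hg : g ∈ polyFun M) :
    (fun x => f x - g x) ∈ polyFun M := (polyFun M).sub_mem hf hg

lemma mul_mem_polyFun {f g : M → ℂ} (hf : f ∈ polyFun M) (hg : g ∈ polyFun M) :
    (fun x => f x * g x) ∈ polyFun M := (polyFun M).mul_mem hf hg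

lemma pow_mem_polyFun {f : M → ℂ} (hf : f ∈ polyFun M) (k : ℕ) :
    (fun x => f x ^ k) ∈ polyFun M := (polyFun M).pow_mem hf k

lemma sum_mem_polyFun {ι : Type*} (s : Finset ι) {f : ι → M → ℂ}
    (hf : ∀ i ∈ s, f i ∈ polyFun M) : (fun x => ∑ i ∈ s, f i x) ∈ polyFun M := by
  have := (polyFun M).sum_mem hf
  convert this using 1
  ext x; simp

lemma prod_mem_polyFun {ι : Type*} (s : Finset ι) {f : ι → M → ℂ}
    (hf : ∀ i ∈ s, f i ∈ polyFun M) : (fun x => ∏ i ∈ s, f i x) ∈ polyFun M := by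
  have := (polyFun M).prod_mem hf
  convert this using 1
  ext x; simp

lemma polyFun_induction {p : (M → ℂ) → Prop} (hd : ∀ φ : Module.Dual ℂ M, p fun x => φ x)
    (hc : ∀ c : ℂ, p fun _ => c) (ha : ∀ f g, p f → p g → p fun x => f x + g x)
    (hm : ∀ f g, p f → p g → p fun x => f x * g x) {f : M → ℂ} (hf : f ∈ polyFun M) : p f := by
  induction hf using Algebra.adjoin_induction with
  | mem x hx => obtain ⟨φ, rfl⟩ := hx; exact hd φ
  | algebraMap r => exact hc r
  | add x y _ _ hx hy => exact ha x y hx hy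
  | mul x y _ _ hx hy => exact hm x y hx hy

/-- A map into a vector space all of whose coordinates are polynomial functions. -/
def IsPolyMap (g : M → M') : Prop := ∀ φ : Module.Dual ℂ M', (fun x => φ (g x)) ∈ polyFun M

lemma comp_mem_polyFun {f : M' → ℂ} (hf : f ∈ polyFun M') {g : M → M'} (hg : IsPolyMap g) :
    (fun x => f (g x)) ∈ polyFun M :=
  polyFun_induction (p := fun f => (fun x => f (g x)) ∈ polyFun M) hg
    (fun c => const_mem_polyFun c) (fun _ _ h h' => add_mem_polyFun h h')
    (fun _ _ h h' => mul_mem_polyFun h h') hf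

lemma LinearMap.isPolyMap (L : M →ₗ[ℂ] M') : IsPolyMap (fun x => L x) :=
  fun φ => dual_mem_polyFun (φ ∘ₗ L)

lemma isPolyMap_const (y : M') : IsPolyMap (fun _ : M => y) := fun _ => const_mem_polyFun _

lemma IsPolyMap.add {f g : M → M'} (hf : IsPolyMap f) (hg : IsPolyMap g) :
    IsPolyMap fun x => f x + g x := fun φ => by
  simpa using add_mem_polyFun (hf φ) (hg φ)

lemma IsPolyMap.sub {f g : M → M'} (hf : IsPolyMap f) (hg : IsPolyMap g) :
    IsPolyMap fun x => f x - g x := fun φ => by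
  simpa using sub_mem_polyFun (hf φ) (hg φ)

lemma IsPolyMap.smul {f : M → ℂ} {g : M → M'} (hf : f ∈ polyFun M) (hg : IsPolyMap g) :
    IsPolyMap fun x => f x • g x := fun φ => by
  simpa using mul_mem_polyFun hf (hg φ)

lemma IsPolyMap.sum {ι : Type*} (s : Finset ι) {f : ι → M → M'}
    (hf : ∀ i ∈ s, IsPolyMap (f i)) : IsPolyMap fun x => ∑ i ∈ s, f i x := fun φ => by
  simpa using sum_mem_polyFun s fun i hi => hf i hi φ

lemma IsPolyMap.linear {M'' : Type*} [AddCommGroup M''] [Module ℂ M''] {f : M → M'}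
    (hf : IsPolyMap f) (L : M' →ₗ[ℂ] M'') : IsPolyMap fun x => L (f x) :=
  fun φ => hf (φ ∘ₗ L)

lemma isPolyMap_pi {ι : Type*} [Finite ι] {Y : ι → Type*} [∀ i, AddCommGroup (Y i)]
    [∀ i, Module ℂ (Y i)] {f : M → ∀ i, Y i} (hf : ∀ i, IsPolyMap fun x => f x i) :
    IsPolyMap f := by
  classical
  have := Fintype.ofFinite ι
  intro φ
  have : (fun x => φ (f x)) = fun x => ∑ i, (φ ∘ₗ LinearMap.single ℂ Y i) (f x i) := by
    ext x
    conv_lhs => rw [← LinearMap.sum_single_apply Y (f x)]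
    simp
  rw [this]
  exact sum_mem_polyFun _ fun i _ => hf i _

lemma IsPolyMap.comp {M'' : Type*} [AddCommGroup M''] [Module ℂ M''] {f : M' → M''} {g : M → M'}
    (hf : IsPolyMap f) (hg : IsPolyMap g) : IsPolyMap fun x => f (g x) :=
  fun φ => comp_mem_polyFun (hf φ) hg

lemma matrix_det_mem_polyFun {m : Type*} [Fintype m] [DecidableEq m] {A : M → Matrix m m ℂ}
    (hA : ∀ i j, (fun x => A x i j) ∈ polyFun M) : (fun x => (A x).det) ∈ polyFun M := by
  simp only [Matrix.det_apply']
  exact sum_mem_polyFun _ fun σ _ => mul_mem_polyFun (const_mem_polyFun _)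
    (prod_mem_polyFun _ fun i _ => hA _ _)

lemma IsPolyMap.det {m : Type*} [Fintype m] [DecidableEq m] (β : Basis m ℂ M')
    {f : M → m → M'} (hf : ∀ i, IsPolyMap fun x => f x i) :
    (fun x => β.det (f x)) ∈ polyFun M := by
  simp only [Basis.det_apply]
  exact matrix_det_mem_polyFun fun i j => hf j (β.coord i)

lemma exists_polynomial_of_line {f : M → ℂ} (hf : f ∈ polyFun M) (x y : M) :
    ∃ p : Polynomial ℂ, ∀ t : ℂ, f (x + t • y) = p.eval t := by
  refine polyFun_induction (p := fun f => ∃ p : Polynomial ℂ, ∀ t : ℂ, f (x + t • y) = p.eval t)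
    (fun φ => ?_) (fun c => ⟨.C c, by simp⟩) ?_ ?_ hf
  · exact ⟨.C (φ x) + .C (φ y) * .X, fun t => by simp; ring⟩
  · rintro f g ⟨p, hp⟩ ⟨q, hq⟩
    exact ⟨p + q, fun t => by simp [hp, hq]⟩
  · rintro f g ⟨p, hp⟩ ⟨q, hq⟩
    exact ⟨p * q, fun t => by simp [hp, hq]⟩

/-- An affine space over `ℂ` is irreducible. -/
lemma exists_mul_ne_zero_of_polyFun {f g : M → ℂ} (hf : f ∈ polyFun M) (hg : g ∈ polyFun M)
    (hf0 : ∃ x, f x ≠ 0) (hg0 : ∃ x, g x ≠ 0) : ∃ x, f x * g x ≠ 0 := by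
  obtain ⟨x, hx⟩ := hf0
  obtain ⟨y, hy⟩ := hg0
  obtain ⟨p, hp⟩ := exists_polynomial_of_line hf x (y - x)
  obtain ⟨q, hq⟩ := exists_polynomial_of_line hg x (y - x)
  have hp0 : p ≠ 0 := by
    rintro rfl
    exact hx (by simpa using hp 0)
  have hq0 : q ≠ 0 := by
    rintro rfl
    exact hy (by simpa using hq 1)
  obtain ⟨t, ht⟩ : ∃ t, (p * q).eval t ≠ 0 := by
    by_contra! h
    exact mul_ne_zero hp0 hq0 (Polynomial.funext (by simpa using h))
  exact ⟨x + t • (y - x), by simpa [hp, hq] using ht⟩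

lemma exists_prod_ne_zero_of_polyFun {ι : Type*} (s : Finset ι) {f : ι → M → ℂ}
    (hf : ∀ i ∈ s, f i ∈ polyFun M) (hf0 : ∀ i ∈ s, ∃ x, f i x ≠ 0) :
    ∃ x, ∏ i ∈ s, f i x ≠ 0 := by
  classical
  induction s using Finset.induction with
  | empty => exact ⟨0, by simp⟩
  | insert a s ha ih =>
    simp only [Finset.prod_insert ha]
    refine exists_mul_ne_zero_of_polyFun (hf a (by simp)) ?_ (hf0 a (by simp)) ?_
    · exact prod_mem_polyFun _ fun i hi => hf i (by simp [hi])
    · exact ih (fun i hi => hf i (by simp [hi])) (fun i hi => hf0 i (by simp [hi]))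

/-- Evaluation at a point, as a ring homomorphism. -/
def polyFunEval (x : M) : polyFun M →+* ℂ :=
  (Pi.evalRingHom (fun _ => ℂ) x).comp (polyFun M).subtype

@[simp] lemma polyFunEval_apply (x : M) (f : polyFun M) : polyFunEval x f = f.1 x := rfl

lemma exists_lift_of_polyFun_prod {P : M × ℂ → ℂ} (hP : P ∈ polyFun (M × ℂ)) :
    ∃ p : Polynomial (polyFun M), ∀ x t, (p.map (polyFunEval x)).eval t = P (x, t) := by
  refine polyFun_induction
    (p := fun P => ∃ p : Polynomial (polyFun M), ∀ x t, (p.map (polyFunEval x)).eval t = P (x, t))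
    (fun φ => ?_) (fun c => ⟨.C ⟨_, const_mem_polyFun c⟩, by simp⟩) ?_ ?_ hP
  · refine ⟨.C ⟨_, dual_mem_polyFun (φ ∘ₗ LinearMap.inl ℂ M ℂ)⟩ +
      .C ⟨_, const_mem_polyFun (φ (0, 1))⟩ * .X, fun x t => ?_⟩
    have : ((x, t) : M × ℂ) = (x, 0) + t • (0, 1) := by simp
    change _ = φ (x, t)
    rw [this, map_add, map_smul]
    simp only [Polynomial.map_add, Polynomial.map_mul, Polynomial.map_C, Polynomial.map_X,
      Polynomial.eval_add, Polynomial.eval_mul, Polynomial.eval_C, Polynomial.eval_X,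
      polyFunEval_apply, smul_eq_mul, LinearMap.comp_apply, LinearMap.inl_apply, mul_comm]
  · rintro f g ⟨p, hp⟩ ⟨q, hq⟩
    exact ⟨p + q, fun x t => by simp [hp, hq]⟩
  · rintro f g ⟨p, hp⟩ ⟨q, hq⟩
    exact ⟨p * q, fun x t => by simp [hp, hq]⟩

/-- Elimination of a root: if `f = ∑ cₖ tᵏ` has coefficients that are polynomial functions, then
the condition that `f` has degree `d` and that `P` vanishes at no root of `f` is Zariski open. -/
lemma exists_elimination {d : ℕ} {c : ℕ → M → ℂ} (hc : ∀ k, c k ∈ polyFun M) {P : M × ℂ → ℂ}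
    (hP : P ∈ polyFun (M × ℂ)) :
    ∃ R ∈ polyFun M, ∀ x, R x ≠ 0 ↔
      c d x ≠ 0 ∧ ∀ t, ∑ k ∈ Finset.range (d + 1), c k x * t ^ k = 0 → P (x, t) ≠ 0 := by
  obtain ⟨p, hp⟩ := exists_lift_of_polyFun_prod hP
  let f : Polynomial (polyFun M) := ∑ k ∈ Finset.range (d + 1), .C ⟨c k, hc k⟩ * .X ^ k
  let R := Polynomial.resultant f p d p.natDegree
  refine ⟨fun x => c d x * R.1 x, mul_mem_polyFun (hc d) R.2, fun x => ?_⟩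
  rw [mul_ne_zero_iff]
  refine and_congr_right fun hd => ?_
  have hev (t : ℂ) : (f.map (polyFunEval x)).eval t
      = ∑ k ∈ Finset.range (d + 1), c k x * t ^ k := by
    simp [f, Polynomial.map_sum, Polynomial.eval_finsetSum]
  have hfmap : f.map (polyFunEval x) = ∑ k ∈ Finset.range (d + 1), .C (c k x) * .X ^ k := by
    simp [f, Polynomial.map_sum]
  have hdeg : (f.map (polyFunEval x)).natDegree = d := by
    apply le_antisymm
    · rw [hfmap]
      refine Polynomial.natDegree_sum_le_of_forall_le _ _ fun k hk => ?_
      exact (Polynomial.natDegree_C_mul_X_pow_le _ _).trans (by simpa [Nat.lt_succ_iff] using hk)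
    · apply Polynomial.le_natDegree_of_ne_zero
      rw [hfmap, Polynomial.finsetSum_coeff]
      simpa [Polynomial.coeff_C_mul, Polynomial.coeff_X_pow] using hd
  have hf0 : f.map (polyFunEval x) ≠ 0 := by
    intro h
    have : (f.map (polyFunEval x)).coeff d = c d x := by
      rw [hfmap, Polynomial.finsetSum_coeff]
      simp [Polynomial.coeff_C_mul, Polynomial.coeff_X_pow]
    rw [h] at this
    exact hd (by simpa using this.symm)
  have hR : R.1 x = Polynomial.resultant (f.map (polyFunEval x)) (p.map (polyFunEval x)) d
      p.natDegree := by
    rw [Polynomial.resultant_map_map]; rfl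
  have h2 := Polynomial.resultant_eq_prod_eval (f.map (polyFunEval x)) (p.map (polyFunEval x))
    p.natDegree Polynomial.natDegree_map_le (IsAlgClosed.splits _)
  rw [hdeg] at h2
  rw [hR, h2]
  have h3 : (f.map (polyFunEval x)).leadingCoeff ^ p.natDegree ≠ 0 :=
    pow_ne_zero _ (by simpa using hf0)
  rw [mul_ne_zero_iff, and_iff_right h3, Ne, Multiset.prod_eq_zero_iff]
  simp only [Multiset.mem_map, not_exists, not_and, Polynomial.mem_roots hf0, Polynomial.IsRoot,
    hev, hp]

lemma encard_roots_eq {d : ℕ} {c : ℕ → ℂ} (hd : c d ≠ 0)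
    (h : ∀ t, ∑ k ∈ Finset.range (d + 1), c k * t ^ k = 0 →
      ∑ k ∈ Finset.range (d + 1), c k * (k * t ^ (k - 1)) ≠ 0) :
    {t | ∑ k ∈ Finset.range (d + 1), c k * t ^ k = 0}.encard = d := by
  let f : Polynomial ℂ := ∑ k ∈ Finset.range (d + 1), .C (c k) * .X ^ k
  have hev (t : ℂ) : f.eval t = ∑ k ∈ Finset.range (d + 1), c k * t ^ k := by
    simp [f, Polynomial.eval_finsetSum]
  have hdev (t : ℂ) : f.derivative.eval t
      = ∑ k ∈ Finset.range (d + 1), c k * (k * t ^ (k - 1)) := by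
    simp [f, Polynomial.eval_finsetSum, Polynomial.derivative_X_pow]
  have hcoeff : f.coeff d = c d := by
    simp [f, Polynomial.coeff_C_mul, Polynomial.coeff_X_pow]
  have hdeg : f.natDegree = d := by
    apply le_antisymm
    · refine Polynomial.natDegree_sum_le_of_forall_le _ _ fun k hk => ?_
      exact (Polynomial.natDegree_C_mul_X_pow_le _ _).trans (by simpa [Nat.lt_succ_iff] using hk)
    · exact Polynomial.le_natDegree_of_ne_zero (by rwa [hcoeff])
  have hf0 : f ≠ 0 := by
    intro h0
    exact hd (by rw [← hcoeff, h0]; simp)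
  have hsep : f.roots.Nodup := by
    refine Polynomial.nodup_roots_iff_of_splits hf0 (IsAlgClosed.splits f) |>.2 ?_
    rw [Polynomial.separable_def]
    by_contra hco
    rw [Polynomial.isCoprime_iff_aeval_ne_zero_of_isAlgClosed ℂ ℂ] at hco
    push Not at hco
    obtain ⟨t, h1, h2⟩ := hco
    simp only [Polynomial.coe_aeval_eq_eval] at h1 h2
    exact h t (by rw [← hev]; exact h1) (by rw [← hdev]; exact h2)
  have : {t | ∑ k ∈ Finset.range (d + 1), c k * t ^ k = 0} = (f.roots.toFinset : Set ℂ) := by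
    ext t
    simp [Polynomial.mem_roots hf0, ← hev]
  rw [this, Set.encard_coe_eq_coe_finsetCard, Multiset.toFinset_card_of_nodup hsep,
    ← (IsAlgClosed.splits f).natDegree_eq_card_roots, hdeg]

end PolyFun

/-! ### Flags spanned by bases -/

section FlagOf

variable {X : Type*} [AddCommGroup X] [Module ℂ X] {n : ℕ}

lemma finrank_span_initial (v : Basis (Fin n) ℂ X) (j : ℕ) :
    finrank ℂ (Submodule.span ℂ (v '' {i | (i : ℕ) < j})) = min j n := by
  classical
  have : Fintype (v '' {i | (i : ℕ) < j}) := Fintype.ofFinite _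
  rw [finrank_span_set_eq_card]
  · rw [Set.toFinset_card, Fintype.card_congr (Equiv.Set.image v _ v.injective).symm]
    simp only [Set.coe_ofPred]
    rw [Fintype.card_subtype, Fin.card_filter_val_lt]
    exact min_comm _ _
  · exact v.linearIndependent.linearIndepOn_id.mono (Set.image_subset_range _ _)

/-- The flag spanned by the initial segments of a basis. -/
def flagOf (v : Basis (Fin n) ℂ X) : CompleteFlag X where
  space j := Submodule.span ℂ (v '' {i | (i : ℕ) < j})
  mono i j hij := Submodule.span_mono (Set.image_mono fun k (hk : (k : ℕ) < i) => hk.trans_le hij)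
  finrank_space j := by rw [finrank_span_initial, Module.finrank_eq_card_basis v, Fintype.card_fin]

lemma flagOf_space (v : Basis (Fin n) ℂ X) (j : ℕ) :
    (flagOf v).space j = Submodule.span ℂ (v '' {i | (i : ℕ) < j}) := rfl

lemma mem_flagOf (v : Basis (Fin n) ℂ X) {j : ℕ} (i : Fin n) (h : (i : ℕ) < j) :
    v i ∈ (flagOf v).space j := Submodule.subset_span ⟨i, h, rfl⟩

lemma mem_flagOf_iff (v : Basis (Fin n) ℂ X) {j : ℕ} {x : X} :
    x ∈ (flagOf v).space j ↔ ∀ i : Fin n, j ≤ i → v.coord i x = 0 := by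
  rw [flagOf_space, v.mem_span_image]
  simp only [Set.subset_def, Finset.mem_coe, Finsupp.mem_support_iff, Set.mem_ofPred_eq,
    Basis.coord_apply]
  exact forall_congr' fun i => by rw [not_imp_comm, not_lt]

lemma isAdapted_flagOf (v : Basis (Fin (finrank ℂ X)) ℂ X) : IsAdapted v (flagOf v) :=
  fun _ => rfl

lemma IsAdapted.eq_flagOf {v : Basis (Fin (finrank ℂ X)) ℂ X} {F : CompleteFlag X}
    (h : IsAdapted v F) : F = flagOf v := by
  ext1; funext j; exact h j

/-- A basis whose initial segments lie in a flag spans that flag. -/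
lemma flagOf_eq (v : Basis (Fin n) ℂ X) (F : CompleteFlag X)
    (h : ∀ i : Fin n, v i ∈ F.space (i + 1)) : flagOf v = F := by
  have : FiniteDimensional ℂ X := v.finiteDimensional_of_finite
  ext1; funext j
  refine Submodule.eq_of_le_of_finrank_eq ?_ ?_
  · rw [flagOf_space, Submodule.span_le]
    rintro _ ⟨i, hi, rfl⟩
    exact F.mono (Nat.succ_le_of_lt hi) (h i)
  · rw [(flagOf v).finrank_space, F.finrank_space]

variable {ι : Type*}

lemma exists_evalBases_eq [Finite ι] {q : (ι → Fin (finrank ℂ X) → X) → ℂ}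
    (hq : q ∈ polyFun (ι → Fin (finrank ℂ X) → X)) :
    ∃ p : MvPolynomial (ι × Fin (finrank ℂ X) × Module.Dual ℂ X) ℂ,
      ∀ v : ι → Basis (Fin (finrank ℂ X)) ℂ X, evalBases p v = q fun i j => v i j := by
  classical
  have := Fintype.ofFinite ι
  refine polyFun_induction (p := fun q => ∃ p : MvPolynomial (ι × Fin (finrank ℂ X) ×
    Module.Dual ℂ X) ℂ, ∀ v : ι → Basis (Fin (finrank ℂ X)) ℂ X,
      evalBases p v = q fun i j => v i j) (fun φ => ?_) (fun c => ⟨.C c, by simp [evalBases]⟩)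
      ?_ ?_ hq
  · refine ⟨∑ i, ∑ j, .X (i, j, φ ∘ₗ LinearMap.single ℂ (fun _ => Fin (finrank ℂ X) → X) i ∘ₗ
      LinearMap.single ℂ (fun _ => X) j), fun v => ?_⟩
    simp only [evalBases, map_sum, MvPolynomial.eval_X, LinearMap.comp_apply]
    simp only [← map_sum]
    congr 1
    ext i j
    simp [Finset.sum_apply, Pi.single_apply, ite_apply]
  · rintro f g ⟨p, hp⟩ ⟨q, hq⟩
    exact ⟨p + q, fun v => by simp [← hp, ← hq, evalBases]⟩
  · rintro f g ⟨p, hp⟩ ⟨q, hq⟩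
    exact ⟨p * q, fun v => by simp [← hp, ← hq, evalBases]⟩

lemma exists_polyFun_eq_evalBases (p : MvPolynomial (ι × Fin (finrank ℂ X) × Module.Dual ℂ X) ℂ) :
    ∃ q ∈ polyFun (ι → Fin (finrank ℂ X) → X),
      ∀ v : ι → Basis (Fin (finrank ℂ X)) ℂ X, evalBases p v = q fun i j => v i j := by
  induction p using MvPolynomial.induction_on with
  | C c => exact ⟨_, const_mem_polyFun c, by simp [evalBases]⟩
  | add p q hp hq =>
    obtain ⟨f, hf, hf'⟩ := hp
    obtain ⟨g, hg, hg'⟩ := hq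
    refine ⟨_, add_mem_polyFun hf hg, fun v => ?_⟩
    rw [← hf', ← hg']
    simp [evalBases]
  | mul_X p x hp =>
    obtain ⟨f, hf, hf'⟩ := hp
    refine ⟨_, mul_mem_polyFun hf (dual_mem_polyFun
      (x.2.2 ∘ₗ LinearMap.proj x.2.1 ∘ₗ LinearMap.proj x.1)), fun v => ?_⟩
    rw [← hf']
    simp [evalBases]

/-- The locus of tuples of flags that have an adapted tuple of bases at which one of the
given polynomial functions does not vanish. -/
def nonvanishingLocus {κ : Type*} (q : κ → (ι → Fin n → X) → ℂ) : Set (ι → CompleteFlag X) :=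
  {F | ∃ (k : κ) (v : ι → Basis (Fin n) ℂ X), (∀ i, F i = flagOf (v i)) ∧ q k (fun i j => v i j) ≠ 0}

lemma isZariskiOpen_nonvanishingLocus [Finite ι] (hn : finrank ℂ X = n) {κ : Type*}
    {q : κ → (ι → Fin n → X) → ℂ} (hq : ∀ k, q k ∈ polyFun (ι → Fin n → X)) :
    IsZariskiOpen (nonvanishingLocus q) := by
  subst hn
  rintro F ⟨k, v, hv, hqv⟩
  obtain ⟨p, hp⟩ := exists_evalBases_eq (hq k)
  refine ⟨p, ⟨v, fun i => hv i ▸ isAdapted_flagOf _, by rwa [hp]⟩, fun v' F' h hp' => ?_⟩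
  exact ⟨k, v', fun i => (h i).eq_flagOf, by rwa [← hp]⟩

lemma exists_polyFun_of_isZariskiOpen (hn : finrank ℂ X = n) {O : Set (ι → CompleteFlag X)}
    (hO : IsZariskiOpen O) (hne : O.Nonempty) :
    ∃ q ∈ polyFun (ι → Fin n → X), (∃ v : ι → Basis (Fin n) ℂ X, q (fun i j => v i j) ≠ 0) ∧
      ∀ v : ι → Basis (Fin n) ℂ X, q (fun i j => v i j) ≠ 0 → (fun i => flagOf (v i)) ∈ O := by
  subst hn
  obtain ⟨F, hF⟩ := hne
  obtain ⟨p, ⟨v, -, hpv⟩, hp⟩ := hO F hF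
  obtain ⟨q, hq, hpq⟩ := exists_polyFun_eq_evalBases p
  exact ⟨q, hq, ⟨v, by rwa [← hpq]⟩, fun w hw =>
    hp w _ (fun i => isAdapted_flagOf _) (by rwa [hpq])⟩

lemma exists_flagOf_eq (hn : finrank ℂ X = n) [FiniteDimensional ℂ X] (F : CompleteFlag X) :
    ∃ v : Basis (Fin n) ℂ X, F = flagOf v := by
  subst hn
  have hlt (i : Fin (finrank ℂ X)) : F.space i < F.space (i + 1) := by
    refine lt_of_le_of_ne (F.mono (Nat.le_succ _)) fun h => ?_
    have h1 := F.finrank_space i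
    have h2 := F.finrank_space (i + 1)
    rw [← h] at h2
    have := i.2
    omega
  choose v hv hv' using fun i => SetLike.exists_of_lt (hlt i)
  have hspan (j : ℕ) (hj : j ≤ finrank ℂ X) :
      F.space j ≤ Submodule.span ℂ (Set.range v) := by
    induction j with
    | zero =>
      have := F.finrank_space 0
      rw [Nat.zero_min, Submodule.finrank_eq_zero] at this
      simp [this]
    | succ j ih =>
      have h1 := F.finrank_space j
      have h2 := F.finrank_space (j + 1)
      rw [min_eq_left (by omega)] at h1 h2
      have h3 : F.space j ⊔ Submodule.span ℂ {v ⟨j, hj⟩} = F.space (j + 1) := by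
        refine Submodule.eq_of_le_of_finrank_le ?_ ?_
        · refine sup_le (F.mono (Nat.le_succ _)) ?_
          rw [Submodule.span_singleton_le_iff_mem]
          exact hv ⟨j, hj⟩
        · rw [h2]
          refine Nat.succ_le_of_lt (lt_of_eq_of_lt h1.symm ?_)
          refine Submodule.finrank_lt_finrank_of_lt (lt_of_le_of_ne le_sup_left fun h => ?_)
          apply hv' ⟨j, hj⟩
          change _ ∈ F.space j
          rw [h]
          exact Submodule.mem_sup_right (Submodule.mem_span_singleton_self _)
      rw [← h3]
      refine sup_le (ih (by omega)) ?_
      rw [Submodule.span_singleton_le_iff_mem]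
      exact Submodule.subset_span ⟨_, rfl⟩
  have htop : ⊤ ≤ Submodule.span ℂ (Set.range v) := by
    refine le_trans (Eq.ge ?_) (hspan _ le_rfl)
    apply Submodule.eq_top_of_finrank_eq
    rw [F.finrank_space, min_self]
  refine ⟨basisOfTopLeSpanOfCardEqFinrank v htop (by simp), (flagOf_eq _ _ fun i => ?_).symm⟩
  simpa using hv i

end FlagOf

/-! ### Dimension counts -/

section Dimension

variable {X : Type*} [AddCommGroup X] [Module ℂ X]

lemma exists_ne_zero_of_one_le_finrank {P : Submodule ℂ X} (h : 1 ≤ finrank ℂ P) :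
    ∃ x ∈ P, x ≠ 0 := by
  have : P ≠ ⊥ := by
    rintro rfl
    simp at h
  exact P.ne_bot_iff.1 this

lemma finrank_span_pair_eq_two {p q : X} (hp : p ≠ 0) (hq : q ∉ Submodule.span ℂ {p}) :
    finrank ℂ (Submodule.span ℂ {p, q}) = 2 := by
  have hli : LinearIndependent ℂ ![p, q] := by
    rw [LinearIndependent.pair_iff' hp]
    intro a ha
    exact hq (Submodule.mem_span_singleton.2 ⟨a, ha⟩)
  have := finrank_span_eq_card hli
  rwa [Matrix.range_cons_cons_empty, Fintype.card_fin] at this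

lemma exists_plane_between {S : Submodule ℂ X} {p : X} (hp : p ∈ S) (hp0 : p ≠ 0)
    (hS : 2 ≤ finrank ℂ S) : ∃ h ≤ S, p ∈ h ∧ finrank ℂ h = 2 := by
  obtain ⟨q, hqS, hq⟩ : ∃ q ∈ S, q ∉ Submodule.span ℂ {p} := by
    by_contra! hcon
    have h1 : S ≤ Submodule.span ℂ {p} := hcon
    have := Submodule.finrank_mono h1
    rw [finrank_span_singleton hp0] at this
    omega
  refine ⟨Submodule.span ℂ {p, q}, ?_, Submodule.subset_span (by simp),
    finrank_span_pair_eq_two hp0 hq⟩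
  rw [Submodule.span_le]
  rintro x (rfl | rfl) <;> assumption

variable [FiniteDimensional ℂ X]

lemma finrank_add_le_finrank_inf_add {P Q R : Submodule ℂ X} (hP : P ≤ R) (hQ : Q ≤ R) :
    finrank ℂ P + finrank ℂ Q ≤ finrank ℂ (P ⊓ Q : Submodule ℂ X) + finrank ℂ R := by
  rw [← Submodule.finrank_sup_add_finrank_inf_eq P Q, add_comm]
  exact Nat.add_le_add_left (Submodule.finrank_mono (sup_le hP hQ)) _

lemma finrank_add_le_finrank_inf_add_finrank (P Q : Submodule ℂ X) :
    finrank ℂ P + finrank ℂ Q ≤ finrank ℂ (P ⊓ Q : Submodule ℂ X) + finrank ℂ X := by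
  rw [← finrank_top ℂ X]
  exact finrank_add_le_finrank_inf_add le_top le_top

lemma finrank_map_mkQ_add (V S : Submodule ℂ X) :
    finrank ℂ (S.map V.mkQ) + finrank ℂ (S ⊓ V : Submodule ℂ X) = finrank ℂ S := by
  have h := LinearMap.finrank_range_add_finrank_ker (V.mkQ.domRestrict S)
  rw [LinearMap.range_domRestrict, LinearMap.ker_domRestrict, Submodule.ker_mkQ] at h
  rw [← h, ← Submodule.map_comap_subtype]
  congr 1
  exact LinearEquiv.finrank_eq (Submodule.equivMapOfInjective _ S.subtype_injective _).symm

lemma one_le_finrank_of_mem {P : Submodule ℂ X} {x : X} (hx : x ∈ P) (h0 : x ≠ 0) :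
    1 ≤ finrank ℂ P :=
  Submodule.one_le_finrank_iff.2 (P.ne_bot_iff.2 ⟨x, hx, h0⟩)

end Dimension

/-! ### The geometry of the fibrations

The natural number `e` is the number of flags that meet the base plane in a special position:
`e = 1` for the base problem `(2,1)·□³` and `e = 2` for the base problem `(2)·□⁴`. These `e` flags
are followed by three flags that impose a condition `□`. -/

section Geometry

variable {X : Type*} [AddCommGroup X] [Module ℂ X] {s e b : ℕ}

/-- The index of the `k`-th flag that imposes a condition `□` on the base plane. -/
def boxIdx (hs : e + 3 ≤ s) (k : Fin 3) : Fin s := ⟨e + k, by omega⟩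

/-- The index of the first flag. -/
def idxZero (hs : e + 3 ≤ s) : Fin s := ⟨0, by omega⟩

/-- The index of the second flag. -/
def idxOne (hs : e + 3 ≤ s) : Fin s := ⟨1, by omega⟩

/-- The five-dimensional subspace `V` attached to an instance. -/
def baseSpace (hs : e + 3 ≤ s) (F : Fin s → CompleteFlag X) : Submodule ℂ X :=
  if e = 1 then (F (idxZero hs)).space 5
  else (F (idxZero hs)).space 2 ⊔ (F (idxOne hs)).space 3

/-- The `m`-th subspace of the `i`-th flag of the fibre comes from the subspace of dimension
`offset e i + m` of the `i`-th flag. -/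
def offset (e i : ℕ) : ℕ := if i < e then 6 - e else if i < e + 3 then 2 else 3

/-- The dimension of the intersection of the base plane with `F_{offset + m}`. -/
def rankDrop (e i : ℕ) : ℕ := if i < e then 3 - e else 0

/-- The dimension of the largest subspace of the `i`-th flag contained in `V`. -/
def plateau (e i : ℕ) : ℕ := if i < e then (if e = 1 then 5 else 2 + i) else 0

/-- The solutions of the base problem, as planes in the ambient space. -/
structure IsBasePlane (b : ℕ) (hs : e + 3 ≤ s) (F : Fin s → CompleteFlag X)
    (h : Submodule ℂ X) : Prop where
  finrank_eq : finrank ℂ h = 2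
  point : 1 ≤ finrank ℂ (h ⊓ (F (idxZero hs)).space 2 : Submodule ℂ X)
  le_of_eq_one : e = 1 → h ≤ (F (idxZero hs)).space 4
  point_of_eq_two : e = 2 → 1 ≤ finrank ℂ (h ⊓ (F (idxOne hs)).space 3 : Submodule ℂ X)
  box : ∀ k, 1 ≤ finrank ℂ (h ⊓ (F (boxIdx hs k)).space (b + 3) : Submodule ℂ X)

/-- The intersection of the three hyperplanes `F_{b+3} + h`. -/
def hull (b : ℕ) (hs : e + 3 ≤ s) (F : Fin s → CompleteFlag X) (h : Submodule ℂ X) :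
    Submodule ℂ X :=
  ⨅ k, (F (boxIdx hs k)).space (b + 3) ⊔ h

lemma le_hull (hs : e + 3 ≤ s) (F : Fin s → CompleteFlag X) (h : Submodule ℂ X) :
    h ≤ hull b hs F h := le_iInf fun _ => le_sup_right

/-- The flags are in sufficiently general position for the instance to be fibered. -/
structure IsGenericInstance (b : ℕ) (hs : e + 3 ≤ s) (F : Fin s → CompleteFlag X) : Prop where
  finrank_baseSpace : finrank ℂ (baseSpace hs F) = 5
  plateau_le : ∀ i : Fin s, (i : ℕ) < e + 3 → (F i).space (plateau e i) ≤ baseSpace hs F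
  inf_le_plateau : ∀ i : Fin s, (i : ℕ) < e + 3 →
    (F i).space (b + plateau e i) ⊓ baseSpace hs F ≤ (F i).space (plateau e i)
  hull_inf_le : ∀ h, IsBasePlane b hs F h → hull b hs F h ⊓ baseSpace hs F ≤ h
  offset_inf_le : ∀ h, IsBasePlane b hs F h → ∀ i : Fin s,
    (F i).space (offset e i) ⊓ hull b hs F h ≤ baseSpace hs F
  finrank_inf_le : ∀ h, IsBasePlane b hs F h → ∀ i : Fin s,
    finrank ℂ ((F i).space (offset e i + b) ⊓ h : Submodule ℂ X) ≤ rankDrop e i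

lemma offset_le_five (he : e = 1 ∨ e = 2) (i : ℕ) : offset e i ≤ 5 := by
  rcases he with rfl | rfl <;> unfold offset <;> split_ifs <;> norm_num

lemma offset_boxIdx (hs : e + 3 ≤ s) (k : Fin 3) : offset e (boxIdx hs k) = 2 := by
  rw [offset, boxIdx, if_neg (by simp), if_pos (by simp)]

lemma rankDrop_boxIdx (hs : e + 3 ≤ s) (k : Fin 3) : rankDrop e (boxIdx hs k) = 0 := by
  simp [rankDrop, boxIdx]

variable [FiniteDimensional ℂ X] {hs : e + 3 ≤ s} {F : Fin s → CompleteFlag X}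
  {h : Submodule ℂ X}

namespace IsGenericInstance

lemma inf_eq_bot (hF : IsGenericInstance b hs F) (he : e = 2) (hX : finrank ℂ X = 5 + b) :
    (F (idxZero hs)).space 2 ⊓ (F (idxOne hs)).space 3 = ⊥ := by
  have h1 := hF.finrank_baseSpace
  have h2 := Submodule.finrank_sup_add_finrank_inf_eq ((F (idxZero hs)).space 2)
    ((F (idxOne hs)).space 3)
  rw [baseSpace, if_neg (by omega)] at h1
  rw [h1, (F _).finrank_space, (F _).finrank_space, hX] at h2
  rw [← Submodule.finrank_eq_zero (R := ℂ)]
  omega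

lemma le_baseSpace (hF : IsGenericInstance b hs F) (he : e = 1 ∨ e = 2)
    (hX : finrank ℂ X = 5 + b) (hh : IsBasePlane b hs F h) : h ≤ baseSpace hs F := by
  rcases he with rfl | rfl
  · rw [baseSpace, if_pos rfl]
    exact (hh.le_of_eq_one rfl).trans ((F _).mono (by norm_num))
  · rw [baseSpace, if_neg (by norm_num)]
    have h0 := hF.inf_eq_bot rfl hX
    set P := (F (idxZero hs)).space 2
    set Q := (F (idxOne hs)).space 3
    have h1 : (h ⊓ P) ⊔ (h ⊓ Q) = h := by
      apply Submodule.eq_of_le_of_finrank_le (sup_le inf_le_left inf_le_left)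
      have h2 := Submodule.finrank_sup_add_finrank_inf_eq (h ⊓ P) (h ⊓ Q)
      have h3 : h ⊓ P ⊓ (h ⊓ Q) = ⊥ := by
        rw [eq_bot_iff, ← h0]
        exact inf_le_inf inf_le_right inf_le_right
      rw [h3, finrank_bot] at h2
      have h4 := hh.point
      have h5 := hh.point_of_eq_two rfl
      rw [hh.finrank_eq]
      change 1 ≤ finrank ℂ (h ⊓ P : Submodule ℂ X) at h4
      change 1 ≤ finrank ℂ (h ⊓ Q : Submodule ℂ X) at h5
      omega
    rw [← h1]
    exact sup_le_sup inf_le_right inf_le_right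

lemma hull_inf_baseSpace (hF : IsGenericInstance b hs F) (he : e = 1 ∨ e = 2)
    (hX : finrank ℂ X = 5 + b) (hh : IsBasePlane b hs F h) :
    hull b hs F h ⊓ baseSpace hs F = h :=
  le_antisymm (hF.hull_inf_le h hh) (le_inf (le_hull hs F h) (hF.le_baseSpace he hX hh))

lemma finrank_box_inf (hF : IsGenericInstance b hs F) (hX : finrank ℂ X = 5 + b)
    (hh : IsBasePlane b hs F h) (k : Fin 3) :
    finrank ℂ ((F (boxIdx hs k)).space (b + 3) ⊓ h : Submodule ℂ X) = 1 := by
  have h1 := hF.finrank_inf_le h hh (boxIdx hs k)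
  rw [offset_boxIdx, rankDrop_boxIdx] at h1
  have h2 := finrank_add_le_finrank_inf_add (P := (F (boxIdx hs k)).space (b + 3) ⊓ h)
    (Q := (F (boxIdx hs k)).space (2 + b)) (R := (F (boxIdx hs k)).space (b + 3)) inf_le_left
    ((F _).mono (by omega))
  have h3 : (F (boxIdx hs k)).space (b + 3) ⊓ h ⊓ (F (boxIdx hs k)).space (2 + b) ≤
      (F (boxIdx hs k)).space (2 + b) ⊓ h := by
    intro x hx
    exact ⟨hx.2, hx.1.2⟩
  have h4 := Submodule.finrank_mono h3
  have h5 := hh.box k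
  rw [inf_comm] at h5
  rw [(F _).finrank_space, (F _).finrank_space, hX] at h2
  omega

lemma finrank_box_sup (hF : IsGenericInstance b hs F) (hX : finrank ℂ X = 5 + b)
    (hh : IsBasePlane b hs F h) (k : Fin 3) :
    finrank ℂ ((F (boxIdx hs k)).space (b + 3) ⊔ h : Submodule ℂ X) = b + 4 := by
  have h1 := Submodule.finrank_sup_add_finrank_inf_eq ((F (boxIdx hs k)).space (b + 3)) h
  rw [hF.finrank_box_inf hX hh, hh.finrank_eq, (F _).finrank_space, hX] at h1
  omega

lemma le_finrank_hull (hF : IsGenericInstance b hs F) (hX : finrank ℂ X = 5 + b)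
    (hh : IsBasePlane b hs F h) : b + 2 ≤ finrank ℂ (hull b hs F h) := by
  set S := fun k => (F (boxIdx hs k)).space (b + 3) ⊔ h with hS
  have h0 : S 0 ⊓ S 1 ⊓ S 2 ≤ hull b hs F h := by
    refine le_iInf fun k => ?_
    fin_cases k
    exacts [inf_le_left.trans inf_le_left, inf_le_left.trans inf_le_right, inf_le_right]
  have h1 := finrank_add_le_finrank_inf_add_finrank (S 0) (S 1)
  have h2 := finrank_add_le_finrank_inf_add_finrank (S 0 ⊓ S 1) (S 2)
  have h3 := Submodule.finrank_mono h0
  have h4 := fun k => hF.finrank_box_sup hX hh k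
  have h5 := h4 0
  have h6 := h4 1
  have h7 := h4 2
  change finrank ℂ (S 0) = _ at h5
  change finrank ℂ (S 1) = _ at h6
  change finrank ℂ (S 2) = _ at h7
  omega

lemma finrank_hull (hF : IsGenericInstance b hs F) (he : e = 1 ∨ e = 2)
    (hX : finrank ℂ X = 5 + b) (hh : IsBasePlane b hs F h) :
    finrank ℂ (hull b hs F h) = b + 2 := by
  refine le_antisymm ?_ (hF.le_finrank_hull hX hh)
  have h1 := finrank_add_le_finrank_inf_add_finrank (hull b hs F h) (baseSpace hs F)
  rw [hF.hull_inf_baseSpace he hX hh, hF.finrank_baseSpace, hh.finrank_eq] at h1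
  omega

lemma hull_sup_baseSpace (hF : IsGenericInstance b hs F) (he : e = 1 ∨ e = 2)
    (hX : finrank ℂ X = 5 + b) (hh : IsBasePlane b hs F h) :
    hull b hs F h ⊔ baseSpace hs F = ⊤ := by
  apply Submodule.eq_top_of_finrank_eq
  have h1 := Submodule.finrank_sup_add_finrank_inf_eq (hull b hs F h) (baseSpace hs F)
  rw [hF.hull_inf_baseSpace he hX hh, hF.finrank_baseSpace, hh.finrank_eq,
    hF.finrank_hull he hX hh] at h1
  omega

lemma finrank_quotient (hF : IsGenericInstance b hs F) (hX : finrank ℂ X = 5 + b) :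
    finrank ℂ (X ⧸ baseSpace hs F) = b := by
  have := Submodule.finrank_quotient_add_finrank (baseSpace hs F)
  rw [hF.finrank_baseSpace] at this
  omega

lemma le_finrank_inf_hull (hF : IsGenericInstance b hs F) (he : e = 1 ∨ e = 2)
    (hX : finrank ℂ X = 5 + b) (hh : IsBasePlane b hs F h) (i : Fin s) {m : ℕ} (hm : m ≤ b) :
    m + rankDrop e i ≤
      finrank ℂ ((F i).space (offset e i + m) ⊓ hull b hs F h : Submodule ℂ X) := by
  have hZ := hF.finrank_hull he hX hh
  by_cases hi : e ≤ i ∧ (i : ℕ) < e + 3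
  · obtain ⟨k, rfl⟩ : ∃ k, i = boxIdx hs k :=
      ⟨⟨i - e, by omega⟩, Fin.ext (by simp [boxIdx]; omega)⟩
    rw [offset_boxIdx, rankDrop_boxIdx]
    have h1 := finrank_add_le_finrank_inf_add (P := (F (boxIdx hs k)).space (2 + m))
      (Q := hull b hs F h) (R := (F (boxIdx hs k)).space (b + 3) ⊔ h)
      (le_sup_of_le_left ((F _).mono (by omega))) (iInf_le _ k)
    rw [hF.finrank_box_sup hX hh, (F _).finrank_space, hX, hZ] at h1
    omega
  · have h1 := finrank_add_le_finrank_inf_add_finrank ((F i).space (offset e i + m))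
      (hull b hs F h)
    have h2 : rankDrop e i + 3 = offset e i := by
      unfold rankDrop offset
      split_ifs <;> omega
    have h3 := offset_le_five he i
    rw [(F _).finrank_space, hX, hZ] at h1
    omega

lemma finrank_map_fiber_le (hF : IsGenericInstance b hs F) (hX : finrank ℂ X = 5 + b)
    (hh : IsBasePlane b hs F h) (i : Fin s) (m : ℕ) :
    finrank ℂ (((F i).space (offset e i + m) ⊓ hull b hs F h).map (baseSpace hs F).mkQ) ≤ m := by
  set S := (F i).space (offset e i + m) ⊓ hull b hs F h with hS
  have h1 := finrank_map_mkQ_add (baseSpace hs F) S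
  have h2 := finrank_add_le_finrank_inf_add (P := S) (Q := (F i).space (offset e i))
    (R := (F i).space (offset e i + m)) inf_le_left ((F i).mono (by omega))
  have h3 : S ⊓ (F i).space (offset e i) ≤ S ⊓ baseSpace hs F := by
    refine le_inf inf_le_left (le_trans ?_ (hF.offset_inf_le h hh i))
    exact le_inf inf_le_right (inf_le_left.trans inf_le_right)
  have h4 := Submodule.finrank_mono h3
  rw [(F _).finrank_space, (F _).finrank_space, hX] at h2
  omega

lemma finrank_inf_le' (hF : IsGenericInstance b hs F)
    (hh : IsBasePlane b hs F h) (i : Fin s) {m : ℕ} (hm : m ≤ b) :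
    finrank ℂ ((F i).space (offset e i + m) ⊓ hull b hs F h ⊓ baseSpace hs F : Submodule ℂ X)
      ≤ rankDrop e i := by
  refine le_trans (Submodule.finrank_mono ?_) (hF.finrank_inf_le h hh i)
  rw [inf_assoc]
  exact inf_le_inf ((F i).mono (by omega)) (hF.hull_inf_le h hh)

lemma finrank_map_fiber (hF : IsGenericInstance b hs F) (he : e = 1 ∨ e = 2)
    (hX : finrank ℂ X = 5 + b) (hh : IsBasePlane b hs F h) (i : Fin s) (m : ℕ) :
    finrank ℂ (((F i).space (offset e i + m) ⊓ hull b hs F h).map (baseSpace hs F).mkQ)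
      = min m b := by
  have key (m : ℕ) (hm : m ≤ b) : m ≤ finrank ℂ
      (((F i).space (offset e i + m) ⊓ hull b hs F h).map (baseSpace hs F).mkQ) := by
    have h1 := finrank_map_mkQ_add (baseSpace hs F)
      ((F i).space (offset e i + m) ⊓ hull b hs F h)
    have h2 := hF.finrank_inf_le' hh i hm
    have h3 := hF.le_finrank_inf_hull he hX hh i hm
    omega
  have hup := hF.finrank_map_fiber_le hX hh i m
  have hup2 := Submodule.finrank_le
    (((F i).space (offset e i + m) ⊓ hull b hs F h).map (baseSpace hs F).mkQ)
  rw [hF.finrank_quotient hX] at hup2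
  have hlow := key (min m b) (min_le_right _ _)
  have hmono := Submodule.finrank_mono (Submodule.map_mono (f := (baseSpace hs F).mkQ)
    (inf_le_inf_right (hull b hs F h) ((F i).mono (add_le_add_right (min_le_left m b) (offset e i)))))
  omega

lemma finrank_inf_baseSpace (hF : IsGenericInstance b hs F) (he : e = 1 ∨ e = 2)
    (hX : finrank ℂ X = 5 + b) (hh : IsBasePlane b hs F h) (i : Fin s) {m : ℕ} (hm : m ≤ b) :
    finrank ℂ ((F i).space (offset e i + m) ⊓ h : Submodule ℂ X) = rankDrop e i := by
  have h1 := finrank_map_mkQ_add (baseSpace hs F)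
    ((F i).space (offset e i + m) ⊓ hull b hs F h)
  have h2 := hF.finrank_inf_le' hh i hm
  have h3 := hF.le_finrank_inf_hull he hX hh i hm
  rw [hF.finrank_map_fiber he hX hh] at h1
  rw [inf_assoc, hF.hull_inf_baseSpace he hX hh] at h1 h2
  omega

/-- The fibre over the base plane `h`: intersecting a subspace `H` between `h` and its hull with
the flag `F i` amounts to intersecting its image with the induced flag. -/
lemma finrank_map_inf_map (hF : IsGenericInstance b hs F) (he : e = 1 ∨ e = 2)
    (hX : finrank ℂ X = 5 + b) (hh : IsBasePlane b hs F h) {H : Submodule ℂ X} (hH : h ≤ H)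
    (hH' : H ≤ hull b hs F h) (i : Fin s) {m : ℕ} (hm : m ≤ b) :
    finrank ℂ (H.map (baseSpace hs F).mkQ ⊓
      ((F i).space (offset e i + m) ⊓ hull b hs F h).map (baseSpace hs F).mkQ : Submodule ℂ _) +
      rankDrop e i = finrank ℂ (H ⊓ (F i).space (offset e i + m) : Submodule ℂ X) := by
  have h1 : H.map (baseSpace hs F).mkQ ⊓
      ((F i).space (offset e i + m) ⊓ hull b hs F h).map (baseSpace hs F).mkQ =
      (H ⊓ (F i).space (offset e i + m)).map (baseSpace hs F).mkQ := by
    apply le_antisymm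
    · rintro _ ⟨⟨p, hp, rfl⟩, ⟨q, hq, hpq⟩⟩
      refine ⟨q, ⟨?_, hq.1⟩, hpq⟩
      have h2 : q - p ∈ h := by
        apply hF.hull_inf_le h hh
        refine ⟨sub_mem hq.2 (hH' hp), ?_⟩
        simpa [Submodule.Quotient.eq] using hpq
      simpa using add_mem (hH h2) hp
    · exact le_inf (Submodule.map_mono inf_le_left)
        (Submodule.map_mono (le_inf inf_le_right (inf_le_left.trans hH')))
  have h2 := finrank_map_mkQ_add (baseSpace hs F) (H ⊓ (F i).space (offset e i + m))
  have h3 : H ⊓ (F i).space (offset e i + m) ⊓ baseSpace hs F =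
      (F i).space (offset e i + m) ⊓ h := by
    apply le_antisymm
    · intro x hx
      exact ⟨hx.1.2, hF.hull_inf_le h hh ⟨hH' hx.1.1, hx.2⟩⟩
    · intro x hx
      exact ⟨⟨hH hx.2, hx.1⟩, hF.le_baseSpace he hX hh hx.2⟩
  rw [h3, hF.finrank_inf_baseSpace he hX hh i hm] at h2
  rw [h1, h2]

/-- Every solution contains a base plane and is contained in its hull. -/
lemma exists_basePlane (hF : IsGenericInstance b hs F) (he : e = 1 ∨ e = 2)
    (hX : finrank ℂ X = 5 + b) {a : ℕ} {H : Submodule ℂ X} (hH : finrank ℂ H = 2 + a)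
    (h0 : 1 ≤ finrank ℂ (H ⊓ (F (idxZero hs)).space 2 : Submodule ℂ X))
    (h1 : e = 1 → 2 ≤ finrank ℂ (H ⊓ (F (idxZero hs)).space 4 : Submodule ℂ X))
    (h2 : e = 2 → 1 ≤ finrank ℂ (H ⊓ (F (idxOne hs)).space 3 : Submodule ℂ X))
    (h3 : ∀ k, a + 1 ≤ finrank ℂ (H ⊓ (F (boxIdx hs k)).space (b + 3) : Submodule ℂ X)) :
    ∃ h, IsBasePlane b hs F h ∧ h ≤ H ∧ H ≤ hull b hs F h := by
  have hbox (h : Submodule ℂ X) (hhH : h ≤ H) (hh2 : finrank ℂ h = 2) (k : Fin 3) :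
      1 ≤ finrank ℂ (h ⊓ (F (boxIdx hs k)).space (b + 3) : Submodule ℂ X) := by
    have h4 := finrank_add_le_finrank_inf_add (P := h)
      (Q := H ⊓ (F (boxIdx hs k)).space (b + 3)) (R := H) hhH inf_le_left
    rw [← inf_assoc, inf_eq_left.2 hhH] at h4
    have := h3 k
    omega
  obtain ⟨p, hp, hp0⟩ := exists_ne_zero_of_one_le_finrank h0
  obtain ⟨h, hhH, hh⟩ : ∃ h ≤ H, IsBasePlane b hs F h := by
    rcases he with rfl | rfl
    · obtain ⟨h, hhS, hph, hh2⟩ := exists_plane_between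
        (S := H ⊓ (F (idxZero hs)).space 4) (p := p)
        ⟨hp.1, (F _).mono (by norm_num) hp.2⟩ hp0 (h1 rfl)
      refine ⟨h, hhS.trans inf_le_left, hh2, one_le_finrank_of_mem ⟨hph, hp.2⟩ hp0,
        fun _ => hhS.trans inf_le_right, by norm_num, hbox h (hhS.trans inf_le_left) hh2⟩
    · obtain ⟨q, hq, hq0⟩ := exists_ne_zero_of_one_le_finrank (h2 rfl)
      have hpq : q ∉ Submodule.span ℂ {p} := by
        intro hqp
        have h4 : q ∈ (F (idxZero hs)).space 2 ⊓ (F (idxOne hs)).space 3 :=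
          ⟨(Submodule.span_singleton_le_iff_mem _ _).2 hp.2 hqp, hq.2⟩
        rw [hF.inf_eq_bot rfl hX] at h4
        exact hq0 h4
      have hspan : Submodule.span ℂ {p, q} ≤ H := by
        rw [Submodule.span_le]
        rintro x (rfl | rfl)
        exacts [hp.1, hq.1]
      have h5 := finrank_span_pair_eq_two hp0 hpq
      exact ⟨Submodule.span ℂ {p, q}, hspan, h5,
        one_le_finrank_of_mem ⟨Submodule.subset_span (by simp), hp.2⟩ hp0, by norm_num,
        fun _ => one_le_finrank_of_mem ⟨Submodule.subset_span (by simp), hq.2⟩ hq0,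
        hbox _ hspan h5⟩
  refine ⟨h, hh, hhH, le_iInf fun k => ?_⟩
  have h4 : H ⊓ (F (boxIdx hs k)).space (b + 3) ⊔ h = H := by
    apply Submodule.eq_of_le_of_finrank_le (sup_le inf_le_left hhH)
    have h5 := Submodule.finrank_sup_add_finrank_inf_eq (H ⊓ (F (boxIdx hs k)).space (b + 3)) h
    have h6 := Submodule.finrank_mono (inf_le_inf_right h
      (inf_le_right : H ⊓ (F (boxIdx hs k)).space (b + 3) ≤ _))
    rw [hF.finrank_box_inf hX hh] at h6
    have := h3 k
    have := hh.finrank_eq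
    omega
  rw [← h4]
  exact sup_le_sup_right inf_le_right _

end IsGenericInstance

end Geometry

/-! ### Schubert conditions of the fibered problems -/

section Conditions

variable {X : Type*} [AddCommGroup X] [Module ℂ X] {s e a b : ℕ}

/-- The problem `(2,1)·□³` for `e = 1` and `(2)·□⁴` for `e = 2`. -/
def baseProblem (e : ℕ) (i : Fin (e + 3)) : ℕ → ℕ :=
  if (i : ℕ) < e then
    (if e = 1 then partition [2, 1] else if (i : ℕ) = 0 then partition [2] else partition [1])
  else partition [1]

lemma baseProblem_one : baseProblem 1 = baseOne := by
  funext i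
  fin_cases i <;> rfl

lemma baseProblem_two : baseProblem 2 = baseTwo := by
  funext i
  fin_cases i <;> rfl

/-- The fibered problems: `familyOne` for `e = 1` and `familyTwo` for `e = 2`. -/
def fiberedFamily (e a b : ℕ) (nu : Fin s → ℕ → ℕ) (i : Fin s) : ℕ → ℕ :=
  if (i : ℕ) < e then
    (if e = 1 then consRow (b - a + 2) (consRow (b - a + 1) (nu i))
      else consRow (b - a + 2 - i) (nu i))
  else if (i : ℕ) < e + 3 then addColumn (a + 1) (nu i)
  else nu i

lemma fiberedFamily_one (nu : Fin s → ℕ → ℕ) : fiberedFamily 1 a b nu = familyOne a b nu := by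
  funext i
  unfold fiberedFamily familyOne
  split_ifs <;> first | rfl | omega

lemma fiberedFamily_two (nu : Fin s → ℕ → ℕ) : fiberedFamily 2 a b nu = familyTwo a b nu := by
  funext i
  unfold fiberedFamily familyTwo
  by_cases h0 : (i : ℕ) = 0
  · simp [h0]
  · by_cases h1 : (i : ℕ) = 1
    · simp [h1]
    · simp only [h0, h1, if_false, show ¬ (i : ℕ) < 2 by omega]
      split_ifs <;> first | rfl | omega

variable [FiniteDimensional ℂ X]

lemma CompleteFlag.space_eq_top (F : CompleteFlag X) {j : ℕ} (h : finrank ℂ X ≤ j) :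
    F.space j = ⊤ := by
  apply Submodule.eq_top_of_finrank_eq
  rw [F.finrank_space, min_eq_right h]

lemma mem_schubertVariety_partition_two_one (hX : finrank ℂ X = 5) (F : CompleteFlag X)
    {h : Submodule ℂ X} (hh : finrank ℂ h = 2) : h ∈ schubertVariety 2 (partition [2, 1]) F ↔
      1 ≤ finrank ℂ (h ⊓ F.space 2 : Submodule ℂ X) ∧ h ≤ F.space 4 := by
  have h4 : 2 ≤ finrank ℂ (h ⊓ F.space 4 : Submodule ℂ X) ↔ h ≤ F.space 4 := by
    rw [← inf_eq_left (a := h)]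
    constructor
    · intro h1
      exact Submodule.eq_of_le_of_finrank_le inf_le_left (by rwa [hh])
    · intro h1
      rw [h1, hh]
  rw [← h4]
  obtain ⟨g, hg⟩ : ∃ g : ℕ → ℕ, ∀ j, finrank ℂ (h ⊓ F.space j : Submodule ℂ X) = g j :=
    ⟨_, fun _ => rfl⟩
  simp only [schubertVariety, Set.mem_ofPred_eq, hh, true_and, hX, hg]
  refine ⟨fun h1 => ⟨h1 0 (by norm_num), h1 1 (by norm_num)⟩, fun h1 j hj => ?_⟩
  interval_cases j
  exacts [h1.1, h1.2]

lemma mem_schubertVariety_partition_two (hX : finrank ℂ X = 5) (F : CompleteFlag X)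
    {h : Submodule ℂ X} (hh : finrank ℂ h = 2) : h ∈ schubertVariety 2 (partition [2]) F ↔
      1 ≤ finrank ℂ (h ⊓ F.space 2 : Submodule ℂ X) := by
  have h5 : finrank ℂ (h ⊓ F.space 5 : Submodule ℂ X) = 2 := by
    rw [F.space_eq_top hX.le, inf_top_eq, hh]
  obtain ⟨g, hg⟩ : ∃ g : ℕ → ℕ, ∀ j, finrank ℂ (h ⊓ F.space j : Submodule ℂ X) = g j :=
    ⟨_, fun _ => rfl⟩
  simp only [schubertVariety, Set.mem_ofPred_eq, hh, true_and, hX, hg] at h5 ⊢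
  refine ⟨fun h1 => h1 0 (by norm_num), fun h1 j hj => ?_⟩
  interval_cases j
  exacts [h1, h5.ge]

lemma mem_schubertVariety_partition_one (hX : finrank ℂ X = 5) (F : CompleteFlag X)
    {h : Submodule ℂ X} (hh : finrank ℂ h = 2) : h ∈ schubertVariety 2 (partition [1]) F ↔
      1 ≤ finrank ℂ (h ⊓ F.space 3 : Submodule ℂ X) := by
  have h5 : finrank ℂ (h ⊓ F.space 5 : Submodule ℂ X) = 2 := by
    rw [F.space_eq_top hX.le, inf_top_eq, hh]
  obtain ⟨g, hg⟩ : ∃ g : ℕ → ℕ, ∀ j, finrank ℂ (h ⊓ F.space j : Submodule ℂ X) = g j :=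
    ⟨_, fun _ => rfl⟩
  simp only [schubertVariety, Set.mem_ofPred_eq, hh, true_and, hX, hg] at h5 ⊢
  refine ⟨fun h1 => h1 0 (by norm_num), fun h1 j hj => ?_⟩
  interval_cases j
  exacts [h1, h5.ge]

lemma mem_schubertSolutions_baseProblem (he : e = 1 ∨ e = 2) (hX : finrank ℂ X = 5)
    (E : Fin (e + 3) → CompleteFlag X) (h : Submodule ℂ X) :
    h ∈ schubertSolutions 2 (baseProblem e) E ↔ IsBasePlane 0 le_rfl E h := by
  by_cases hh : finrank ℂ h = 2
  swap
  · exact ⟨fun h1 => absurd h1.1 hh, fun h1 => absurd h1.finrank_eq hh⟩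
  have hbox (k : Fin 3) : baseProblem e (boxIdx le_rfl k) = partition [1] := by
    rw [baseProblem, if_neg (by simp [boxIdx])]
  have hcases (i : Fin (e + 3)) : i = idxZero le_rfl ∨ (e = 2 ∧ i = idxOne le_rfl) ∨
      ∃ k, i = boxIdx le_rfl k := by
    by_cases h0 : (i : ℕ) < e
    · by_cases h1 : (i : ℕ) = 0
      · exact Or.inl (Fin.ext h1)
      · exact Or.inr (Or.inl ⟨by omega, Fin.ext (by simp [idxOne]; omega)⟩)
    · exact Or.inr (Or.inr ⟨⟨i - e, by omega⟩, Fin.ext (by simp [boxIdx]; omega)⟩)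
  constructor
  · intro h1
    have hb := fun k => h1.2 (boxIdx le_rfl k)
    have hz := h1.2 (idxZero le_rfl)
    simp only [hbox, mem_schubertVariety_partition_one hX _ hh] at hb
    rcases he with rfl | rfl
    · have h2 : baseProblem 1 (idxZero le_rfl) = partition [2, 1] := rfl
      rw [h2, mem_schubertVariety_partition_two_one hX _ hh] at hz
      exact ⟨hh, hz.1, fun _ => hz.2, by norm_num, hb⟩
    · have h2 : baseProblem 2 (idxZero le_rfl) = partition [2] := rfl
      have h3 : baseProblem 2 (idxOne le_rfl) = partition [1] := rfl
      have ho := h1.2 (idxOne le_rfl)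
      rw [h2, mem_schubertVariety_partition_two hX _ hh] at hz
      rw [h3, mem_schubertVariety_partition_one hX _ hh] at ho
      exact ⟨hh, hz, by norm_num, fun _ => ho, hb⟩
  · intro h1
    refine ⟨hh, fun i => ?_⟩
    rcases hcases i with rfl | ⟨rfl, rfl⟩ | ⟨k, rfl⟩
    · rcases he with rfl | rfl
      · have h2 : baseProblem 1 (idxZero le_rfl) = partition [2, 1] := rfl
        rw [h2, mem_schubertVariety_partition_two_one hX _ hh]
        exact ⟨h1.point, h1.le_of_eq_one rfl⟩
      · have h2 : baseProblem 2 (idxZero le_rfl) = partition [2] := rfl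
        rw [h2, mem_schubertVariety_partition_two hX _ hh]
        exact h1.point
    · have h3 : baseProblem 2 (idxOne le_rfl) = partition [1] := rfl
      rw [h3, mem_schubertVariety_partition_one hX _ hh]
      exact h1.point_of_eq_two rfl
    · rw [hbox, mem_schubertVariety_partition_one hX _ hh]
      have := h1.box k
      rwa [zero_add] at this

/-- The part of a Schubert condition of the fibered problem that only involves the base plane. -/
def baseCondition (e a b : ℕ) (i : ℕ) (F : CompleteFlag X) (H : Submodule ℂ X) : Prop :=
  if i < e then
    (if e = 1 then 1 ≤ finrank ℂ (H ⊓ F.space 2 : Submodule ℂ X) ∧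
        2 ≤ finrank ℂ (H ⊓ F.space 4 : Submodule ℂ X)
      else 1 ≤ finrank ℂ (H ⊓ F.space (2 + i) : Submodule ℂ X))
  else if i < e + 3 then a + 1 ≤ finrank ℂ (H ⊓ F.space (b + 3) : Submodule ℂ X)
  else True

lemma mem_schubertVariety_fiberedFamily (he : e = 1 ∨ e = 2) (hX : finrank ℂ X = 5 + b)
    (hab : a < b) {nu : Fin s → ℕ → ℕ} (i : Fin s) (hnu : IsPartitionFor a b (nu i))
    (F : CompleteFlag X) {H : Submodule ℂ X} (hH : finrank ℂ H = 2 + a) :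
    H ∈ schubertVariety (2 + a) (fiberedFamily e a b nu i) F ↔
      baseCondition e a b i F H ∧ ∀ j < a, j + 1 + rankDrop e i ≤ finrank ℂ
        (H ⊓ F.space (offset e i + (b - a + (j + 1) - nu i j)) : Submodule ℂ X) := by
  have hle (j : ℕ) : nu i j ≤ b - a := (hnu.1 (Nat.zero_le j)).trans hnu.2.1
  have hzero (j : ℕ) (hj : a ≤ j) : nu i j = 0 :=
    Nat.le_zero.1 ((hnu.1 hj).trans hnu.2.2.le)
  have hH1 : a + 1 ≤ finrank ℂ (H ⊓ F.space (b + 4) : Submodule ℂ X) := by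
    have := finrank_add_le_finrank_inf_add_finrank H (F.space (b + 4))
    rw [F.finrank_space, hX, hH] at this
    omega
  have hH2 (j : ℕ) (hj : 5 + b ≤ j) : 2 + a ≤ finrank ℂ (H ⊓ F.space j : Submodule ℂ X) := by
    rw [F.space_eq_top (by omega), inf_top_eq, hH]
  have hmem : H ∈ schubertVariety (2 + a) (fiberedFamily e a b nu i) F ↔ ∀ j < 2 + a,
      j + 1 ≤ finrank ℂ (H ⊓ F.space (5 + b - (2 + a) + (j + 1) - fiberedFamily e a b nu i j) :
        Submodule ℂ X) := by
    rw [← hX]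
    exact ⟨fun h => h.2, fun h => ⟨hH, h⟩⟩
  rw [hmem]
  unfold baseCondition
  obtain ⟨g, hg⟩ : ∃ g : ℕ → ℕ, ∀ j, finrank ℂ (H ⊓ F.space j : Submodule ℂ X) = g j :=
    ⟨_, fun _ => rfl⟩
  simp only [hg] at hH1 hH2 ⊢
  clear hmem
  by_cases hi : (i : ℕ) < e
  · rcases he with rfl | rfl
    · simp only [fiberedFamily, rankDrop, offset, if_pos hi, if_true]
      constructor
      · intro h
        refine ⟨⟨?_, ?_⟩, fun j hj => ?_⟩
        · convert h 0 (by omega) using 2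
          simp only [consRow]; omega
        · convert h 1 (by omega) using 2
          simp only [consRow]; omega
        · convert h (j + 2) (by omega) using 2
          have := hle j
          simp only [consRow]; omega
      · rintro ⟨⟨h0, h1⟩, h2⟩ j hj
        match j with
        | 0 =>
          convert h0 using 2
          simp only [consRow]; omega
        | 1 =>
          convert h1 using 2
          simp only [consRow]; omega
        | j + 2 =>
          convert h2 j (by omega) using 2
          have := hle j
          simp only [consRow]; omega
    · simp only [fiberedFamily, rankDrop, offset, if_pos hi, OfNat.ofNat_ne_one,
        if_false]
      constructor
      · intro h
        refine ⟨?_, fun j hj => ?_⟩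
        · convert h 0 (by omega) using 2
          simp only [consRow]; omega
        · convert h (j + 1) (by omega) using 2
          have := hle j
          simp only [consRow]; omega
      · rintro ⟨h0, h2⟩ j hj
        match j with
        | 0 =>
          convert h0 using 2
          simp only [consRow]; omega
        | j + 1 =>
          by_cases hja : j < a
          · convert h2 j (by omega) using 2
            have := hle j
            simp only [consRow]; omega
          · refine le_trans (by omega) (hH2 _ ?_)
            simp only [consRow, hzero j (by omega)]; omega
  · by_cases hi' : (i : ℕ) < e + 3
    · simp only [fiberedFamily, rankDrop, offset, if_neg hi, if_pos hi']
      constructor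
      · intro h
        refine ⟨?_, fun j hj => ?_⟩
        · convert h a (by omega) using 2
          have := hzero a le_rfl
          simp only [addColumn]; rw [if_pos (by omega)]; omega
        · convert h j (by omega) using 2
          have := hle j
          simp only [addColumn]; rw [if_pos (by omega)]; omega
      · rintro ⟨h0, h2⟩ j hj
        by_cases hja : j < a
        · convert h2 j (by omega) using 2
          have := hle j
          simp only [addColumn]; rw [if_pos (by omega)]; omega
        · obtain rfl | rfl : j = a ∨ j = a + 1 := by omega
          · convert h0 using 2
            have := hzero j le_rfl
            simp only [addColumn]; rw [if_pos (by omega)]; omega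
          · refine le_trans (by omega) (hH2 _ ?_)
            have := hzero (a + 1) (by omega)
            simp only [addColumn]; rw [if_neg (by omega)]; omega
    · simp only [fiberedFamily, rankDrop, offset, if_neg hi, if_neg hi', true_and]
      constructor
      · intro h j hj
        convert h j (by omega) using 2
        have := hle j
        omega
      · rintro h2 j hj
        by_cases hja : j < a
        · convert h2 j (by omega) using 2
          have := hle j
          omega
        · obtain rfl | rfl : j = a ∨ j = a + 1 := by omega
          · convert hH1 using 2
            have := hzero j le_rfl
            omega
          · refine le_trans (by omega) (hH2 _ ?_)
            have := hzero (a + 1) (by omega)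
            omega

end Conditions

/-! ### The decomposition of the solutions of a generic instance -/

section Decomposition

variable {s e a b : ℕ}

/-- The index of the subspace of the `i`-th flag that cuts out the `j`-th subspace of the induced
flag in `V`. -/
def baseFlagIdx (e b i j : ℕ) : ℕ := if j ≤ plateau e i then j else b + j

/-- The subspaces of the flags of the base instance and of the instances in the fibers. -/
structure IsInducedDatum {X : Type*} [AddCommGroup X] [Module ℂ X] (b : ℕ) (hs : e + 3 ≤ s)
    (F : Fin s → CompleteFlag X) (V : Submodule ℂ X) (E : Fin (e + 3) → CompleteFlag V)
    (G : Submodule ℂ V → Fin s → CompleteFlag (X ⧸ V)) : Prop where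
  eq_baseSpace : V = baseSpace hs F
  base : ∀ i j, (E i).space j =
    ((F (Fin.castLE hs i)).space (baseFlagIdx e b i j)).comap V.subtype
  fiber : ∀ h : Submodule ℂ V, IsBasePlane b hs F (h.map V.subtype) → ∀ i m,
    (G h i).space m =
      ((F i).space (offset e i + m) ⊓ hull b hs F (h.map V.subtype)).map V.mkQ

section

variable {X : Type*} [AddCommGroup X] [Module ℂ X]

lemma finrank_map_subtype (V : Submodule ℂ X) (h : Submodule ℂ V) :
    finrank ℂ (h.map V.subtype) = finrank ℂ h :=
  (Submodule.equivMapOfInjective _ V.subtype_injective h).symm.finrank_eq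

lemma finrank_inf_comap_subtype (V : Submodule ℂ X) (h : Submodule ℂ V) (S : Submodule ℂ X) :
    finrank ℂ (h ⊓ S.comap V.subtype : Submodule ℂ V)
      = finrank ℂ (h.map V.subtype ⊓ S : Submodule ℂ X) := by
  rw [← finrank_map_subtype, Submodule.map_inf _ V.subtype_injective, Submodule.map_comap_subtype,
    ← inf_assoc, inf_eq_left.2 (Submodule.map_subtype_le V h)]

variable [FiniteDimensional ℂ X]

lemma IsInducedDatum.mem_iff {hs : e + 3 ≤ s} {F : Fin s → CompleteFlag X} {V : Submodule ℂ X}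
    {E : Fin (e + 3) → CompleteFlag V} {G : Submodule ℂ V → Fin s → CompleteFlag (X ⧸ V)}
    (hD : IsInducedDatum b hs F V E G) (hV : finrank ℂ V = 5) (he : e = 1 ∨ e = 2)
    (h : Submodule ℂ V) :
    h ∈ schubertSolutions 2 (baseProblem e) E ↔ IsBasePlane b hs F (h.map V.subtype) := by
  rw [mem_schubertSolutions_baseProblem he hV]
  have h1 : (E (idxZero le_rfl)).space 2 = ((F (idxZero hs)).space 2).comap V.subtype := by
    rw [hD.base]
    rcases he with rfl | rfl <;> rfl
  have h2 (he1 : e = 1) :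
      (E (idxZero le_rfl)).space 4 = ((F (idxZero hs)).space 4).comap V.subtype := by
    rw [hD.base]
    subst he1
    rfl
  have h3 (he2 : e = 2) :
      (E (idxOne le_rfl)).space 3 = ((F (idxOne hs)).space 3).comap V.subtype := by
    rw [hD.base]
    subst he2
    rfl
  have h4 (k : Fin 3) : (E (boxIdx le_rfl k)).space (0 + 3) =
      ((F (boxIdx hs k)).space (b + 3)).comap V.subtype := by
    rw [hD.base]
    have : baseFlagIdx e b (boxIdx (le_refl (e + 3)) k) (0 + 3) = b + 3 := by
      simp [baseFlagIdx, plateau, boxIdx]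
    rw [this]
    rfl
  constructor
  · rintro ⟨c1, c2, c3, c4, c5⟩
    refine ⟨by rwa [finrank_map_subtype], ?_, fun he1 => ?_, fun he2 => ?_, fun k => ?_⟩
    · rwa [h1, finrank_inf_comap_subtype] at c2
    · have := c3 he1
      rwa [h2 he1, ← Submodule.map_le_iff_le_comap] at this
    · have := c4 he2
      rwa [h3 he2, finrank_inf_comap_subtype] at this
    · have := c5 k
      rwa [h4, finrank_inf_comap_subtype] at this
  · rintro ⟨c1, c2, c3, c4, c5⟩
    refine ⟨by rwa [finrank_map_subtype] at c1, ?_, fun he1 => ?_, fun he2 => ?_, fun k => ?_⟩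
    · rwa [h1, finrank_inf_comap_subtype]
    · rw [h2 he1, ← Submodule.map_le_iff_le_comap]
      exact c3 he1
    · rw [h3 he2, finrank_inf_comap_subtype]
      exact c4 he2
    · rw [h4, finrank_inf_comap_subtype]
      exact c5 k

variable {hs : e + 3 ≤ s} {F : Fin s → CompleteFlag X} {h H : Submodule ℂ X}

lemma map_comap_baseSpace_eq (hF : IsGenericInstance b hs F) (he : e = 1 ∨ e = 2)
    (hX : finrank ℂ X = 5 + b) (hh : IsBasePlane b hs F h) (h1 : h ≤ H)
    (h2 : H ≤ hull b hs F h) :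
    (H.comap (baseSpace hs F).subtype).map (baseSpace hs F).subtype = h := by
  rw [Submodule.map_comap_subtype]
  apply le_antisymm
  · exact fun x hx => hF.hull_inf_le h hh ⟨h2 hx.2, hx.1⟩
  · exact le_inf (hF.le_baseSpace he hX hh) h1

lemma finrank_map_mkQ_baseSpace (hF : IsGenericInstance b hs F) (he : e = 1 ∨ e = 2)
    (hX : finrank ℂ X = 5 + b) (hh : IsBasePlane b hs F h) (h1 : h ≤ H)
    (h2 : H ≤ hull b hs F h) :
    finrank ℂ (H.map (baseSpace hs F).mkQ) + 2 = finrank ℂ H := by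
  have h3 := finrank_map_mkQ_add (baseSpace hs F) H
  rwa [inf_comm, ← Submodule.map_comap_subtype, map_comap_baseSpace_eq hF he hX hh h1 h2,
    hh.finrank_eq] at h3

lemma baseCondition_of_isBasePlane (hF : IsGenericInstance b hs F) (he : e = 1 ∨ e = 2)
    (hX : finrank ℂ X = 5 + b) (hh : IsBasePlane b hs F h) (h1 : h ≤ H)
    (h2 : H ≤ hull b hs F h) (hH : finrank ℂ H = 2 + a) (i : Fin s) :
    baseCondition e a b i (F i) H := by
  unfold baseCondition
  split_ifs with hi he1 hi3
  · obtain rfl : i = idxZero hs := Fin.ext (by simp [idxZero]; omega)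
    refine ⟨hh.point.trans (Submodule.finrank_mono (inf_le_inf_right _ h1)), ?_⟩
    rw [← hh.finrank_eq]
    exact Submodule.finrank_mono (le_inf h1 (hh.le_of_eq_one he1))
  · by_cases hi0 : (i : ℕ) = 0
    · obtain rfl : i = idxZero hs := Fin.ext hi0
      exact hh.point.trans (Submodule.finrank_mono (inf_le_inf_right _ h1))
    · obtain rfl : i = idxOne hs := Fin.ext (by simp [idxOne]; omega)
      exact (hh.point_of_eq_two (by omega)).trans
        (Submodule.finrank_mono (inf_le_inf_right _ h1))
  · obtain ⟨k, rfl⟩ : ∃ k, i = boxIdx hs k :=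
      ⟨⟨i - e, by omega⟩, Fin.ext (by simp [boxIdx]; omega)⟩
    have h3 : (H ⊓ (F (boxIdx hs k)).space (b + 3)) ⊔ h = H := by
      rw [inf_sup_assoc_of_le _ h1]
      exact inf_eq_left.2 (h2.trans (iInf_le _ k))
    have h4 := Submodule.finrank_sup_add_finrank_inf_eq (H ⊓ (F (boxIdx hs k)).space (b + 3)) h
    have h5 : H ⊓ (F (boxIdx hs k)).space (b + 3) ⊓ h =
        (F (boxIdx hs k)).space (b + 3) ⊓ h := by
      rw [inf_comm H, inf_assoc, inf_eq_right.2 h1]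
    rw [h3, h5, hF.finrank_box_inf hX hh, hh.finrank_eq] at h4
    omega

lemma mem_schubertSolutions_iff_of_le_hull (hF : IsGenericInstance b hs F) (he : e = 1 ∨ e = 2)
    (hX : finrank ℂ X = 5 + b) (hab : a < b) {nu : Fin s → ℕ → ℕ}
    (hnu : ∀ i, IsPartitionFor a b (nu i)) (hh : IsBasePlane b hs F h) (h1 : h ≤ H)
    (h2 : H ≤ hull b hs F h) {G : Fin s → CompleteFlag (X ⧸ baseSpace hs F)}
    (hG : ∀ i m, (G i).space m =
      ((F i).space (offset e i + m) ⊓ hull b hs F h).map (baseSpace hs F).mkQ) :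
    H ∈ schubertSolutions (2 + a) (fiberedFamily e a b nu) F ↔
      H.map (baseSpace hs F).mkQ ∈ schubertSolutions a nu G := by
  have h3 := finrank_map_mkQ_baseSpace hF he hX hh h1 h2
  by_cases hH : finrank ℂ H = 2 + a
  swap
  · exact ⟨fun h4 => absurd h4.1 hH, fun h4 => absurd h4.1 (by omega)⟩
  have hK : finrank ℂ (H.map (baseSpace hs F).mkQ) = a := by omega
  simp only [schubertSolutions, Set.mem_ofPred_eq, hH, hK, true_and]
  refine forall_congr' fun i => ?_
  rw [mem_schubertVariety_fiberedFamily he hX hab i (hnu i) (F i) hH,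
    and_iff_right (baseCondition_of_isBasePlane hF he hX hh h1 h2 hH i)]
  simp only [schubertVariety, Set.mem_ofPred_eq, hK, true_and]
  refine forall_congr' fun j => forall_congr' fun hj => ?_
  rw [hG, hF.finrank_quotient hX, ← hF.finrank_map_inf_map he hX hh h1 h2 i (by omega)]
  omega

end

theorem isFiberDecomposition {hs : e + 3 ≤ s} {F : Fin s → CompleteFlag (Fin (5 + b) → ℂ)}
    (hF : IsGenericInstance b hs F) (he : e = 1 ∨ e = 2) (hab : a < b) {nu : Fin s → ℕ → ℕ}
    (hnu : ∀ i, IsPartitionFor a b (nu i)) {D : FibrationDatum (5 + b) (e + 3) s}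
    (hD : IsInducedDatum b hs F D.V D.E D.G) :
    IsFiberDecomposition 2 5 a b (fiberedFamily e a b nu) (baseProblem e) nu F D := by
  obtain ⟨V, E, G⟩ := D
  have hV : V = baseSpace hs F := hD.eq_baseSpace
  dsimp only at hD
  subst hV
  have hX : finrank ℂ (Fin (5 + b) → ℂ) = 5 + b := by simp
  have hmem := hD.mem_iff hF.finrank_baseSpace he
  have hex (H) (hH : H ∈ schubertSolutions (2 + a) (fiberedFamily e a b nu) F) :
      ∃ h, IsBasePlane b hs F h ∧ h ≤ H ∧ H ≤ hull b hs F h := by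
    have h1 := fun i => ((mem_schubertVariety_fiberedFamily he hX hab i (hnu i) (F i) hH.1).1
      (hH.2 i)).1
    refine hF.exists_basePlane he hX hH.1 ?_ (fun he1 => ?_) (fun he2 => ?_) (fun k => ?_)
    · have := h1 (idxZero hs)
      rcases he with rfl | rfl
      · exact this.1
      · exact this
    · subst he1
      exact (h1 (idxZero hs)).2
    · subst he2
      exact h1 (idxOne hs)
    · have := h1 (boxIdx hs k)
      rwa [baseCondition, if_neg (by simp [boxIdx]), if_pos (by simp [boxIdx])] at this
  have hbase (H) (hH : H ∈ schubertSolutions (2 + a) (fiberedFamily e a b nu) F) :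
      H.comap (baseSpace hs F).subtype ∈ schubertSolutions 2 (baseProblem e) E := by
    obtain ⟨h, hh, h1, h2⟩ := hex H hH
    rw [hmem, map_comap_baseSpace_eq hF he hX hh h1 h2]
    exact hh
  have hfiber (h) (hh : h ∈ schubertSolutions 2 (baseProblem e) E) (H)
      (hH : H ∈ schubertSolutions (2 + a) (fiberedFamily e a b nu) F)
      (hHh : H.comap (baseSpace hs F).subtype = h) : H.map (baseSpace hs F).mkQ ∈ schubertSolutions a nu (G h) := by
    obtain ⟨h', hh', h1, h2⟩ := hex H hH
    have h3 : h.map (baseSpace hs F).subtype = h' := by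
      rw [← hHh, map_comap_baseSpace_eq hF he hX hh' h1 h2]
    refine (mem_schubertSolutions_iff_of_le_hull hF he hX hab hnu hh' h1 h2 fun i m => ?_).1 hH
    rw [hD.fiber h ((hmem h).1 hh), h3]
  refine ⟨hF.finrank_baseSpace, hbase, hfiber, ?_, ?_, ?_⟩
  · exact fun H hH => ⟨hbase H hH, hfiber _ (hbase H hH) H hH rfl⟩
  · intro H hH H' hH' hEq
    obtain ⟨h, hh, h1, h2⟩ := hex H hH
    obtain ⟨h', hh', h1', h2'⟩ := hex H' hH'
    simp only [Prod.mk.injEq] at hEq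
    obtain rfl : h = h' := by
      rw [← map_comap_baseSpace_eq hF he hX hh h1 h2,
        ← map_comap_baseSpace_eq hF he hX hh' h1' h2', hEq.1]
    have key (H H' : Submodule ℂ (Fin (5 + b) → ℂ)) (h2 : H ≤ hull b hs F h) (h1' : h ≤ H')
        (h2' : H' ≤ hull b hs F h) (hK : H.map (baseSpace hs F).mkQ ≤ H'.map (baseSpace hs F).mkQ) : H ≤ H' := by
      intro x hx
      obtain ⟨y, hy, hxy⟩ := hK ⟨x, hx, rfl⟩
      have h4 : x - y ∈ h := by
        refine hF.hull_inf_le h hh ⟨sub_mem (h2 hx) (h2' hy), ?_⟩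
        simpa [Submodule.Quotient.eq] using hxy.symm
      simpa using add_mem (h1' h4) hy
    exact le_antisymm (key H H' h2 h1' h2' hEq.2.le) (key H' H h2' h1 h2 hEq.2.ge)
  · rintro ⟨h, K⟩ ⟨hh, hK⟩
    have hh' := (hmem h).1 hh
    dsimp only at hh hK
    set h0 := h.map (baseSpace hs F).subtype with hh0
    set H := hull b hs F h0 ⊓ K.comap (baseSpace hs F).mkQ with hHdef
    have h1 : h0 ≤ H := by
      refine le_inf (le_hull _ _ _) ?_
      rintro _ ⟨x, -, rfl⟩
      have : (baseSpace hs F).mkQ ((baseSpace hs F).subtype x) = 0 := by simp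
      rw [Submodule.mem_comap, this]
      exact zero_mem _
    have h2 : H ≤ hull b hs F h0 := inf_le_left
    have h3 : H.map (baseSpace hs F).mkQ = K := by
      apply le_antisymm
      · rw [Submodule.map_le_iff_le_comap]
        exact inf_le_right
      · intro w hw
        obtain ⟨x, rfl⟩ := (baseSpace hs F).mkQ_surjective w
        have hx : x ∈ hull b hs F h0 ⊔ baseSpace hs F := by
          rw [hF.hull_sup_baseSpace he hX hh']
          trivial
        obtain ⟨z, hz, v, hv, rfl⟩ := Submodule.mem_sup.1 hx
        have h4 : (baseSpace hs F).mkQ (z + v) = (baseSpace hs F).mkQ z := by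
          rw [map_add, add_eq_left]
          simpa using hv
        rw [h4] at hw ⊢
        exact ⟨z, ⟨hz, hw⟩, rfl⟩
    refine ⟨H, ?_, Prod.ext ?_ h3⟩
    · rw [mem_schubertSolutions_iff_of_le_hull hF he hX hab hnu hh' h1 h2 (G := G h)
        (hD.fiber h hh'), h3]
      exact hK
    · apply Submodule.map_injective_of_injective (baseSpace hs F).subtype_injective
      exact map_comap_baseSpace_eq hF he hX hh' h1 h2

end Decomposition

/-! ### Existence and uniqueness of the induced flags -/

section InducedDatum

variable {X : Type*} [AddCommGroup X] [Module ℂ X] [FiniteDimensional ℂ X] {s e b : ℕ}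
  {hs : e + 3 ≤ s} {F : Fin s → CompleteFlag X}

lemma plateau_le_five (he : e = 1 ∨ e = 2) (i : ℕ) : plateau e i ≤ 5 := by
  unfold plateau; split_ifs <;> omega

lemma monotone_baseFlagIdx (i : ℕ) : Monotone (baseFlagIdx e b i) := by
  intro j k hjk
  unfold baseFlagIdx
  split_ifs <;> omega

lemma IsGenericInstance.finrank_base (hF : IsGenericInstance b hs F) (he : e = 1 ∨ e = 2)
    (hX : finrank ℂ X = 5 + b) (i : Fin s) (hi : (i : ℕ) < e + 3) (j : ℕ) :
    finrank ℂ (((F i).space (baseFlagIdx e b i j)).comap (baseSpace hs F).subtype) = min j 5 := by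
  have hκ := plateau_le_five he i
  rw [← finrank_map_subtype, Submodule.map_comap_subtype]
  by_cases hj : j ≤ plateau e i
  · rw [show baseFlagIdx e b i j = j from if_pos hj]
    rw [inf_eq_right.2 (((F i).mono hj).trans (hF.plateau_le i hi)), (F i).finrank_space, hX]
    omega
  · rw [show baseFlagIdx e b i j = b + j from if_neg hj]
    have h1 := finrank_add_le_finrank_inf_add_finrank (baseSpace hs F) ((F i).space (b + j))
    have h2 := finrank_add_le_finrank_inf_add (P := baseSpace hs F ⊓ (F i).space (b + j))
      (Q := (F i).space (b + plateau e i)) (R := (F i).space (b + j)) inf_le_right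
      ((F i).mono (by omega))
    have h3 : baseSpace hs F ⊓ (F i).space (b + j) ⊓ (F i).space (b + plateau e i) ≤
        (F i).space (plateau e i) :=
      le_trans (le_inf inf_le_right (inf_le_left.trans inf_le_left)) (hF.inf_le_plateau i hi)
    have h4 := Submodule.finrank_mono h3
    have h5 := Submodule.finrank_mono
      (inf_le_left : baseSpace hs F ⊓ (F i).space (b + j) ≤ baseSpace hs F)
    simp only [(F i).finrank_space, hX, hF.finrank_baseSpace] at h1 h2 h4 h5
    omega

lemma IsGenericInstance.exists_isInducedDatum (hF : IsGenericInstance b hs F)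
    (he : e = 1 ∨ e = 2) (hX : finrank ℂ X = 5 + b) :
    ∃ E G, IsInducedDatum b hs F (baseSpace hs F) E G := by
  classical
  refine ⟨fun i => ⟨fun j => ((F (Fin.castLE hs i)).space
      (baseFlagIdx e b i j)).comap (baseSpace hs F).subtype, fun j k hjk =>
      Submodule.comap_mono ((F _).mono (monotone_baseFlagIdx _ hjk)), fun j => ?_⟩,
    fun h i => if hh : IsBasePlane b hs F (h.map (baseSpace hs F).subtype) then
      ⟨fun m => ((F i).space (offset e i + m) ⊓
        hull b hs F (h.map (baseSpace hs F).subtype)).map (baseSpace hs F).mkQ,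
        fun m m' hm => Submodule.map_mono (inf_le_inf_right _ ((F i).mono (by omega))), fun m => ?_⟩
      else flagOf (finBasis ℂ _), rfl, fun i j => rfl, fun h hh i m => ?_⟩
  · rw [hF.finrank_baseSpace]
    exact hF.finrank_base he hX (Fin.castLE hs i) i.2 j
  · rw [hF.finrank_map_fiber he hX hh, hF.finrank_quotient hX]
  · simp only [dif_pos hh]

omit [FiniteDimensional ℂ X] in
lemma IsInducedDatum.base_unique {V : Submodule ℂ X} {E E' : Fin (e + 3) → CompleteFlag V}
    {G G' : Submodule ℂ V → Fin s → CompleteFlag (X ⧸ V)} (h : IsInducedDatum b hs F V E G)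
    (h' : IsInducedDatum b hs F V E' G') : E = E' := by
  funext i
  ext1
  funext j
  rw [h.base, h'.base]

omit [FiniteDimensional ℂ X] in
lemma IsInducedDatum.fiber_unique {V : Submodule ℂ X} {E E' : Fin (e + 3) → CompleteFlag V}
    {G G' : Submodule ℂ V → Fin s → CompleteFlag (X ⧸ V)} (h : IsInducedDatum b hs F V E G)
    (h' : IsInducedDatum b hs F V E' G') {p : Submodule ℂ V}
    (hp : IsBasePlane b hs F (p.map V.subtype)) : G p = G' p := by
  funext i
  ext1
  funext j
  rw [h.fiber p hp, h'.fiber p hp]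

end InducedDatum

/-! ### Linear algebra of forms -/

section Forms

variable {X : Type*} [AddCommGroup X] [Module ℂ X]

/-- Three linear forms evaluated at three vectors. -/
def formDet (ρ : Fin 3 → X →ₗ[ℂ] ℂ) (x : Fin 3 → X) : ℂ :=
  Matrix.det (Matrix.of fun k l => ρ k (x l))

lemma eq_zero_of_formDet_ne_zero {ρ : Fin 3 → X →ₗ[ℂ] ℂ} {x : Fin 3 → X} (h : formDet ρ x ≠ 0)
    {c : Fin 3 → ℂ} (hc : ∀ k, ρ k (∑ l, c l • x l) = 0) : c = 0 := by
  refine Matrix.eq_zero_of_mulVec_eq_zero h ?_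
  funext k
  have := hc k
  simpa [Matrix.mulVec, dotProduct, mul_comm] using this

lemma exists_of_formDet_eq_zero {ρ : Fin 3 → X →ₗ[ℂ] ℂ} {x : Fin 3 → X} (h : formDet ρ x = 0) :
    ∃ c : Fin 3 → ℂ, c ≠ 0 ∧ ∀ k, ρ k (∑ l, c l • x l) = 0 := by
  obtain ⟨c, hc, h0⟩ := Matrix.exists_mulVec_eq_zero_iff.2 h
  refine ⟨c, hc, fun k => ?_⟩
  have := congrFun h0 k
  simpa [Matrix.mulVec, dotProduct, mul_comm] using this

lemma formDet_eq_zero {ρ : Fin 3 → X →ₗ[ℂ] ℂ} {x : Fin 3 → X} {c : Fin 3 → ℂ} (hc0 : c ≠ 0)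
    (hc : ∀ k, ρ k (∑ l, c l • x l) = 0) : formDet ρ x = 0 := by
  by_contra h
  exact hc0 (eq_zero_of_formDet_ne_zero h hc)

/-- The form `x ↦ α(w) β(x) - β(w) α(x)`. -/
def pencil (α β : X →ₗ[ℂ] ℂ) (w : X) : X →ₗ[ℂ] ℂ := α w • β - β w • α

lemma pencil_apply (α β : X →ₗ[ℂ] ℂ) (w x : X) : pencil α β w x = α w * β x - β w * α x := rfl

lemma pencil_add_smul (α β : X →ₗ[ℂ] ℂ) (w w' x : X) (t : ℂ) :
    pencil α β (w + t • w') x = pencil α β w x + t * pencil α β w' x := by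
  simp [pencil_apply]; ring

lemma pencil_self (α β : X →ₗ[ℂ] ℂ) (w : X) : pencil α β w w = 0 := by
  simp [pencil_apply]; ring

lemma pencil_eq_zero {α β : X →ₗ[ℂ] ℂ} {w x : X} {c d : ℂ} (hcd : c ≠ 0 ∨ d ≠ 0)
    (hα : α (c • w + d • x) = 0) (hβ : β (c • w + d • x) = 0) : pencil α β w x = 0 := by
  simp only [map_add, map_smul, smul_eq_mul] at hα hβ
  rw [pencil_apply]
  rcases hcd with h | h
  · refine mul_left_cancel₀ h ?_
    linear_combination β x * hα - α x * hβ
  · refine mul_left_cancel₀ h ?_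
    linear_combination α w * hβ - β w * hα

lemma exists_of_pencil_eq_zero {α β : X →ₗ[ℂ] ℂ} {w x : X} (h : pencil α β w x = 0) :
    ∃ c d : ℂ, (c ≠ 0 ∨ d ≠ 0) ∧ α (c • w + d • x) = 0 ∧ β (c • w + d • x) = 0 := by
  rw [pencil_apply] at h
  simp only [map_add, map_smul, smul_eq_mul]
  by_cases h1 : α w = 0 ∧ α x = 0
  · by_cases h2 : β w = 0 ∧ β x = 0
    · exact ⟨1, 0, Or.inl one_ne_zero, by simp [h1.1], by simp [h2.1]⟩
    · refine ⟨β x, - β w, ?_, by simp [h1], by ring⟩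
      rw [neg_ne_zero]
      tauto
  · refine ⟨α x, - α w, ?_, by ring, by linear_combination -h⟩
    rw [neg_ne_zero]
    tauto

/-- The coefficients of `det (P + t Q)` for 3 × 3 matrices. -/
def pencilCoeff (P Q : Matrix (Fin 3) (Fin 3) ℂ) : ℕ → ℂ
  | 0 => P.det
  | 1 => ((P + Q).det - (P - Q).det) / 2 - Q.det
  | 2 => ((P + Q).det + (P - Q).det) / 2 - P.det
  | 3 => Q.det
  | _ => 0

lemma det_add_smul (P Q : Matrix (Fin 3) (Fin 3) ℂ) (t : ℂ) :
    (P + t • Q).det = ∑ k ∈ Finset.range 4, pencilCoeff P Q k * t ^ k := by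
  simp only [Finset.sum_range_succ, Finset.range_zero, Finset.sum_empty, pencilCoeff,
    Matrix.det_fin_three, Matrix.add_apply, Matrix.sub_apply, Matrix.smul_apply, smul_eq_mul]
  ring

lemma pencilCoeff_three_eq_zero {P Q : Matrix (Fin 3) (Fin 3) ℂ} (hQ : ∀ k, Q k 0 = 0) :
    pencilCoeff P Q 3 = 0 := Matrix.det_eq_zero_of_column_eq_zero 0 hQ

lemma pencilCoeff_two_eq {P Q : Matrix (Fin 3) (Fin 3) ℂ} (hQ : ∀ k, Q k 0 = 0) :
    pencilCoeff P Q 2 = (Matrix.of fun k l => if l = 0 then P k 0 else Q k l).det := by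
  simp [pencilCoeff, Matrix.det_fin_three, hQ]
  ring

end Forms

/-! ### Tuples of bases in general position -/

section Frames

variable {X : Type*} [AddCommGroup X] [Module ℂ X] {s e b n : ℕ}

/-- The `j`-th vector of the `i`-th basis, with junk value `0` for `j ≥ n`. -/
def vecAt (v : Fin s → Fin n → X) (i : Fin s) (j : ℕ) : X := if h : j < n then v i ⟨j, h⟩ else 0

/-- The form `x ↦ det (v₀, …, x, …, vₙ₋₁)` with `x` at the `k`-th position. Up to a scalar it is
a coordinate with respect to the `i`-th basis. -/
def coordForm (β : Fin s → Basis (Fin n) ℂ X) (v : Fin s → Fin n → X) (i : Fin s) (k : ℕ) :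
    X →ₗ[ℂ] ℂ :=
  if h : k < n then (β i).det.toMultilinearMap.toLinearMap (v i) ⟨k, h⟩ else 0

omit [Module ℂ X] in
lemma vecAt_eq (v : Fin s → Fin n → X) (i : Fin s) {j : ℕ} (h : j < n) :
    vecAt v i j = v i ⟨j, h⟩ := dif_pos h

lemma coordForm_apply (β : Fin s → Basis (Fin n) ℂ X) (v : Fin s → Fin n → X) (i : Fin s)
    {k : ℕ} (h : k < n) (x : X) :
    coordForm β v i k x = (β i).det (Function.update (v i) ⟨k, h⟩ x) := by
  rw [coordForm, dif_pos h]
  rfl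

lemma Module.Basis.det_update_eq (β v : Basis (Fin n) ℂ X) (k : Fin n) (x : X) :
    β.det (Function.update v k x) = β.det v * v.coord k x := by
  conv_lhs => rw [← v.sum_repr x]
  rw [AlternatingMap.map_update_sum, Finset.sum_eq_single k]
  · rw [AlternatingMap.map_update_smul, Function.update_eq_self, smul_eq_mul, mul_comm,
      Basis.coord_apply]
  · intro j _ hj
    rw [AlternatingMap.map_update_smul, AlternatingMap.map_update_self _ _ hj.symm, smul_zero]
  · simp

lemma det_basis_ne_zero (β v : Basis (Fin n) ℂ X) : β.det v ≠ 0 :=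
  (β.isUnit_det v).ne_zero

lemma coordForm_eq (β v : Fin s → Basis (Fin n) ℂ X) (i : Fin s) {k : ℕ} (h : k < n) (x : X) :
    coordForm β (fun i j => v i j) i k x = (β i).det (v i) * (v i).coord ⟨k, h⟩ x := by
  rw [coordForm_apply _ _ _ h]
  exact (β i).det_update_eq (v i) ⟨k, h⟩ x

lemma coordForm_eq_zero_iff (β v : Fin s → Basis (Fin n) ℂ X) (i : Fin s) {k : ℕ} (h : k < n)
    (x : X) : coordForm β (fun i j => v i j) i k x = 0 ↔ (v i).coord ⟨k, h⟩ x = 0 := by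
  rw [coordForm_eq β v i h, mul_eq_zero, or_iff_right (det_basis_ne_zero (β i) (v i))]

/-- The moving point of the first line. -/
def movingPoint (hs : e + 3 ≤ s) (v : Fin s → Fin n → X) (t : ℂ) : X :=
  vecAt v (idxZero hs) 0 + t • vecAt v (idxZero hs) 1

/-- Three vectors of `V`, whose span contains the second point that spans a base plane. -/
def baseVec (hs : e + 3 ≤ s) (v : Fin s → Fin n → X) (l : Fin 3) : X :=
  if e = 1 then vecAt v (idxZero hs) (l + 1) else vecAt v (idxOne hs) l

/-- The vector that completes the moving point and `baseVec` to a basis of `V`. -/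
def lastVec (hs : e + 3 ≤ s) (v : Fin s → Fin n → X) : X :=
  if e = 1 then vecAt v (idxZero hs) 4 else vecAt v (idxZero hs) 1

/-- The pencil of forms whose base locus is the subspace `F_{b+3}` of the `k`-th flag `□`. -/
def boxForm (b : ℕ) (hs : e + 3 ≤ s) (β : Fin s → Basis (Fin n) ℂ X) (v : Fin s → Fin n → X)
    (k : Fin 3) (w : X) : X →ₗ[ℂ] ℂ :=
  pencil (coordForm β v (boxIdx hs k) (b + 4)) (coordForm β v (boxIdx hs k) (b + 3)) w

/-- The equation of the hyperplane spanned by `F_{b+3}` and the moving point. -/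
def theta (b : ℕ) (hs : e + 3 ≤ s) (β : Fin s → Basis (Fin n) ℂ X) (v : Fin s → Fin n → X)
    (t : ℂ) (k : Fin 3) : X →ₗ[ℂ] ℂ :=
  boxForm b hs β v k (movingPoint hs v t)

/-- The coefficients of the polynomial `t ↦ det (θₖ(t) (xₗ))`, for the three base vectors `xₗ`,
whose roots correspond to the base planes. -/
def rootCoeff (b : ℕ) (hs : e + 3 ≤ s) (β : Fin s → Basis (Fin n) ℂ X) (v : Fin s → Fin n → X) :
    ℕ → ℂ :=
  pencilCoeff (Matrix.of fun k l => boxForm b hs β v k (vecAt v (idxZero hs) 0) (baseVec hs v l))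
    (Matrix.of fun k l => boxForm b hs β v k (vecAt v (idxZero hs) 1) (baseVec hs v l))

/-- A vector of a complement of the plateau in `V`. -/
def complVec (hs : e + 3 ≤ s) (v : Fin s → Fin n → X) (i j : ℕ) : X :=
  if e = 1 then vecAt v (idxZero hs) j
  else if i = 0 then vecAt v (idxOne hs) j
  else if i = 1 then vecAt v (idxZero hs) j
  else if j < 2 then vecAt v (idxZero hs) j else vecAt v (idxOne hs) (j - 2)

/-- The first `b + κ` vectors of the `i`-th basis, followed by a basis of a complement
of `F_κ` in `V`, where `κ` is the plateau. -/
def complFrame (b : ℕ) (hs : e + 3 ≤ s) (v : Fin s → Fin n → X) (i : Fin s) (j : Fin n) : X :=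
  if (j : ℕ) < b + plateau e i then v i j else complVec hs v i (j - (b + plateau e i))

/-- The conditions that ensure that a tuple of bases induces a base instance with `e + 1`
solutions, at which the three hyperplanes meet `V` transversally. -/
structure IsBaseFrame (b : ℕ) (hs : e + 3 ≤ s) (β : Fin s → Basis (Fin n) ℂ X)
    (v : Fin s → Fin n → X) : Prop where
  compl : ∀ i : Fin s, (i : ℕ) < e + 3 → (β i).det (complFrame b hs v i) ≠ 0
  lead : rootCoeff b hs β v (e + 1) ≠ 0
  simple : ∀ t, ∑ k ∈ Finset.range (e + 2), rootCoeff b hs β v k * t ^ k = 0 →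
    ∑ k ∈ Finset.range (e + 2), rootCoeff b hs β v k * (k * t ^ (k - 1)) ≠ 0
  transverse : ∀ t, ∑ k ∈ Finset.range (e + 2), rootCoeff b hs β v k * t ^ k = 0 →
    formDet (theta b hs β v t) ![baseVec hs v 1, baseVec hs v 2, lastVec hs v] ≠ 0

section Algebra

variable (hs : e + 3 ≤ s) (β : Fin s → Basis (Fin n) ℂ X) (v : Fin s → Fin n → X)

lemma theta_apply (t : ℂ) (k : Fin 3) (x : X) : theta b hs β v t k x =
    boxForm b hs β v k (vecAt v (idxZero hs) 0) x +
      t * boxForm b hs β v k (vecAt v (idxZero hs) 1) x :=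
  pencil_add_smul _ _ _ _ _ _

lemma theta_movingPoint (t : ℂ) (k : Fin 3) : theta b hs β v t k (movingPoint hs v t) = 0 :=
  pencil_self _ _ _

lemma boxForm_col_zero (he : e = 1) (k : Fin 3) :
    boxForm b hs β v k (vecAt v (idxZero hs) 1) (baseVec hs v 0) = 0 := by
  rw [baseVec, if_pos he]
  exact pencil_self _ _ _

lemma sum_rootCoeff (he : e = 1 ∨ e = 2) (t : ℂ) :
    ∑ k ∈ Finset.range (e + 2), rootCoeff b hs β v k * t ^ k
      = formDet (theta b hs β v t) (baseVec hs v) := by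
  have h1 : formDet (theta b hs β v t) (baseVec hs v) =
      ∑ k ∈ Finset.range 4, rootCoeff b hs β v k * t ^ k := by
    rw [rootCoeff, ← det_add_smul, formDet]
    congr 1
    ext k l
    simp [theta_apply]
  rw [h1]
  rcases he with rfl | rfl
  · rw [Finset.sum_range_succ _ 3]
    have : rootCoeff b hs β v 3 = 0 := pencilCoeff_three_eq_zero (boxForm_col_zero hs β v rfl)
    rw [this, zero_mul, add_zero]
  · rfl

end Algebra

section FlagVectors

lemma exists_sum_of_mem_flagOf (v : Fin s → Basis (Fin n) ℂ X) (i : Fin s) {m : ℕ}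
    {x : X} (hx : x ∈ (flagOf (v i)).space m) :
    ∃ c : ℕ → ℂ, x = ∑ j ∈ Finset.range m, c j • vecAt (fun i j => v i j) i j := by
  rw [flagOf_space] at hx
  induction hx using Submodule.span_induction with
  | mem x hx =>
    obtain ⟨j, hj, rfl⟩ := hx
    refine ⟨Pi.single j 1, ?_⟩
    rw [Finset.sum_eq_single (j : ℕ)]
    · simp [vecAt_eq _ _ j.2]
    · intro k _ hk
      simp [Pi.single_eq_of_ne hk]
    · intro h
      exact absurd (Finset.mem_range.2 hj) h
  | zero => exact ⟨0, by simp⟩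
  | add x y _ _ hx hy =>
    obtain ⟨c, rfl⟩ := hx
    obtain ⟨d, rfl⟩ := hy
    exact ⟨c + d, by simp [add_smul, Finset.sum_add_distrib]⟩
  | smul r x _ hx =>
    obtain ⟨c, rfl⟩ := hx
    exact ⟨r • c, by simp [Finset.smul_sum, mul_smul]⟩

lemma vecAt_mem_flagOf (v : Fin s → Basis (Fin n) ℂ X) (i : Fin s) {j m : ℕ} (hj : j < n)
    (hjm : j < m) : vecAt (fun i j => v i j) i j ∈ (flagOf (v i)).space m := by
  rw [vecAt_eq _ _ hj]
  exact mem_flagOf _ _ hjm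

lemma coord_vecAt (v : Fin s → Basis (Fin n) ℂ X) (i : Fin s) {j : ℕ} (hj : j < n)
    (k : Fin n) : (v i).coord k (vecAt (fun i j => v i j) i j) = if (k : ℕ) = j then 1 else 0 := by
  rw [vecAt_eq _ _ hj, Basis.coord_apply, Basis.repr_self, Finsupp.single_apply]
  congr 1
  simp only [Fin.ext_iff, eq_iff_iff]
  exact eq_comm

end FlagVectors

end Frames

/-! ### The base planes of a tuple of bases in general position -/

section BasePlanes

variable {X : Type*} [AddCommGroup X] [Module ℂ X] {s e b : ℕ}

/-- The vectors of a tuple of bases. -/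
abbrev vecs {n : ℕ} (v : Fin s → Basis (Fin n) ℂ X) : Fin s → Fin n → X := fun i j => v i j

/-- The flags spanned by a tuple of bases. -/
abbrev flags {n : ℕ} (v : Fin s → Basis (Fin n) ℂ X) : Fin s → CompleteFlag X :=
  fun i => flagOf (v i)

variable {hs : e + 3 ≤ s} {β v : Fin s → Basis (Fin (5 + b)) ℂ X}

lemma mem_flags_iff (β v : Fin s → Basis (Fin (5 + b)) ℂ X) (i : Fin s) {m : ℕ} {x : X} :
    x ∈ (flags v i).space m ↔ ∀ k, m ≤ k → k < 5 + b → coordForm β (vecs v) i k x = 0 := by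
  rw [mem_flagOf_iff]
  constructor
  · intro h k hk hk'
    rw [coordForm_eq_zero_iff β v i hk']
    exact h ⟨k, hk'⟩ hk
  · intro h k hk
    rw [← coordForm_eq_zero_iff β v i k.2]
    exact h k hk k.2

lemma mem_flags_add_three (β v : Fin s → Basis (Fin (5 + b)) ℂ X) (i : Fin s) {x : X} :
    x ∈ (flags v i).space (b + 3) ↔
      coordForm β (vecs v) i (b + 4) x = 0 ∧ coordForm β (vecs v) i (b + 3) x = 0 := by
  rw [mem_flags_iff β v]
  constructor
  · exact fun h => ⟨h _ (by omega) (by omega), h _ (by omega) (by omega)⟩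
  · rintro ⟨h1, h2⟩ k hk hk'
    obtain rfl | rfl : k = b + 4 ∨ k = b + 3 := by omega
    exacts [h1, h2]

lemma flagOf_space_zero {n : ℕ} (v : Basis (Fin n) ℂ X) : (flagOf v).space 0 = ⊥ := by
  simp [flagOf_space]

lemma flagOf_le_span_of_forall {n : ℕ} (v : Fin s → Basis (Fin n) ℂ X) (i : Fin s) {m : ℕ}
    {S : Submodule ℂ X} (h : ∀ j < m, vecAt (vecs v) i j ∈ S) : (flags v i).space m ≤ S := by
  rw [flagOf_space, Submodule.span_le]
  rintro _ ⟨j, hj, rfl⟩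
  have := h j hj
  rwa [vecAt_eq _ _ j.2] at this

lemma movingPoint_mem (v : Fin s → Basis (Fin (5 + b)) ℂ X) (t : ℂ) :
    movingPoint hs (vecs v) t ∈ (flags v (idxZero hs)).space 2 :=
  add_mem (vecAt_mem_flagOf v _ (by omega) (by omega))
    (Submodule.smul_mem _ _ (vecAt_mem_flagOf v _ (by omega) (by omega)))

lemma baseVec_mem_one (v : Fin s → Basis (Fin (5 + b)) ℂ X) (he : e = 1) (l : Fin 3) :
    baseVec hs (vecs v) l ∈ (flags v (idxZero hs)).space 4 := by
  rw [baseVec, if_pos he]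
  exact vecAt_mem_flagOf v _ (by omega) (by omega)

lemma baseVec_mem_two (v : Fin s → Basis (Fin (5 + b)) ℂ X) (he : e = 2) (l : Fin 3) :
    baseVec hs (vecs v) l ∈ (flags v (idxOne hs)).space 3 := by
  rw [baseVec, if_neg (by omega)]
  exact vecAt_mem_flagOf v _ (by omega) (by omega)

lemma first_le_baseSpace (F : Fin s → CompleteFlag X) :
    (F (idxZero hs)).space 2 ≤ baseSpace hs F := by
  unfold baseSpace
  split_ifs
  · exact (F _).mono (by norm_num)
  · exact le_sup_left

lemma movingPoint_mem_baseSpace (v : Fin s → Basis (Fin (5 + b)) ℂ X) (t : ℂ) :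
    movingPoint hs (vecs v) t ∈ baseSpace hs (flags v) :=
  first_le_baseSpace _ (movingPoint_mem v t)

lemma baseVec_mem_baseSpace (v : Fin s → Basis (Fin (5 + b)) ℂ X) (he : e = 1 ∨ e = 2)
    (l : Fin 3) : baseVec hs (vecs v) l ∈ baseSpace hs (flags v) := by
  rcases he with rfl | rfl
  · rw [baseSpace, if_pos rfl]
    exact (flags v _).mono (by norm_num) (baseVec_mem_one v rfl l)
  · rw [baseSpace, if_neg (by norm_num)]
    exact Submodule.mem_sup_right (baseVec_mem_two v rfl l)

lemma exists_eq_of_mem_flags_four (v : Fin s → Basis (Fin (5 + b)) ℂ X) (he : e = 1) (t : ℂ)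
    {x : X} (hx : x ∈ (flags v (idxZero hs)).space 4) :
    ∃ (c₀ : ℂ) (c : Fin 3 → ℂ),
      x = c₀ • movingPoint hs (vecs v) t + ∑ l, c l • baseVec hs (vecs v) l := by
  obtain ⟨d, rfl⟩ := exists_sum_of_mem_flagOf v _ hx
  refine ⟨d 0, ![d 1 - d 0 * t, d 2, d 3], ?_⟩
  simp only [Finset.sum_range_succ, Finset.range_zero, Finset.sum_empty, Fin.sum_univ_three,
    baseVec, if_pos he, movingPoint, Matrix.cons_val_zero, Matrix.cons_val_one,
    Matrix.cons_val_two, Matrix.tail_cons, Matrix.head_cons, Fin.val_zero, Fin.val_one,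
    Fin.val_two]
  module

lemma exists_eq_of_mem_flags_three (v : Fin s → Basis (Fin (5 + b)) ℂ X) (he : e = 2)
    {x : X} (hx : x ∈ (flags v (idxOne hs)).space 3) :
    ∃ c : Fin 3 → ℂ, x = ∑ l, c l • baseVec hs (vecs v) l := by
  obtain ⟨d, rfl⟩ := exists_sum_of_mem_flagOf v _ hx
  refine ⟨fun l => d l, ?_⟩
  simp [Finset.sum_range_succ, Fin.sum_univ_three, baseVec, he]

lemma exists_eq_of_mem_baseSpace (v : Fin s → Basis (Fin (5 + b)) ℂ X) (he : e = 1 ∨ e = 2)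
    (t : ℂ) {x : X} (hx : x ∈ baseSpace hs (flags v)) :
    ∃ (c₀ : ℂ) (c : Fin 3 → ℂ) (c₁ : ℂ), x = c₀ • movingPoint hs (vecs v) t +
      ∑ l, c l • baseVec hs (vecs v) l + c₁ • lastVec hs (vecs v) := by
  rcases he with he | he
  · rw [baseSpace, if_pos he] at hx
    obtain ⟨d, rfl⟩ := exists_sum_of_mem_flagOf v _ hx
    have h4 : ∑ j ∈ Finset.range 4, d j • vecAt (vecs v) (idxZero hs) j ∈
        (flags v (idxZero hs)).space 4 := Submodule.sum_mem _ fun j hj =>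
      Submodule.smul_mem _ _ (vecAt_mem_flagOf v _
        (by have := Finset.mem_range.1 hj; omega) (Finset.mem_range.1 hj))
    obtain ⟨c₀, c, h⟩ := exists_eq_of_mem_flags_four v he t h4
    exact ⟨c₀, c, d 4, by rw [Finset.sum_range_succ, h, lastVec, if_pos he]⟩
  · rw [baseSpace, if_neg (by omega)] at hx
    obtain ⟨p, hp, q, hq, rfl⟩ := Submodule.mem_sup.1 hx
    obtain ⟨c, rfl⟩ := exists_eq_of_mem_flags_three v he hq
    obtain ⟨d, rfl⟩ := exists_sum_of_mem_flagOf v _ hp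
    refine ⟨d 0, c, d 1 - d 0 * t, ?_⟩
    simp only [Finset.sum_range_succ, Finset.range_zero, Finset.sum_empty, movingPoint, lastVec,
      he]
    rw [if_neg (by omega)]
    module

namespace IsBaseFrame

variable (hv : IsBaseFrame b hs β (vecs v))
include hv

lemma disjoint_compl (i : Fin s) (hi : (i : ℕ) < e + 3) :
    Disjoint ((flags v i).space (b + plateau e i))
      (Submodule.span ℂ (complVec hs (vecs v) i '' {j | j < 5 - plateau e i})) := by
  have h1 := hv.compl i hi
  have h2 : LinearIndependent ℂ (complFrame b hs (vecs v) i) :=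
    ((β i).is_basis_iff_det.2 (isUnit_iff_ne_zero.2 h1)).1
  have h3 := h2.disjoint_span_image
    (s := {k | (k : ℕ) < b + plateau e i}) (t := {k | b + plateau e i ≤ (k : ℕ)})
    (Set.disjoint_left.2 fun k (hk : (k : ℕ) < _) (hk' : _ ≤ (k : ℕ)) => absurd (hk.trans_le hk') (lt_irrefl _))
  refine h3.mono (Submodule.span_mono ?_) (Submodule.span_mono ?_)
  · rintro _ ⟨k, hk, rfl⟩
    exact ⟨k, hk, if_pos hk⟩
  · rintro _ ⟨j, hj, rfl⟩
    have hj' : j < 5 - plateau e i := hj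
    refine ⟨⟨b + plateau e i + j, by omega⟩, by simp, ?_⟩
    rw [complFrame, if_neg (by simp)]
    congr 1
    simp

omit hv in
lemma baseSpace_le (he : e = 1 ∨ e = 2) (i : Fin s) (hi : (i : ℕ) < e + 3) :
    baseSpace hs (flags v) ≤ (flags v i).space (plateau e i) ⊔
      Submodule.span ℂ (complVec hs (vecs v) i '' {j | j < 5 - plateau e i}) := by
  rcases he with rfl | rfl
  · rw [baseSpace, if_pos rfl]
    by_cases h0 : (i : ℕ) < 1
    · obtain rfl : i = idxZero hs := Fin.ext (by simp [idxZero]; omega)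
      have : plateau 1 (idxZero hs) = 5 := rfl
      rw [this]
      exact le_sup_left
    · have : plateau 1 i = 0 := if_neg h0
      rw [this]
      refine le_sup_of_le_right (flagOf_le_span_of_forall v _ fun j hj => ?_)
      exact Submodule.subset_span ⟨j, hj, by rw [complVec, if_pos rfl]⟩
  · rw [baseSpace, if_neg (by norm_num)]
    by_cases h0 : (i : ℕ) = 0
    · obtain rfl : i = idxZero hs := Fin.ext h0
      have : plateau 2 (idxZero hs) = 2 := rfl
      rw [this]
      refine sup_le_sup_left (flagOf_le_span_of_forall v _ fun j hj => ?_) _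
      exact Submodule.subset_span ⟨j, hj, by rw [complVec, if_neg (by norm_num), if_pos h0]⟩
    · by_cases h1 : (i : ℕ) = 1
      · obtain rfl : i = idxOne hs := Fin.ext h1
        have : plateau 2 (idxOne hs) = 3 := rfl
        rw [this, sup_comm]
        refine sup_le_sup_left (flagOf_le_span_of_forall v _ fun j hj => ?_) _
        exact Submodule.subset_span ⟨j, hj, by
          rw [complVec, if_neg (by norm_num), if_neg h0, if_pos h1]⟩
      · have : plateau 2 i = 0 := if_neg (by omega)
        rw [this]
        refine le_sup_of_le_right (sup_le (flagOf_le_span_of_forall v _ fun j hj => ?_)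
          (flagOf_le_span_of_forall v _ fun j hj => ?_))
        · exact Submodule.subset_span ⟨j, by simp; omega, by
            rw [complVec, if_neg (by norm_num), if_neg h0, if_neg h1, if_pos hj]⟩
        · exact Submodule.subset_span ⟨j + 2, by simp; omega, by
            rw [complVec, if_neg (by norm_num), if_neg h0, if_neg h1, if_neg (by omega),
              Nat.add_sub_cancel]⟩

lemma inf_le_plateau (he : e = 1 ∨ e = 2) (i : Fin s) (hi : (i : ℕ) < e + 3) :
    (flags v i).space (b + plateau e i) ⊓ baseSpace hs (flags v) ≤
      (flags v i).space (plateau e i) := by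
  rintro x ⟨hx, hxV⟩
  obtain ⟨y, hy, z, hz, rfl⟩ := Submodule.mem_sup.1 (baseSpace_le he i hi hxV)
  have h1 : z ∈ (flags v i).space (b + plateau e i) := by
    have := sub_mem hx ((flags v i).mono (Nat.le_add_left _ b) hy)
    simpa using this
  have h2 := Submodule.disjoint_def.1 (hv.disjoint_compl i hi) z h1 hz
  simpa [h2] using hy

omit hv in
lemma plateau_le (he : e = 1 ∨ e = 2) (i : Fin s) :
    (flags v i).space (plateau e i) ≤ baseSpace hs (flags v) := by
  by_cases h0 : (i : ℕ) < e
  · rcases he with rfl | rfl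
    · obtain rfl : i = idxZero hs := Fin.ext (by simp [idxZero]; omega)
      rw [baseSpace, if_pos rfl]
      exact le_rfl
    · rw [baseSpace, if_neg (by norm_num)]
      obtain h1 | h1 : (i : ℕ) = 0 ∨ (i : ℕ) = 1 := by omega
      · obtain rfl : i = idxZero hs := Fin.ext h1
        exact le_sup_left
      · obtain rfl : i = idxOne hs := Fin.ext h1
        exact le_sup_right
  · have : plateau e i = 0 := if_neg h0
    rw [this, flagOf_space_zero]
    exact bot_le

lemma inf_eq_bot (he : e = 2) :
    (flags v (idxZero hs)).space 2 ⊓ (flags v (idxOne hs)).space 3 = ⊥ := by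
  subst he
  have h1 := hv.disjoint_compl (idxZero hs) (by simp [idxZero])
  rw [← disjoint_iff]
  refine h1.mono ((flags v _).mono (Nat.le_add_left _ _)) ?_
  refine flagOf_le_span_of_forall v _ fun j hj => ?_
  exact Submodule.subset_span ⟨j, hj, by rw [complVec, if_neg (by norm_num)]; rfl⟩

lemma finrank_baseSpace [FiniteDimensional ℂ X] (he : e = 1 ∨ e = 2) :
    finrank ℂ (baseSpace hs (flags v)) = 5 := by
  have hX : finrank ℂ X = 5 + b := by
    rw [finrank_eq_card_basis (v (idxZero hs)), Fintype.card_fin]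
  rcases he with rfl | rfl
  · rw [baseSpace, if_pos rfl, (flags v _).finrank_space, hX]
    omega
  · rw [baseSpace, if_neg (by norm_num)]
    have h1 := Submodule.finrank_sup_add_finrank_inf_eq ((flags v (idxZero hs)).space 2)
      ((flags v (idxOne hs)).space 3)
    rw [hv.inf_eq_bot rfl, finrank_bot, (flags v _).finrank_space, (flags v _).finrank_space,
      hX] at h1
    omega

lemma eq_zero_of_sum_eq_zero (he : e = 1 ∨ e = 2) {t c₀ : ℂ} {c : Fin 3 → ℂ} {c₁ : ℂ}
    (h : c₀ • movingPoint hs (vecs v) t + ∑ l, c l • baseVec hs (vecs v) l +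
      c₁ • lastVec hs (vecs v) = 0) : c₀ = 0 ∧ c = 0 ∧ c₁ = 0 := by
  rcases he with rfl | rfl
  · have hc (j k : ℕ) (hj : j < 5) (hk : k < 5 + b) := coord_vecAt v (idxZero hs)
      (show j < 5 + b by omega) ⟨k, hk⟩
    have hcoord (k : ℕ) (hk : k < 5 + b) := congrArg ((v (idxZero hs)).coord ⟨k, hk⟩) h
    simp only [movingPoint, Fin.sum_univ_three, baseVec, lastVec, if_true, map_add, map_smul,
      smul_eq_mul, Fin.val_zero, Fin.val_one, Fin.val_two, map_zero, Nat.reduceAdd,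
      hc 0 _ (by norm_num), hc 1 _ (by norm_num), hc 2 _ (by norm_num), hc 3 _ (by norm_num),
      hc 4 _ (by norm_num)] at hcoord
    have h0 := hcoord 0 (by omega)
    have h1 := hcoord 1 (by omega)
    have h2 := hcoord 2 (by omega)
    have h3 := hcoord 3 (by omega)
    have h4 := hcoord 4 (by omega)
    norm_num at h0 h1 h2 h3 h4
    subst h0
    refine ⟨rfl, ?_, h4⟩
    funext l
    fin_cases l
    exacts [by simpa using h1, h2, h3]
  · have hq : ∑ l, c l • baseVec hs (vecs v) l ∈ (flags v (idxOne hs)).space 3 :=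
      Submodule.sum_mem _ fun l _ => Submodule.smul_mem _ _ (baseVec_mem_two v rfl l)
    have hl : lastVec hs (vecs v) ∈ (flags v (idxZero hs)).space 2 := by
      rw [lastVec, if_neg (by norm_num)]
      exact vecAt_mem_flagOf v _ (by omega) (by omega)
    have hp : ∑ l, c l • baseVec hs (vecs v) l ∈ (flags v (idxZero hs)).space 2 := by
      have : ∑ l, c l • baseVec hs (vecs v) l =
          -(c₀ • movingPoint hs (vecs v) t + c₁ • lastVec hs (vecs v)) := by
        rw [eq_neg_iff_add_eq_zero, ← h]
        abel
      rw [this]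
      exact neg_mem (add_mem (Submodule.smul_mem _ _ (movingPoint_mem v t))
        (Submodule.smul_mem _ _ hl))
    have h0 : ∑ l, c l • baseVec hs (vecs v) l = 0 := by
      have : ∑ l, c l • baseVec hs (vecs v) l ∈
          (flags v (idxZero hs)).space 2 ⊓ (flags v (idxOne hs)).space 3 := ⟨hp, hq⟩
      rwa [hv.inf_eq_bot rfl] at this
    rw [h0, add_zero] at h
    have hc (i : Fin s) (j k : ℕ) (hj : j < 5) (hk : k < 5 + b) := coord_vecAt v i
      (show j < 5 + b by omega) ⟨k, hk⟩
    have hcoord (k : ℕ) (hk : k < 5 + b) := congrArg ((v (idxZero hs)).coord ⟨k, hk⟩) h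
    have hcoord' (k : ℕ) (hk : k < 5 + b) := congrArg ((v (idxOne hs)).coord ⟨k, hk⟩) h0
    simp only [movingPoint, Fin.sum_univ_three, baseVec, lastVec, OfNat.ofNat_ne_one, if_false,
      map_add, map_smul, smul_eq_mul, Fin.val_zero, Fin.val_one, Fin.val_two, map_zero,
      hc _ 0 _ (by norm_num), hc _ 1 _ (by norm_num), hc _ 2 _ (by norm_num)]
      at hcoord hcoord'
    have h1 := hcoord 0 (by omega)
    have h2 := hcoord 1 (by omega)
    have h3 := hcoord' 0 (by omega)
    have h4 := hcoord' 1 (by omega)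
    have h5 := hcoord' 2 (by omega)
    norm_num at h1 h2 h3 h4 h5
    subst h1
    refine ⟨rfl, ?_, by simpa using h2⟩
    funext l
    fin_cases l
    exacts [h3, h4, h5]

end IsBaseFrame

end BasePlanes

section RootPlanes

variable {X : Type*} [AddCommGroup X] [Module ℂ X] {s e b : ℕ}
  {hs : e + 3 ≤ s} {β v : Fin s → Basis (Fin (5 + b)) ℂ X}

/-- The polynomial equation satisfied by the parameters of the base planes. -/
def IsRoot {n : ℕ} (b : ℕ) (hs : e + 3 ≤ s) (β : Fin s → Basis (Fin n) ℂ X)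
    (v : Fin s → Fin n → X) (t : ℂ) : Prop :=
  ∑ k ∈ Finset.range (e + 2), rootCoeff b hs β v k * t ^ k = 0

/-- The base plane that corresponds to the root `t`. -/
def rootPlane (hs : e + 3 ≤ s) (β v : Fin s → Basis (Fin (5 + b)) ℂ X) (t : ℂ) :
    Submodule ℂ X :=
  (⨅ k, LinearMap.ker (theta b hs β (vecs v) t k)) ⊓ baseSpace hs (flags v)

lemma pencil_eq_zero_of_mem {h : Submodule ℂ X} [FiniteDimensional ℂ X]
    (hh : IsBasePlane b hs (flags v) h) (β : Fin s → Basis (Fin (5 + b)) ℂ X) {p q : X}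
    (hp : p ∈ h) (hp0 : p ≠ 0) (hq : q ∈ h) (k : Fin 3) : boxForm b hs β (vecs v) k p q = 0 := by
  by_cases hqp : q ∈ Submodule.span ℂ {p}
  · obtain ⟨c, rfl⟩ := Submodule.mem_span_singleton.1 hqp
    rw [map_smul, boxForm, pencil_self, smul_zero]
  have h1 : Submodule.span ℂ {p, q} = h := by
    apply Submodule.eq_of_le_of_finrank_eq
    · rw [Submodule.span_le]
      rintro x (rfl | rfl) <;> assumption
    · rw [hh.finrank_eq, finrank_span_pair_eq_two hp0 hqp]
  obtain ⟨x, ⟨hxh, hxA⟩, hx0⟩ := exists_ne_zero_of_one_le_finrank (hh.box k)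
  rw [← h1] at hxh
  obtain ⟨c, d, rfl⟩ := Submodule.mem_span_pair.1 hxh
  rw [SetLike.mem_coe, mem_flags_add_three β v] at hxA
  refine pencil_eq_zero ?_ hxA.1 hxA.2
  by_contra! hcd
  simp [hcd.1, hcd.2] at hx0

namespace IsBaseFrame

variable (hv : IsBaseFrame b hs β (vecs v)) (he : e = 1 ∨ e = 2)
include hv he

lemma exists_second_point {t : ℂ} (ht : IsRoot b hs β (vecs v) t) :
    ∃ c : Fin 3 → ℂ, c 0 ≠ 0 ∧
      ∀ k, theta b hs β (vecs v) t k (∑ l, c l • baseVec hs (vecs v) l) = 0 := by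
  have h1 := ht
  rw [IsRoot, sum_rootCoeff hs β _ he] at h1
  obtain ⟨c, hc0, hc⟩ := exists_of_formDet_eq_zero h1
  refine ⟨c, fun h0 => hc0 ?_, hc⟩
  have h2 := eq_zero_of_formDet_ne_zero (hv.transverse t ht) (c := ![c 1, c 2, 0]) (fun k => by
    have := hc k
    rw [Fin.sum_univ_three] at this ⊢
    simpa [h0] using this)
  funext l
  fin_cases l
  exacts [h0, congrFun h2 0, congrFun h2 1]

omit hv in
lemma span_pair_le_rootPlane {t : ℂ} {c : Fin 3 → ℂ}
    (hc : ∀ k, theta b hs β (vecs v) t k (∑ l, c l • baseVec hs (vecs v) l) = 0) :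
    Submodule.span ℂ {movingPoint hs (vecs v) t, ∑ l, c l • baseVec hs (vecs v) l} ≤
      rootPlane hs β v t := by
  rw [Submodule.span_le]
  rintro x (rfl | rfl)
  · exact ⟨by simp [theta_movingPoint], movingPoint_mem_baseSpace v t⟩
  · refine ⟨by simpa using hc, Submodule.sum_mem _ fun l _ => Submodule.smul_mem _ _
      (baseVec_mem_baseSpace v he l)⟩

lemma finrank_span_pair {t : ℂ} {c : Fin 3 → ℂ} (hc : c ≠ 0) :
    finrank ℂ (Submodule.span ℂ {movingPoint hs (vecs v) t, ∑ l, c l • baseVec hs (vecs v) l}) = 2 := by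
  refine finrank_span_pair_eq_two (fun h0 => ?_) (fun hmem => hc ?_)
  · have := hv.eq_zero_of_sum_eq_zero he (t := t) (c₀ := 1) (c := 0) (c₁ := 0) (by simp [h0])
    exact one_ne_zero this.1
  · obtain ⟨a, ha⟩ := Submodule.mem_span_singleton.1 hmem
    exact (hv.eq_zero_of_sum_eq_zero he (t := t) (c₀ := -a) (c := c) (c₁ := 0)
      (by rw [← ha]; module)).2.1

lemma rootPlane_eq_span {t : ℂ} (ht : IsRoot b hs β (vecs v) t) {c : Fin 3 → ℂ} (hc0 : c 0 ≠ 0)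
    (hc : ∀ k, theta b hs β (vecs v) t k (∑ l, c l • baseVec hs (vecs v) l) = 0) :
    rootPlane hs β v t =
      Submodule.span ℂ {movingPoint hs (vecs v) t, ∑ l, c l • baseVec hs (vecs v) l} := by
  refine le_antisymm ?_ (span_pair_le_rootPlane he hc)
  rintro x ⟨hx, hxV⟩
  have hx' : ∀ k, theta b hs β (vecs v) t k x = 0 := by simpa using hx
  obtain ⟨d₀, d, d₁, rfl⟩ := exists_eq_of_mem_baseSpace v he t hxV
  have h1 := eq_zero_of_formDet_ne_zero (hv.transverse t ht)
    (c := ![d 1 - d 0 / c 0 * c 1, d 2 - d 0 / c 0 * c 2, d₁]) (fun k => by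
    have h2 := hx' k
    have h3 := hc k
    rw [map_add, map_add, map_smul, theta_movingPoint, smul_zero, zero_add] at h2
    simp only [Fin.sum_univ_three, map_add, map_smul, smul_eq_mul, Matrix.cons_val_zero,
      Matrix.cons_val_one, Matrix.cons_val_two, Matrix.tail_cons, Matrix.head_cons] at h2 h3 ⊢
    have h4 : d 0 = d 0 / c 0 * c 0 := by field_simp
    linear_combination h2 - d 0 / c 0 * h3 - theta b hs β (vecs v) t k (baseVec hs (vecs v) 0) * h4)
  have h2 := congrFun h1 0
  have h3 := congrFun h1 1
  have h4 : d₁ = 0 := congrFun h1 2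
  simp only [Matrix.cons_val_zero, Matrix.cons_val_one, Pi.zero_apply, sub_eq_zero] at h2 h3
  have h5 : d 0 = d 0 / c 0 * c 0 := by field_simp
  refine Submodule.mem_span_pair.2 ⟨d₀, d 0 / c 0, ?_⟩
  rw [h4, zero_smul, add_zero, Finset.smul_sum]
  congr 1
  refine Finset.sum_congr rfl fun l _ => ?_
  rw [smul_smul]
  congr 1
  fin_cases l
  exacts [h5.symm, h2.symm, h3.symm]

lemma isBasePlane_rootPlane [FiniteDimensional ℂ X] {t : ℂ} (ht : IsRoot b hs β (vecs v) t) :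
    IsBasePlane b hs (flags v) (rootPlane hs β v t) := by
  obtain ⟨c, hc0, hc⟩ := hv.exists_second_point he ht
  have hc0' : c ≠ 0 := fun h => hc0 (by rw [h]; rfl)
  have h2 := hv.finrank_span_pair he (t := t) hc0'
  have hspan := hv.rootPlane_eq_span he ht hc0 hc
  rw [← hspan] at h2
  set p := movingPoint hs (vecs v) t with hp
  set w := ∑ l, c l • baseVec hs (vecs v) l with hw
  have hpm : p ∈ rootPlane hs β v t := by
    rw [hspan]
    exact Submodule.subset_span (by simp)
  have hwm : w ∈ rootPlane hs β v t := by
    rw [hspan]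
    exact Submodule.subset_span (by simp)
  have hind (a d : ℂ) (h : a • p + d • w = 0) : a = 0 ∧ d = 0 := by
    have h3 := hv.eq_zero_of_sum_eq_zero he (t := t) (c₀ := a) (c := d • c) (c₁ := 0) (by
      rw [← h, hw, Finset.smul_sum]
      simp [mul_smul, hp])
    refine ⟨h3.1, ?_⟩
    have := congrFun h3.2.1 0
    simpa [hc0] using this
  have hp0 : p ≠ 0 := fun h => one_ne_zero (hind 1 0 (by simp [h])).1
  have hw0 : w ≠ 0 := fun h => one_ne_zero (hind 0 1 (by simp [h])).2
  refine ⟨h2, one_le_finrank_of_mem ⟨hpm, movingPoint_mem v t⟩ hp0, fun he1 => ?_, fun he2 => ?_,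
    fun k => ?_⟩
  · rw [hspan, Submodule.span_le]
    rintro x (rfl | rfl)
    · exact (flags v _).mono (by norm_num) (movingPoint_mem v t)
    · exact Submodule.sum_mem _ fun l _ => Submodule.smul_mem _ _ (baseVec_mem_one v he1 l)
  · exact one_le_finrank_of_mem ⟨hwm, Submodule.sum_mem _ fun l _ => Submodule.smul_mem _ _
      (baseVec_mem_two v he2 l)⟩ hw0
  · obtain ⟨a, d, had, h3, h4⟩ := exists_of_pencil_eq_zero (hc k)
    refine one_le_finrank_of_mem (x := a • p + d • w)
      ⟨add_mem (Submodule.smul_mem _ _ hpm) (Submodule.smul_mem _ _ hwm),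
        (mem_flags_add_three β v _).2 ⟨h3, h4⟩⟩ fun h0 => ?_
    obtain ⟨rfl, rfl⟩ := hind a d h0
    simp at had

lemma vecAt_one_notMem [FiniteDimensional ℂ X] {h : Submodule ℂ X}
    (hh : IsBasePlane b hs (flags v) h) : vecAt (vecs v) (idxZero hs) 1 ∉ h := by
  intro hmem
  have h10 : vecAt (vecs v) (idxZero hs) 1 ≠ 0 := by
    rw [vecAt_eq _ _ (by omega)]
    exact (v _).ne_zero _
  refine hv.lead ?_
  rcases he with rfl | rfl
  · have h2 : ∃ q ∈ h, q ∉ Submodule.span ℂ {vecAt (vecs v) (idxZero hs) 1} := by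
      by_contra! hcon
      have h3 := Submodule.finrank_mono (show h ≤ _ from hcon)
      rw [finrank_span_singleton h10, hh.finrank_eq] at h3
      omega
    obtain ⟨q, hq, hqp⟩ := h2
    obtain ⟨d, hd⟩ := exists_sum_of_mem_flagOf v _ (hh.le_of_eq_one rfl hq)
    rw [rootCoeff, pencilCoeff_two_eq (boxForm_col_zero hs β _ rfl)]
    refine Matrix.exists_mulVec_eq_zero_iff.1 ⟨![-d 0, d 2, d 3], fun h0 => hqp ?_, ?_⟩
    · have e0 := congrFun h0 0
      have e1 := congrFun h0 1
      have e2 := congrFun h0 2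
      simp only [Matrix.cons_val_zero, Matrix.cons_val_one, Matrix.cons_val_two, Matrix.tail_cons,
        Matrix.head_cons, Pi.zero_apply, neg_eq_zero] at e0 e1 e2
      rw [hd, Submodule.mem_span_singleton]
      exact ⟨d 1, by simp [Finset.sum_range_succ, e0, e1, e2]⟩
    · funext k
      have h3 := pencil_eq_zero_of_mem hh β hmem h10 hq k
      rw [hd] at h3
      simp only [Finset.sum_range_succ, Finset.range_zero, Finset.sum_empty, map_add, map_smul,
        smul_eq_mul, zero_add] at h3
      simp [Matrix.mulVec, dotProduct, Fin.sum_univ_three, baseVec]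
      have h4 : boxForm b hs β (vecs v) k (vecAt (vecs v) (idxZero hs) 1)
          (vecAt (vecs v) (idxZero hs) 1) = 0 := pencil_self _ _ _
      have h5 : boxForm b hs β (vecs v) k (vecAt (vecs v) (idxZero hs) 1)
          (vecAt (vecs v) (idxZero hs) 0) = - boxForm b hs β (vecs v) k
            (vecAt (vecs v) (idxZero hs) 0) (vecAt (vecs v) (idxZero hs) 1) := by
        simp only [boxForm, pencil_apply]
        ring
      rw [h4, h5] at h3
      linear_combination h3
  · obtain ⟨q, ⟨hq, hqF⟩, hq0⟩ := exists_ne_zero_of_one_le_finrank (hh.point_of_eq_two rfl)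
    obtain ⟨c, rfl⟩ := exists_eq_of_mem_flags_three v rfl hqF
    rw [rootCoeff]
    refine Matrix.exists_mulVec_eq_zero_iff.1 ⟨c, fun h0 => hq0 (by simp [h0]), ?_⟩
    funext k
    have h3 := pencil_eq_zero_of_mem hh β hmem h10 hq k
    simpa [Matrix.mulVec, dotProduct, Fin.sum_univ_three, mul_comm] using h3

lemma exists_root_of_isBasePlane [FiniteDimensional ℂ X] {h : Submodule ℂ X}
    (hh : IsBasePlane b hs (flags v) h) :
    ∃ t, IsRoot b hs β (vecs v) t ∧ h = rootPlane hs β v t := by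
  obtain ⟨p, ⟨hp, hpF⟩, hp0⟩ := exists_ne_zero_of_one_le_finrank hh.point
  obtain ⟨d, hd⟩ := exists_sum_of_mem_flagOf v _ hpF
  simp only [Finset.sum_range_succ, Finset.range_zero, Finset.sum_empty, zero_add] at hd
  have hd0 : d 0 ≠ 0 := by
    intro h0
    rw [h0, zero_smul, zero_add] at hd
    have hd1 : d 1 ≠ 0 := fun h1 => hp0 (by rw [hd, h1, zero_smul])
    refine hv.vecAt_one_notMem he hh ?_
    have := Submodule.smul_mem h (d 1)⁻¹ hp
    rwa [hd, smul_smul, inv_mul_cancel₀ hd1, one_smul] at this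
  have hpt : movingPoint hs (vecs v) (d 1 / d 0) ∈ h := by
    have h1 := Submodule.smul_mem h (d 0)⁻¹ hp
    have h2 : (d 0)⁻¹ • p = movingPoint hs (vecs v) (d 1 / d 0) := by
      rw [hd, smul_add, smul_smul, smul_smul, inv_mul_cancel₀ hd0, one_smul, movingPoint,
        div_eq_inv_mul]
    rwa [h2] at h1
  set t := d 1 / d 0 with ht
  have hpt0 : movingPoint hs (vecs v) t ≠ 0 := fun h0 =>
    one_ne_zero (hv.eq_zero_of_sum_eq_zero he (t := t) (c₀ := 1) (c := 0) (c₁ := 0)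
      (by simp [h0])).1
  obtain ⟨c, hc, hcm⟩ : ∃ c : Fin 3 → ℂ, c ≠ 0 ∧ ∑ l, c l • baseVec hs (vecs v) l ∈ h := by
    rcases he with he | he
    · have h2 : ∃ q ∈ h, q ∉ Submodule.span ℂ {movingPoint hs (vecs v) t} := by
        by_contra! hcon
        have h3 := Submodule.finrank_mono (show h ≤ _ from hcon)
        rw [finrank_span_singleton hpt0, hh.finrank_eq] at h3
        omega
      obtain ⟨q, hq, hqp⟩ := h2
      obtain ⟨c₀, c, hqc⟩ := exists_eq_of_mem_flags_four v he t (hh.le_of_eq_one he hq)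
      refine ⟨c, fun h0 => hqp ?_, ?_⟩
      · rw [hqc, Submodule.mem_span_singleton]
        exact ⟨c₀, by simp [h0]⟩
      · have := sub_mem hq (Submodule.smul_mem h c₀ hpt)
        rwa [hqc, add_sub_cancel_left] at this
    · obtain ⟨q, ⟨hq, hqF⟩, hq0⟩ := exists_ne_zero_of_one_le_finrank (hh.point_of_eq_two he)
      obtain ⟨c, rfl⟩ := exists_eq_of_mem_flags_three v he hqF
      exact ⟨c, fun h0 => hq0 (by simp [h0]), hq⟩
  have hθ (k : Fin 3) : theta b hs β (vecs v) t k (∑ l, c l • baseVec hs (vecs v) l) = 0 :=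
    pencil_eq_zero_of_mem hh β hpt hpt0 hcm k
  have hroot : IsRoot b hs β (vecs v) t := by
    rw [IsRoot, sum_rootCoeff hs β _ he]
    exact formDet_eq_zero hc hθ
  refine ⟨t, hroot, ?_⟩
  have h1 := hv.finrank_span_pair he (t := t) hc
  have h2 : Submodule.span ℂ {movingPoint hs (vecs v) t, ∑ l, c l • baseVec hs (vecs v) l} = h := by
    refine Submodule.eq_of_le_of_finrank_eq ?_ (h1.trans hh.finrank_eq.symm)
    rw [Submodule.span_le]
    rintro x (rfl | rfl) <;> assumption
  rw [← h2]
  refine Submodule.eq_of_le_of_finrank_eq (span_pair_le_rootPlane he hθ) ?_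
  rw [h1, (hv.isBasePlane_rootPlane he hroot).finrank_eq]

lemma isBasePlane_iff [FiniteDimensional ℂ X] {h : Submodule ℂ X} :
    IsBasePlane b hs (flags v) h ↔ ∃ t, IsRoot b hs β (vecs v) t ∧ h = rootPlane hs β v t := by
  refine ⟨hv.exists_root_of_isBasePlane he, ?_⟩
  rintro ⟨t, ht, rfl⟩
  exact hv.isBasePlane_rootPlane he ht

theorem encard_isBasePlane [FiniteDimensional ℂ X] :
    {h | IsBasePlane b hs (flags v) h}.encard = (e + 1 : ℕ) := by
  have h1 : {h | IsBasePlane b hs (flags v) h} =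
      rootPlane hs β v '' {t | IsRoot b hs β (vecs v) t} := by
    ext h
    simp only [Set.mem_ofPred_eq, Set.mem_image, hv.isBasePlane_iff he, eq_comm]
  rw [h1, Set.InjOn.encard_image]
  · exact encard_roots_eq hv.lead hv.simple
  · intro t ht t' ht' hEq
    by_contra hne
    refine hv.vecAt_one_notMem he (hv.isBasePlane_rootPlane he ht) ?_
    have hmem (t : ℂ) : movingPoint hs (vecs v) t ∈ rootPlane hs β v t :=
      ⟨by simp [theta_movingPoint], movingPoint_mem_baseSpace v t⟩
    have h2 := hmem t'
    rw [← hEq] at h2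
    have h3 := Submodule.smul_mem _ (t - t')⁻¹ (sub_mem (hmem t) h2)
    have h4 : movingPoint hs (vecs v) t - movingPoint hs (vecs v) t' =
        (t - t') • vecAt (vecs v) (idxZero hs) 1 := by
      rw [movingPoint, movingPoint]
      module
    rwa [h4, smul_smul, inv_mul_cancel₀ (sub_ne_zero.2 hne), one_smul] at h3

end IsBaseFrame

end RootPlanes

/-! ### Tuples of bases that span generic instances -/

section GoodFrames

variable {X : Type*} [AddCommGroup X] [Module ℂ X] {s e b n : ℕ}

/-- The indices of three vectors of the `i`-th basis along which one can project to the hull. -/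
def pivotIdx (b e i : ℕ) : Fin 3 → ℕ :=
  if i < e then (if e = 1 then ![2, 3, 4] else ![1, 2, 3])
  else if i < e + 3 then ![0, 1, b + 3] else ![0, 1, 2]

/-- Three vectors of the `i`-th basis along which one can project to the hull. -/
def pivot (b e : ℕ) (v : Fin s → Fin n → X) (i : Fin s) (l : Fin 3) : X :=
  vecAt v i (pivotIdx b e i l)

/-- A quantity that vanishes if the base plane with parameter `t` meets a certain large subspace of
the `i`-th flag in excessive dimension. -/
def meetValue (b : ℕ) (hs : e + 3 ≤ s) (β : Fin s → Basis (Fin n) ℂ X) (v : Fin s → Fin n → X)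
    (t : ℂ) (i : Fin s) : ℂ :=
  if (i : ℕ) < e then
    if e = 1 then 1
    else if (i : ℕ) = 0 then
      formDet ![theta b hs β v t 0, theta b hs β v t 1, coordForm β v i (b + 4)] (baseVec hs v)
    else coordForm β v i (b + 4) (movingPoint hs v t)
  else formDet ![theta b hs β v t 0, theta b hs β v t 1,
    pencil (coordForm β v i (b + 4)) (coordForm β v i (if (i : ℕ) < e + 3 then b + 2 else b + 3))
      (movingPoint hs v t)] (baseVec hs v)

/-- The conditions that ensure that a tuple of bases spans a generic instance. -/
structure IsGoodFrame (b : ℕ) (hs : e + 3 ≤ s) (β : Fin s → Basis (Fin n) ℂ X)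
    (v : Fin s → Fin n → X) : Prop extends IsBaseFrame b hs β v where
  pivot_ne_zero : ∀ t, IsRoot b hs β v t → ∀ i, formDet (theta b hs β v t) (pivot b e v i) ≠ 0
  meetValue_ne_zero : ∀ t, IsRoot b hs β v t → ∀ i, meetValue b hs β v t i ≠ 0

end GoodFrames

section GoodFrames

variable {X : Type*} [AddCommGroup X] [Module ℂ X] {s e b : ℕ}
  {hs : e + 3 ≤ s} {β v : Fin s → Basis (Fin (5 + b)) ℂ X}

lemma theta_eq_zero_of_mem (β v : Fin s → Basis (Fin (5 + b)) ℂ X) (t : ℂ) (k : Fin 3) {x : X}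
    (hx : x ∈ (flags v (boxIdx hs k)).space (b + 3)) : theta b hs β (vecs v) t k x = 0 := by
  obtain ⟨h1, h2⟩ := (mem_flags_add_three β v _).1 hx
  rw [theta, boxForm, pencil_apply, h1, h2]
  ring

lemma hull_rootPlane_le (t : ℂ) : hull b hs (flags v) (rootPlane hs β v t) ≤
    ⨅ k, LinearMap.ker (theta b hs β (vecs v) t k) := by
  refine le_iInf fun k => (iInf_le _ k).trans (sup_le (fun x hx => ?_) (inf_le_left.trans
    (iInf_le _ k)))
  exact theta_eq_zero_of_mem β v t k hx

namespace IsBaseFrame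

variable (hv : IsBaseFrame b hs β (vecs v))
include hv

lemma hull_rootPlane {t : ℂ} (ht : IsRoot b hs β (vecs v) t) :
    hull b hs (flags v) (rootPlane hs β v t) =
      ⨅ k, LinearMap.ker (theta b hs β (vecs v) t k) := by
  refine le_antisymm (hull_rootPlane_le t) (le_iInf fun k => (iInf_le _ k).trans fun x hx => ?_)
  set p := movingPoint hs (vecs v) t with hp
  set α := coordForm β (vecs v) (boxIdx hs k) (b + 4) with hα
  set α' := coordForm β (vecs v) (boxIdx hs k) (b + 3) with hα'
  have hpm : p ∈ rootPlane hs β v t :=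
    ⟨by simp [hp, theta_movingPoint], movingPoint_mem_baseSpace v t⟩
  have hx' : α p * α' x - α' p * α x = 0 := hx
  have key (c : ℂ) (h1 : α (x - c • p) = 0) (h2 : α' (x - c • p) = 0) :
      x ∈ (flags v (boxIdx hs k)).space (b + 3) ⊔ rootPlane hs β v t := by
    rw [← sub_add_cancel x (c • p)]
    exact Submodule.add_mem_sup ((mem_flags_add_three β v _).2 ⟨h1, h2⟩)
      (Submodule.smul_mem _ _ hpm)
  by_cases h1 : α p = 0
  · by_cases h2 : α' p = 0
    · refine absurd ?_ (hv.transverse t ht)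
      refine Matrix.det_eq_zero_of_row_eq_zero k fun l => ?_
      rw [Matrix.of_apply, theta, boxForm, pencil_apply, ← hα, ← hα', ← hp, h1, h2]
      ring
    · refine key (α' x / α' p) ?_ ?_
      · rw [h1, zero_mul, zero_sub, neg_eq_zero, mul_eq_zero, or_iff_right h2] at hx'
        simp [h1, hx']
      · simp [h2]
  · refine key (α x / α p) (by simp [h1]) ?_
    rw [map_sub, map_smul, smul_eq_mul]
    field_simp
    linear_combination hx'

end IsBaseFrame

namespace IsGoodFrame

variable (hv : IsGoodFrame b hs β (vecs v)) (he : e = 1 ∨ e = 2)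
include hv he

lemma offset_inf_le {t : ℂ} (ht : IsRoot b hs β (vecs v) t) (i : Fin s) :
    (flags v i).space (offset e i) ⊓ (⨅ k, LinearMap.ker (theta b hs β (vecs v) t k)) ≤
      baseSpace hs (flags v) := by
  rintro x ⟨hx, hxZ⟩
  have hx' : ∀ k, theta b hs β (vecs v) t k x = 0 := by simpa using hxZ
  have hpiv := hv.pivot_ne_zero t ht i
  obtain ⟨d, hd⟩ := exists_sum_of_mem_flagOf v i hx
  by_cases h1 : (i : ℕ) < e
  · rw [offset, if_pos h1] at hx hd
    rcases he with rfl | rfl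
    · obtain rfl : i = idxZero hs := Fin.ext (by simp [idxZero]; omega)
      rw [baseSpace, if_pos rfl]
      exact hx
    have hτ (l : Fin 3) : pivot b 2 (vecs v) i l = vecAt (vecs v) i (l + 1) := by
      rw [pivot, pivotIdx, if_pos h1, if_neg (by norm_num)]
      fin_cases l <;> rfl
    simp only [Finset.sum_range_succ, Finset.range_zero, Finset.sum_empty, zero_add,
      Nat.reduceSub] at hd
    have key (y : X) (hy : y ∈ baseSpace hs (flags v))
        (hy' : ∀ k, theta b hs β (vecs v) t k y = 0) (c : Fin 3 → ℂ)
        (hc : x - y = ∑ l, c l • pivot b 2 (vecs v) i l) : x ∈ baseSpace hs (flags v) := by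
      have h2 := eq_zero_of_formDet_ne_zero hpiv (c := c) (fun k => by
        rw [← hc, map_sub, hx', hy', sub_zero])
      rw [h2] at hc
      simp only [Pi.zero_apply, zero_smul, Finset.sum_const_zero, sub_eq_zero] at hc
      rwa [hc]
    obtain h0 | h0 : (i : ℕ) = 0 ∨ (i : ℕ) = 1 := by omega
    · obtain rfl : i = idxZero hs := Fin.ext h0
      refine key (d 0 • movingPoint hs (vecs v) t)
        (Submodule.smul_mem _ _ (movingPoint_mem_baseSpace v t))
        (fun k => by rw [map_smul, theta_movingPoint, smul_zero]) ![d 1 - d 0 * t, d 2, d 3] ?_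
      simp only [Fin.sum_univ_three, hτ, hd, movingPoint, Matrix.cons_val_zero,
        Matrix.cons_val_one, Matrix.cons_val_two, Matrix.tail_cons, Matrix.head_cons, Fin.val_zero,
        Fin.val_one, Fin.val_two]
      module
    · obtain rfl : i = idxOne hs := Fin.ext h0
      obtain ⟨c, hc0, hc⟩ := hv.exists_second_point (Or.inr rfl) ht
      refine key ((d 0 / c 0) • ∑ l, c l • baseVec hs (vecs v) l)
        (Submodule.smul_mem _ _ (Submodule.sum_mem _ fun l _ => Submodule.smul_mem _ _
          (baseVec_mem_baseSpace v (Or.inr rfl) l)))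
        (fun k => by rw [map_smul, hc, smul_zero])
        ![d 1 - d 0 / c 0 * c 1, d 2 - d 0 / c 0 * c 2, d 3] ?_
      have h4 : d 0 = d 0 / c 0 * c 0 := by field_simp
      simp only [Fin.sum_univ_three, hτ, hd, baseVec, Matrix.cons_val_zero,
        Matrix.cons_val_one, Matrix.cons_val_two, Matrix.tail_cons, Matrix.head_cons, Fin.val_zero,
        Fin.val_one, Fin.val_two, OfNat.ofNat_ne_one, if_false]
      nth_rw 1 [h4]
      module
  · have h0 : x = 0 := by
      rw [offset, if_neg h1] at hd
      have hpe : pivot b e (vecs v) i = fun l => vecAt (vecs v) i (pivotIdx b e i l) := rfl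
      by_cases h2 : (i : ℕ) < e + 3
      · rw [if_pos h2] at hd
        have h3 := eq_zero_of_formDet_ne_zero hpiv (c := ![d 0, d 1, 0]) (fun k => by
          have := hx' k
          rw [hd] at this
          simpa [hpe, pivotIdx, h1, h2, Fin.sum_univ_three, Finset.sum_range_succ] using this)
        have e0 : d 0 = 0 := congrFun h3 0
        have e1 : d 1 = 0 := congrFun h3 1
        simp [hd, Finset.sum_range_succ, e0, e1]
      · rw [if_neg h2] at hd
        have h3 := eq_zero_of_formDet_ne_zero hpiv (c := ![d 0, d 1, d 2]) (fun k => by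
          have := hx' k
          rw [hd] at this
          simpa [hpe, pivotIdx, h1, h2, Fin.sum_univ_three, Finset.sum_range_succ] using this)
        have e0 : d 0 = 0 := congrFun h3 0
        have e1 : d 1 = 0 := congrFun h3 1
        have e2 : d 2 = 0 := congrFun h3 2
        simp [hd, Finset.sum_range_succ, e0, e1, e2]
    rw [h0]
    exact zero_mem _

lemma finrank_inf_rootPlane_le [FiniteDimensional ℂ X] {t : ℂ}
    (ht : IsRoot b hs β (vecs v) t) (i : Fin s) :
    finrank ℂ ((flags v i).space (offset e i + b) ⊓ rootPlane hs β v t : Submodule ℂ X) ≤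
      rankDrop e i := by
  have hbp := hv.isBasePlane_rootPlane he ht
  obtain ⟨c, hc0, hc⟩ := hv.exists_second_point he ht
  have hspan := hv.rootPlane_eq_span he ht hc0 hc
  have hc0' : c ≠ 0 := fun h => hc0 (by rw [h]; rfl)
  have hmeet := hv.meetValue_ne_zero t ht i
  set p := movingPoint hs (vecs v) t with hp
  set w := ∑ l, c l • baseVec hs (vecs v) l with hw
  have hcontra (ρ : X →ₗ[ℂ] ℂ) (hρ : ρ w = 0) :
      formDet ![theta b hs β (vecs v) t 0, theta b hs β (vecs v) t 1, ρ]
        (baseVec hs (vecs v)) = 0 := by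
    refine formDet_eq_zero hc0' fun k => ?_
    fin_cases k
    exacts [hc 0, hc 1, hρ]
  have hpm : p ∈ rootPlane hs β v t := by
    rw [hspan]
    exact Submodule.subset_span (by simp)
  have hwm : w ∈ rootPlane hs β v t := by
    rw [hspan]
    exact Submodule.subset_span (by simp)
  rw [meetValue] at hmeet
  by_cases h1 : (i : ℕ) < e
  · rw [if_pos h1] at hmeet
    rcases he with rfl | rfl
    · refine (Submodule.finrank_mono inf_le_right).trans ?_
      rw [hbp.finrank_eq, rankDrop, if_pos h1]
    · rw [if_neg (by norm_num)] at hmeet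
      have hoff : offset 2 i + b = b + 4 := by rw [offset, if_pos h1]; omega
      rw [hoff, rankDrop, if_pos h1]
      by_contra! hcon
      have hle : rootPlane hs β v t ≤ (flags v i).space (b + 4) := by
        rw [← inf_eq_right]
        refine Submodule.eq_of_le_of_finrank_le inf_le_right ?_
        rw [hbp.finrank_eq]
        omega
      have hform (x : X) (hx : x ∈ rootPlane hs β v t) :
          coordForm β (vecs v) i (b + 4) x = 0 :=
        (mem_flags_iff β v i).1 (hle hx) _ le_rfl (by omega)
      split_ifs at hmeet with h0
      · exact hmeet (hcontra _ (hform w hwm))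
      · exact hmeet (hform p hpm)
  · rw [if_neg h1] at hmeet
    rw [rankDrop, if_neg h1, Nat.le_zero, Submodule.finrank_eq_zero, eq_bot_iff]
    rintro x ⟨hxF, hxh⟩
    rw [hspan] at hxh
    obtain ⟨a, d, rfl⟩ := Submodule.mem_span_pair.1 hxh
    rw [Submodule.mem_bot]
    by_cases had : a ≠ 0 ∨ d ≠ 0
    · have hF : ∀ k, offset e i + b ≤ k → k < 5 + b → coordForm β (vecs v) i k (a • p + d • w) = 0 :=
        (mem_flags_iff β v i).1 hxF
      refine absurd (hcontra _ (pencil_eq_zero had (hF (b + 4) ?_ (by omega)) (hF _ ?_ ?_))) hmeet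
      · have := offset_le_five he i
        rw [offset, if_neg h1]
        split_ifs <;> omega
      · rw [offset, if_neg h1]
        split_ifs <;> omega
      · split_ifs <;> omega
    · push Not at had
      simp [had.1, had.2]

theorem isGenericInstance [FiniteDimensional ℂ X] : IsGenericInstance b hs (flags v) where
  finrank_baseSpace := hv.finrank_baseSpace he
  plateau_le i _ := IsBaseFrame.plateau_le he i
  inf_le_plateau := hv.inf_le_plateau he
  hull_inf_le h hh := by
    obtain ⟨t, ht, rfl⟩ := (hv.isBasePlane_iff he).1 hh
    exact inf_le_inf_right _ (hull_rootPlane_le t)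
  offset_inf_le h hh i := by
    obtain ⟨t, ht, rfl⟩ := (hv.isBasePlane_iff he).1 hh
    exact (inf_le_inf_left _ (hull_rootPlane_le t)).trans (hv.offset_inf_le he ht i)
  finrank_inf_le h hh i := by
    obtain ⟨t, ht, rfl⟩ := (hv.isBasePlane_iff he).1 hh
    exact hv.finrank_inf_rootPlane_le he ht i

end IsGoodFrame

end GoodFrames

/-! ### General position is an open condition -/

section Openness

variable {X : Type*} [AddCommGroup X] [Module ℂ X] {s e b n : ℕ}
  {M : Type*} [AddCommGroup M] [Module ℂ M]

lemma formDet_mem_polyFun {ρ : M → Fin 3 → X →ₗ[ℂ] ℂ} {x : M → Fin 3 → X}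
    (h : ∀ k l, (fun y => ρ y k (x y l)) ∈ polyFun M) :
    (fun y => formDet (ρ y) (x y)) ∈ polyFun M :=
  matrix_det_mem_polyFun h

lemma pencilCoeff_mem_polyFun {P Q : M → Matrix (Fin 3) (Fin 3) ℂ}
    (hP : ∀ k l, (fun y => P y k l) ∈ polyFun M) (hQ : ∀ k l, (fun y => Q y k l) ∈ polyFun M)
    (k : ℕ) : (fun y => pencilCoeff (P y) (Q y) k) ∈ polyFun M := by
  have h1 := matrix_det_mem_polyFun hP
  have h2 := matrix_det_mem_polyFun hQ
  have h3 := matrix_det_mem_polyFun (A := fun y => P y + Q y)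
    fun i j => add_mem_polyFun (hP i j) (hQ i j)
  have h4 := matrix_det_mem_polyFun (A := fun y => P y - Q y)
    fun i j => sub_mem_polyFun (hP i j) (hQ i j)
  have h5 : (fun _ : M => (2 : ℂ)⁻¹) ∈ polyFun M := const_mem_polyFun _
  match k with
  | 0 => exact h1
  | 1 =>
    simp only [pencilCoeff, div_eq_mul_inv]
    exact sub_mem_polyFun (mul_mem_polyFun (sub_mem_polyFun h3 h4) h5) h2
  | 2 =>
    simp only [pencilCoeff, div_eq_mul_inv]
    exact sub_mem_polyFun (mul_mem_polyFun (add_mem_polyFun h3 h4) h5) h1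
  | 3 => exact h2
  | _ + 4 => exact const_mem_polyFun 0

variable {v : M → Fin s → Fin n → X} (hv : ∀ i j, IsPolyMap fun y => v y i j)
  {t : M → ℂ} (ht : t ∈ polyFun M) (hs : e + 3 ≤ s) (β : Fin s → Basis (Fin n) ℂ X)
include hv

lemma isPolyMap_vecAt (i : Fin s) (j : ℕ) : IsPolyMap fun y => vecAt (v y) i j := by
  unfold vecAt
  split_ifs
  · exact hv _ _
  · exact isPolyMap_const _

lemma isPolyMap_baseVec (l : Fin 3) : IsPolyMap fun y => baseVec hs (v y) l := by
  unfold baseVec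
  split_ifs <;> exact isPolyMap_vecAt hv _ _

lemma isPolyMap_lastVec : IsPolyMap fun y => lastVec hs (v y) := by
  unfold lastVec
  split_ifs <;> exact isPolyMap_vecAt hv _ _

lemma isPolyMap_complVec (i j : ℕ) : IsPolyMap fun y => complVec hs (v y) i j := by
  unfold complVec
  split_ifs <;> exact isPolyMap_vecAt hv _ _

lemma isPolyMap_complFrame (i : Fin s) (j : Fin n) :
    IsPolyMap fun y => complFrame b hs (v y) i j := by
  unfold complFrame
  split_ifs
  · exact hv _ _
  · exact isPolyMap_complVec hv hs _ _

lemma isPolyMap_pivot (i : Fin s) (l : Fin 3) : IsPolyMap fun y => pivot b e (v y) i l :=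
  isPolyMap_vecAt hv _ _

lemma coordForm_mem_polyFun (i : Fin s) (k : ℕ) {x : M → X} (hx : IsPolyMap x) :
    (fun y => coordForm β (v y) i k (x y)) ∈ polyFun M := by
  by_cases h : k < n
  · simp only [coordForm_apply _ _ _ h]
    refine IsPolyMap.det (f := fun y => Function.update (v y i) ⟨k, h⟩ (x y)) (β i) fun j => ?_
    by_cases hj : j = ⟨k, h⟩
    · subst hj
      simpa using hx
    · simpa [Function.update_of_ne hj] using hv i j
  · simp only [coordForm, dif_neg h]
    exact const_mem_polyFun 0

lemma pencil_mem_polyFun (i : Fin s) (k l : ℕ) {w x : M → X} (hw : IsPolyMap w)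
    (hx : IsPolyMap x) : (fun y => pencil (coordForm β (v y) i k) (coordForm β (v y) i l)
      (w y) (x y)) ∈ polyFun M := by
  simp only [pencil_apply]
  exact sub_mem_polyFun
    (mul_mem_polyFun (coordForm_mem_polyFun hv β _ _ hw) (coordForm_mem_polyFun hv β _ _ hx))
    (mul_mem_polyFun (coordForm_mem_polyFun hv β _ _ hw) (coordForm_mem_polyFun hv β _ _ hx))

lemma boxForm_mem_polyFun (k : Fin 3) {w x : M → X} (hw : IsPolyMap w) (hx : IsPolyMap x) :
    (fun y => boxForm b hs β (v y) k (w y) (x y)) ∈ polyFun M :=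
  pencil_mem_polyFun hv β _ _ _ hw hx

lemma rootCoeff_mem_polyFun (k : ℕ) : (fun y => rootCoeff b hs β (v y) k) ∈ polyFun M :=
  pencilCoeff_mem_polyFun
    (fun _ _ => boxForm_mem_polyFun hv hs β _ (isPolyMap_vecAt hv _ _) (isPolyMap_baseVec hv hs _))
    (fun _ _ => boxForm_mem_polyFun hv hs β _ (isPolyMap_vecAt hv _ _) (isPolyMap_baseVec hv hs _))
    k

include ht

lemma isPolyMap_movingPoint : IsPolyMap fun y => movingPoint hs (v y) (t y) :=
  (isPolyMap_vecAt hv _ _).add (IsPolyMap.smul ht (isPolyMap_vecAt hv _ _))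

lemma theta_mem_polyFun (k : Fin 3) {x : M → X} (hx : IsPolyMap x) :
    (fun y => theta b hs β (v y) (t y) k (x y)) ∈ polyFun M :=
  boxForm_mem_polyFun hv hs β k (isPolyMap_movingPoint hv ht hs) hx

lemma meetValue_mem_polyFun (i : Fin s) :
    (fun y => meetValue b hs β (v y) (t y) i) ∈ polyFun M := by
  unfold meetValue
  split_ifs
  · exact const_mem_polyFun 1
  · refine formDet_mem_polyFun fun k l => ?_
    fin_cases k
    · exact theta_mem_polyFun hv ht hs β 0 (isPolyMap_baseVec hv hs l)
    · exact theta_mem_polyFun hv ht hs β 1 (isPolyMap_baseVec hv hs l)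
    · exact coordForm_mem_polyFun hv β _ _ (isPolyMap_baseVec hv hs l)
  · exact coordForm_mem_polyFun hv β _ _ (isPolyMap_movingPoint hv ht hs)
  all_goals
    refine formDet_mem_polyFun fun k l => ?_
    fin_cases k
    · exact theta_mem_polyFun hv ht hs β 0 (isPolyMap_baseVec hv hs l)
    · exact theta_mem_polyFun hv ht hs β 1 (isPolyMap_baseVec hv hs l)
    · exact pencil_mem_polyFun hv β _ _ _ (isPolyMap_movingPoint hv ht hs)
        (isPolyMap_baseVec hv hs l)

lemma transverse_mem_polyFun : (fun y => formDet (theta b hs β (v y) (t y))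
    ![baseVec hs (v y) 1, baseVec hs (v y) 2, lastVec hs (v y)]) ∈ polyFun M := by
  refine formDet_mem_polyFun fun k l => theta_mem_polyFun hv ht hs β k ?_
  fin_cases l
  exacts [isPolyMap_baseVec hv hs 1, isPolyMap_baseVec hv hs 2, isPolyMap_lastVec hv hs]

end Openness

section Openness

variable {X : Type*} [AddCommGroup X] [Module ℂ X] {s e n : ℕ} (b : ℕ) (hs : e + 3 ≤ s)
  (β : Fin s → Basis (Fin n) ℂ X)

lemma isPolyMap_apply_apply (i : Fin s) (j : Fin n) :
    IsPolyMap fun y : Fin s → Fin n → X => y i j :=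
  (LinearMap.proj (R := ℂ) j ∘ₗ LinearMap.proj (R := ℂ) (φ := fun _ : Fin s => Fin n → X) i).isPolyMap

lemma isPolyMap_fst_apply_apply (i : Fin s) (j : Fin n) :
    IsPolyMap fun y : (Fin s → Fin n → X) × ℂ => y.1 i j :=
  (isPolyMap_apply_apply i j).comp (LinearMap.fst ℂ (Fin s → Fin n → X) ℂ).isPolyMap

lemma snd_mem_polyFun {M : Type*} [AddCommGroup M] [Module ℂ M] :
    (fun y : M × ℂ => y.2) ∈ polyFun (M × ℂ) :=
  dual_mem_polyFun (LinearMap.snd ℂ M ℂ)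

/-- Elimination of the parameter of the base planes. -/
lemma exists_polyFun_forall_isRoot {P : (Fin s → Fin n → X) × ℂ → ℂ} (hP : P ∈ polyFun _) :
    ∃ R ∈ polyFun (Fin s → Fin n → X), ∀ v, R v ≠ 0 ↔ rootCoeff b hs β v (e + 1) ≠ 0 ∧
      ∀ t, IsRoot b hs β v t → P (v, t) ≠ 0 :=
  exists_elimination (d := e + 1) (c := fun k v => rootCoeff b hs β v k)
    (fun k => rootCoeff_mem_polyFun isPolyMap_apply_apply hs β k) hP

lemma exists_polyFun_isBaseFrame : ∃ q ∈ polyFun (Fin s → Fin n → X),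
    ∀ v, q v ≠ 0 ↔ IsBaseFrame b hs β v := by
  have hv := isPolyMap_fst_apply_apply (X := X) (s := s) (n := n)
  have ht := snd_mem_polyFun (M := Fin s → Fin n → X)
  obtain ⟨R, hR, hR'⟩ := exists_polyFun_forall_isRoot b hs β (P := fun y =>
    (∑ k ∈ Finset.range (e + 2), rootCoeff b hs β y.1 k * (k * y.2 ^ (k - 1))) *
      formDet (theta b hs β y.1 y.2) ![baseVec hs y.1 1, baseVec hs y.1 2, lastVec hs y.1])
    (mul_mem_polyFun (sum_mem_polyFun _ fun k _ => mul_mem_polyFun (rootCoeff_mem_polyFun hv hs β k)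
      (mul_mem_polyFun (const_mem_polyFun _) (pow_mem_polyFun ht _)))
      (transverse_mem_polyFun hv ht hs β))
  refine ⟨fun v => (∏ i ∈ Finset.univ.filter (fun i : Fin s => (i : ℕ) < e + 3), (β i).det (complFrame b hs v i)) * R v,
    mul_mem_polyFun (prod_mem_polyFun _ fun i _ => IsPolyMap.det _ fun j =>
      isPolyMap_complFrame isPolyMap_apply_apply hs i j) hR, fun v => ?_⟩
  simp only [mul_ne_zero_iff, Finset.prod_ne_zero_iff, Finset.mem_filter, Finset.mem_univ,
    true_and, hR']
  constructor
  · rintro ⟨h1, h2, h3⟩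
    exact ⟨h1, h2, fun t h => (h3 t h).1, fun t h => (h3 t h).2⟩
  · rintro ⟨h1, h2, h3, h4⟩
    exact ⟨h1, h2, fun t h => ⟨h3 t h, h4 t h⟩⟩

lemma exists_polyFun_isGoodFrame : ∃ q ∈ polyFun (Fin s → Fin n → X),
    ∀ v, q v ≠ 0 ↔ IsGoodFrame b hs β v := by
  have hv := isPolyMap_fst_apply_apply (X := X) (s := s) (n := n)
  have ht := snd_mem_polyFun (M := Fin s → Fin n → X)
  obtain ⟨q, hq, hq'⟩ := exists_polyFun_isBaseFrame b hs β
  obtain ⟨R, hR, hR'⟩ := exists_polyFun_forall_isRoot b hs β (P := fun y =>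
    (∏ i, formDet (theta b hs β y.1 y.2) (pivot b e y.1 i)) * ∏ i, meetValue b hs β y.1 y.2 i)
    (mul_mem_polyFun (prod_mem_polyFun _ fun i _ => formDet_mem_polyFun fun k l =>
      theta_mem_polyFun hv ht hs β k (isPolyMap_pivot hv i l))
      (prod_mem_polyFun _ fun i _ => meetValue_mem_polyFun hv ht hs β i))
  refine ⟨fun v => q v * R v, mul_mem_polyFun hq hR, fun v => ?_⟩
  simp only [mul_ne_zero_iff, Finset.prod_ne_zero_iff, Finset.mem_univ, true_imp_iff, hR', hq']
  constructor
  · rintro ⟨h1, h2, h3⟩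
    exact ⟨h1, fun t h => (h3 t h).1, fun t h => (h3 t h).2⟩
  · rintro ⟨h1, h3, h4⟩
    exact ⟨h1, h1.lead, fun t h => ⟨h3 t h, h4 t h⟩⟩

/-- The polynomial function whose non-vanishing expresses that a tuple of bases spans a generic
instance. -/
def goodFun : (Fin s → Fin n → X) → ℂ := (exists_polyFun_isGoodFrame b hs β).choose

lemma goodFun_mem_polyFun : goodFun b hs β ∈ polyFun (Fin s → Fin n → X) :=
  (exists_polyFun_isGoodFrame b hs β).choose_spec.1

lemma goodFun_ne_zero_iff {v : Fin s → Fin n → X} :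
    goodFun b hs β v ≠ 0 ↔ IsGoodFrame b hs β v :=
  (exists_polyFun_isGoodFrame b hs β).choose_spec.2 v

end Openness

/-! ### Lifting tuples of bases of `V` -/

section Lift

variable {X : Type*} [AddCommGroup X] [Module ℂ X] {V : Submodule ℂ X} {s b : ℕ}

/-- The position at which a complementary tuple of vectors is inserted into the `i`-th basis. -/
def liftIdx (e i : ℕ) : ℕ := if i < e + 3 then plateau e i else 3

/-- The basis of the ambient space that arises from a basis of `V` and a tuple `z` that spans a
complement of `V`, which is inserted into the basis of `V` and sheared. -/
def liftFrame (e : ℕ) (z : Fin b → X) (x : Fin s → Fin 5 → V) (i : Fin s) (m : Fin (5 + b)) : X :=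
  if (m : ℕ) < liftIdx e i then (vecAt x i m : V)
  else if h : (m : ℕ) - liftIdx e i < b then
    z ⟨m - liftIdx e i, h⟩ + if (m : ℕ) < liftIdx e i + 2 then ((vecAt x i m : V) : X) else 0
  else (vecAt x i (m - b) : V)

lemma liftIdx_le_five {e : ℕ} (he : e = 1 ∨ e = 2) (i : ℕ) : liftIdx e i ≤ 5 := by
  unfold liftIdx
  split_ifs
  · exact plateau_le_five he i
  · norm_num

lemma vecAt_of_le {n : ℕ} {Y : Type*} [AddCommGroup Y] [Module ℂ Y] (x : Fin s → Fin n → Y)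
    (i : Fin s) {m : ℕ} (h : n ≤ m) : vecAt x i m = 0 := dif_neg (by omega)

section LiftFrame

variable {e : ℕ} (z : Fin b → X) (x : Fin s → Fin 5 → V) (i : Fin s)

lemma vecAt_liftFrame_of_lt (he : e = 1 ∨ e = 2) {m : ℕ} (h : m < liftIdx e i) :
    vecAt (liftFrame e z x) i m = (vecAt x i m : V) := by
  have := liftIdx_le_five he i
  rw [vecAt_eq _ _ (show m < 5 + b by omega), liftFrame, if_pos h]

lemma vecAt_liftFrame_middle (he : e = 1 ∨ e = 2) (j : Fin b) :
    vecAt (liftFrame e z x) i (liftIdx e i + j) =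
      z j + if (j : ℕ) < 2 then ((vecAt x i (liftIdx e i + j) : V) : X) else 0 := by
  have := liftIdx_le_five he i
  rw [vecAt_eq _ _ (show liftIdx e i + j < 5 + b by omega), liftFrame,
    if_neg (by simp), dif_pos (by simp)]
  simp

lemma vecAt_liftFrame_of_le (he : e = 1 ∨ e = 2) {m : ℕ} (h : liftIdx e i ≤ m) (h5 : m < 5) :
    vecAt (liftFrame e z x) i (b + m) = (vecAt x i m : V) := by
  have := liftIdx_le_five he i
  rw [vecAt_eq _ _ (show b + m < 5 + b by omega), liftFrame,
    if_neg (by simp only; omega), dif_neg (by simp only; omega)]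
  simp

lemma exists_liftBasis [FiniteDimensional ℂ X] (he : e = 1 ∨ e = 2) (hX : finrank ℂ X = 5 + b)
    {z : Fin b → X} (hz : ⊤ ≤ V ⊔ Submodule.span ℂ (Set.range z))
    (x : Fin s → Basis (Fin 5) ℂ V) :
    ∃ v : Fin s → Basis (Fin (5 + b)) ℂ X, vecs v = liftFrame e z (vecs x) := by
  have key (i : Fin s) : ⊤ ≤ Submodule.span ℂ (Set.range (liftFrame e z (vecs x) i)) := by
    have hκ := liftIdx_le_five he i
    set S := Submodule.span ℂ (Set.range (liftFrame e z (vecs x) i)) with hS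
    have hmem (m : ℕ) (hm : m < 5 + b) : vecAt (liftFrame e z (vecs x)) i m ∈ S := by
      rw [vecAt_eq _ _ hm]
      exact Submodule.subset_span ⟨_, rfl⟩
    have hx (m : Fin 5) : (x i m : X) ∈ S := by
      have h0 : ((vecAt (vecs x) i m : V) : X) = x i m := by rw [vecAt_eq _ _ m.2]
      rw [← h0]
      by_cases h : (m : ℕ) < liftIdx e i
      · rw [← vecAt_liftFrame_of_lt z _ i he h]
        exact hmem _ (by omega)
      · rw [← vecAt_liftFrame_of_le z _ i he (not_lt.1 h) m.2]
        exact hmem _ (by omega)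
    have hV : V ≤ S := by
      intro y hy
      have h1 := (x i).sum_repr ⟨y, hy⟩
      have h2 : ((∑ m, (x i).repr ⟨y, hy⟩ m • x i m : V) : X) = y := congrArg Subtype.val h1
      rw [← h2]
      simp only [AddSubmonoidClass.coe_finsetSum, Submodule.coe_smul]
      exact Submodule.sum_mem _ fun m _ => Submodule.smul_mem _ _ (hx m)
    refine hz.trans (sup_le hV ?_)
    rw [Submodule.span_le]
    rintro _ ⟨j, rfl⟩
    have h1 := hmem (liftIdx e i + j) (by omega)
    rw [vecAt_liftFrame_middle z _ i he j] at h1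
    refine (Submodule.add_mem_iff_left _ ?_).1 h1
    split_ifs
    · exact hV (SetLike.coe_mem _)
    · exact zero_mem _
  refine ⟨fun i => basisOfTopLeSpanOfCardEqFinrank _ (key i) (by simp [hX]), ?_⟩
  funext i
  exact coe_basisOfTopLeSpanOfCardEqFinrank _ _ _

end LiftFrame

/-! ### Lifted bases in general position -/

section LiftGood

variable {e : ℕ} {hs : e + 3 ≤ s} {z : Fin b → X} {x : Fin s → Basis (Fin 5) ℂ V}
  {v : Fin s → Basis (Fin (5 + b)) ℂ X}

lemma coordForm_self {n : ℕ} {Y : Type*} [AddCommGroup Y] [Module ℂ Y]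
    (y : Fin s → Basis (Fin n) ℂ Y) (i : Fin s) {k : ℕ} (h : k < n) (p : Y) :
    coordForm y (vecs y) i k p = (y i).coord ⟨k, h⟩ p := by
  rw [coordForm_eq y y i h, Basis.det_self, one_mul]

variable (he : e = 1 ∨ e = 2) (hvx : vecs v = liftFrame e z (vecs x))
include he hvx

lemma coordForm_lift (i : Fin s) {k : ℕ} (h1 : liftIdx e i ≤ k) (h5 : k < 5) (y : V) :
    coordForm v (vecs v) i (b + k) y = coordForm x (vecs x) i k y := by
  rw [coordForm_self _ _ (show b + k < 5 + b by omega), coordForm_self _ _ h5]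
  have : (v i).coord ⟨b + k, by omega⟩ ∘ₗ V.subtype = (x i).coord ⟨k, h5⟩ := by
    refine (x i).ext fun m => ?_
    rw [LinearMap.comp_apply, Submodule.subtype_apply, Basis.coord_apply, Basis.coord_apply,
      Basis.repr_self, Finsupp.single_apply]
    have h0 : ((vecAt (vecs x) i m : V) : X) = x i m := by rw [vecAt_eq _ _ m.2]
    rw [← h0]
    by_cases h : (m : ℕ) < liftIdx e i
    · have h2 := vecAt_liftFrame_of_lt z (vecs x) i he h
      rw [← hvx] at h2
      rw [← h2, ← Basis.coord_apply, coord_vecAt v i (by omega), if_neg (by simp only; omega), if_neg]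
      rintro rfl
      simp only at h
      omega
    · have h2 := vecAt_liftFrame_of_le z (vecs x) i he (not_lt.1 h) m.2
      rw [← hvx] at h2
      rw [← h2, ← Basis.coord_apply, coord_vecAt v i (by omega)]
      congr 1
      simp only [Fin.ext_iff, eq_iff_iff]
      omega
  rw [← this]
  rfl

lemma coordForm_lift_compl (i : Fin s) {k : ℕ} (h1 : liftIdx e i + 2 ≤ k) (h5 : k < 5)
    (j : Fin b) : coordForm v (vecs v) i (b + k) (z j) = 0 := by
  have h2 := vecAt_liftFrame_middle z (vecs x) i he j
  rw [← hvx] at h2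
  rw [eq_sub_of_add_eq h2.symm, map_sub,
    coordForm_self _ _ (show b + k < 5 + b by omega), coord_vecAt v i (by omega),
    if_neg (by simp only; omega), zero_sub, neg_eq_zero]
  split_ifs with h3
  · rw [coordForm_lift he hvx i (by omega) h5]
    by_cases h4 : liftIdx e i + j < 5
    · rw [coordForm_self _ _ h5, coord_vecAt x i h4, if_neg (by simp only; omega)]
    · rw [vecAt_of_le _ _ (by omega), map_zero]
  · rw [map_zero]

omit he hvx in
lemma liftIdx_boxIdx (k : Fin 3) : liftIdx e (boxIdx hs k) = 0 := by
  simp [liftIdx, boxIdx, plateau]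

lemma movingPoint_lift (t : ℂ) :
    movingPoint hs (vecs v) t = (movingPoint hs (vecs x) t : V) := by
  have h : 2 ≤ liftIdx e (idxZero hs) := by
    rcases he with rfl | rfl <;> simp [liftIdx, idxZero, plateau]
  rw [movingPoint, hvx, vecAt_liftFrame_of_lt z _ _ he (by omega),
    vecAt_liftFrame_of_lt z _ _ he (by omega)]
  rfl

lemma vecAt_idxZero_lift {m : ℕ} (hm : m < if e = 1 then 5 else 2) :
    vecAt (vecs v) (idxZero hs) m = (vecAt (vecs x) (idxZero hs) m : V) := by
  rw [hvx, vecAt_liftFrame_of_lt z _ _ he]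
  rcases he with rfl | rfl <;> simpa [liftIdx, idxZero, plateau] using hm

lemma vecAt_idxOne_lift (h2 : e = 2) {m : ℕ} (hm : m < 3) :
    vecAt (vecs v) (idxOne hs) m = (vecAt (vecs x) (idxOne hs) m : V) := by
  rw [hvx, vecAt_liftFrame_of_lt z _ _ he]
  subst h2
  simpa [liftIdx, idxOne, plateau] using hm

lemma baseVec_lift (l : Fin 3) : baseVec hs (vecs v) l = (baseVec hs (vecs x) l : V) := by
  unfold baseVec
  split_ifs with h
  · exact vecAt_idxZero_lift he hvx (by rw [if_pos h]; omega)
  · exact vecAt_idxOne_lift he hvx (by omega) (by omega)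

lemma lastVec_lift : lastVec hs (vecs v) = (lastVec hs (vecs x) : V) := by
  unfold lastVec
  split_ifs with h
  · exact vecAt_idxZero_lift he hvx (by rw [if_pos h]; omega)
  · exact vecAt_idxZero_lift he hvx (by rw [if_neg h]; omega)

lemma complVec_lift (i j : ℕ) (hj : j < 5 - plateau e i) :
    complVec hs (vecs v) i j = (complVec hs (vecs x) i j : V) := by
  unfold complVec
  split_ifs with h h0 h1 h2
  · exact vecAt_idxZero_lift he hvx (by rw [if_pos h]; omega)
  · refine vecAt_idxOne_lift he hvx (by omega) ?_
    have : e = 2 := by omega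
    subst this
    simpa [plateau, h0] using hj
  · refine vecAt_idxZero_lift he hvx ?_
    have : e = 2 := by omega
    subst this
    simpa [plateau, h1] using hj
  · exact vecAt_idxZero_lift he hvx (by rw [if_neg h]; omega)
  · exact vecAt_idxOne_lift he hvx (by omega) (by omega)

lemma boxForm_lift (k : Fin 3) (p y : V) :
    boxForm b hs v (vecs v) k p y = boxForm 0 hs x (vecs x) k p y := by
  have h := liftIdx_boxIdx (e := e) (hs := hs) k
  simp only [boxForm, pencil_apply]
  rw [coordForm_lift he hvx _ (by omega) (by norm_num),
    coordForm_lift he hvx _ (by omega) (by norm_num),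
    coordForm_lift he hvx _ (by omega) (by norm_num),
    coordForm_lift he hvx _ (by omega) (by norm_num)]

lemma theta_lift (t : ℂ) (k : Fin 3) (y : V) :
    theta b hs v (vecs v) t k y = theta 0 hs x (vecs x) t k y := by
  rw [theta, movingPoint_lift he hvx, boxForm_lift he hvx]
  rfl

lemma theta_lift_compl (t : ℂ) (k : Fin 3) (j : Fin b) : theta b hs v (vecs v) t k (z j) = 0 := by
  have h := liftIdx_boxIdx (e := e) (hs := hs) k
  rw [theta, boxForm, pencil_apply, coordForm_lift_compl he hvx _ (by omega) (by norm_num),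
    coordForm_lift_compl he hvx _ (by omega) (by norm_num)]
  ring

lemma rootCoeff_lift : rootCoeff b hs v (vecs v) = rootCoeff 0 hs x (vecs x) := by
  have h0 : vecAt (vecs v) (idxZero hs) 0 = (vecAt (vecs x) (idxZero hs) 0 : V) :=
    vecAt_idxZero_lift he hvx (by split_ifs <;> norm_num)
  have h1 : vecAt (vecs v) (idxZero hs) 1 = (vecAt (vecs x) (idxZero hs) 1 : V) :=
    vecAt_idxZero_lift he hvx (by split_ifs <;> norm_num)
  unfold rootCoeff
  simp only [h0, h1, baseVec_lift he hvx, boxForm_lift he hvx]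

lemma isRoot_lift (t : ℂ) : IsRoot b hs v (vecs v) t ↔ IsRoot 0 hs x (vecs x) t := by
  rw [IsRoot, IsRoot, rootCoeff_lift he hvx]

lemma complFrame_lift_det_ne_zero [FiniteDimensional ℂ X]
    (hz : ⊤ ≤ V ⊔ Submodule.span ℂ (Set.range z)) (i : Fin s) (hi : (i : ℕ) < e + 3)
    (h : (x i).det (complFrame 0 hs (vecs x) i) ≠ 0) :
    (v i).det (complFrame b hs (vecs v) i) ≠ 0 := by
  have hκ := plateau_le_five he i
  have hX : finrank ℂ X = 5 + b := by
    rw [finrank_eq_card_basis (v i), Fintype.card_fin]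
  have hl : liftIdx e i = plateau e i := if_pos hi
  set S := Submodule.span ℂ (Set.range (complFrame b hs (vecs v) i)) with hS
  have hmem (m : Fin 5) : ((complFrame 0 hs (vecs x) i m : V) : X) ∈ S := by
    rw [complFrame, zero_add]
    split_ifs with hm
    · refine Submodule.subset_span ⟨⟨m, by omega⟩, ?_⟩
      rw [complFrame, if_pos (by simp only; omega)]
      have := vecAt_liftFrame_of_lt z (vecs x) i he (by omega : (m : ℕ) < liftIdx e i)
      rw [← hvx, vecAt_eq _ _ (show (m : ℕ) < 5 + b by omega), vecAt_eq _ _ m.2] at this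
      exact this
    · refine Submodule.subset_span ⟨⟨b + m, by omega⟩, ?_⟩
      rw [complFrame, if_neg (by simp only; omega), complVec_lift he hvx _ _ (by simp only; omega)]
      rw [show ((⟨b + m, by omega⟩ : Fin (5 + b)) : ℕ) - (b + plateau e i) = m - plateau e i by
        simp only; omega]
  have hx0 := (((x i).is_basis_iff_det).2 (isUnit_iff_ne_zero.2 h)).2
  have hV : V ≤ S := by
    intro y hy
    have h1 : (⟨y, hy⟩ : V) ∈ Submodule.span ℂ (Set.range (complFrame 0 hs (vecs x) i)) := by
      rw [hx0]; trivial
    have h2 : Submodule.span ℂ (Set.range (complFrame 0 hs (vecs x) i)) ≤ S.comap V.subtype := by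
      rw [Submodule.span_le]
      rintro _ ⟨m, rfl⟩
      exact hmem m
    exact h2 h1
  have htop : ⊤ ≤ S := by
    refine hz.trans (sup_le hV ?_)
    rw [Submodule.span_le]
    rintro _ ⟨j, rfl⟩
    have h2 := vecAt_liftFrame_middle z (vecs x) i he j
    rw [← hvx, vecAt_eq _ _ (by omega)] at h2
    rw [eq_sub_of_add_eq h2.symm]
    refine sub_mem (Submodule.subset_span ⟨⟨liftIdx e i + j, by omega⟩, ?_⟩) ?_
    · rw [complFrame, if_pos (by simp only; omega)]
    · split_ifs
      · exact hV (SetLike.coe_mem _)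
      · exact zero_mem _
  have hb : LinearIndependent ℂ (complFrame b hs (vecs v) i) :=
    linearIndependent_of_top_le_span_of_card_eq_finrank htop (by simp [hX])
  exact isUnit_iff_ne_zero.1 (((v i).is_basis_iff_det).1 ⟨hb, top_le_iff.1 htop⟩)

lemma IsBaseFrame.lift [FiniteDimensional ℂ X] (hz : ⊤ ≤ V ⊔ Submodule.span ℂ (Set.range z))
    (hx : IsBaseFrame 0 hs x (vecs x)) : IsBaseFrame b hs v (vecs v) where
  compl i hi := complFrame_lift_det_ne_zero he hvx hz i hi (hx.compl i hi)
  lead := by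
    rw [rootCoeff_lift he hvx]
    exact hx.lead
  simple := by
    rw [rootCoeff_lift he hvx]
    exact hx.simple
  transverse t ht := by
    have h := hx.transverse t ((isRoot_lift he hvx t).1 ht)
    rw [baseVec_lift he hvx, baseVec_lift he hvx, lastVec_lift he hvx]
    convert h using 2
    simp only [formDet]
    congr 2
    ext k l
    fin_cases l <;> exact theta_lift he hvx _ _ _

lemma theta_pivot_lift (hb : 2 ≤ b) (t : ℂ) (k : Fin 3) (i : Fin s) (l : Fin 3) :
    theta b hs v (vecs v) t k (pivot b e (vecs v) i l) =
      theta 0 hs x (vecs x) t k (pivot 0 e (vecs x) i l) := by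
  have key {m : ℕ} (hm : m < liftIdx e i + 2) : theta b hs v (vecs v) t k (vecAt (vecs v) i m) =
      theta 0 hs x (vecs x) t k (vecAt (vecs x) i m) := by
    by_cases h : m < liftIdx e i
    · rw [hvx, vecAt_liftFrame_of_lt z (vecs x) i he h, ← hvx, theta_lift he hvx]
    · obtain ⟨j, rfl⟩ := Nat.exists_eq_add_of_le (not_lt.1 h)
      have h2 := vecAt_liftFrame_middle z (vecs x) i he ⟨j, by omega⟩
      rw [← hvx] at h2
      simp only at h2
      rw [h2, if_pos (by omega), map_add, theta_lift_compl he hvx, zero_add, theta_lift he hvx]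
  have key' {m : ℕ} (hm : liftIdx e i ≤ m) (h5 : m < 5) :
      theta b hs v (vecs v) t k (vecAt (vecs v) i (b + m)) =
      theta 0 hs x (vecs x) t k (vecAt (vecs x) i m) := by
    rw [hvx, vecAt_liftFrame_of_le z (vecs x) i he hm h5, ← hvx, theta_lift he hvx]
  unfold pivot pivotIdx
  by_cases h1 : (i : ℕ) < e
  · simp only [if_pos h1]
    have hl : liftIdx e i = if e = 1 then 5 else 2 + (i : ℕ) := by
      rw [liftIdx, if_pos (by omega), plateau, if_pos h1]
    split_ifs at hl ⊢ <;> fin_cases l <;> exact key (by simp <;> omega)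
  · simp only [if_neg h1]
    by_cases h2 : (i : ℕ) < e + 3
    · simp only [if_pos h2]
      have hl : liftIdx e i = 0 := by rw [liftIdx, if_pos h2, plateau, if_neg h1]
      fin_cases l
      · exact key (by simp)
      · exact key (by simp)
      · exact key' (by omega) (by norm_num)
    · simp only [if_neg h2]
      have hl : liftIdx e i = 3 := by rw [liftIdx, if_neg h2]
      fin_cases l <;> exact key (by rw [hl]; simp)

lemma meetValue_lift (t : ℂ) (i : Fin s) :
    meetValue b hs v (vecs v) t i = meetValue 0 hs x (vecs x) t i := by
  have hform {k : ℕ} (h1 : liftIdx e i ≤ k) (h5 : k < 5) (y : V) :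
    coordForm v (vecs v) i (b + k) y = coordForm x (vecs x) i (0 + k) y := by
      rw [zero_add]; exact coordForm_lift he hvx i h1 h5 y
  have h4 : liftIdx e i ≤ 4 ∨ e = 1 ∧ (i : ℕ) < e := by
    unfold liftIdx plateau
    split_ifs <;> omega
  have hdet (ρ : X →ₗ[ℂ] ℂ) (ρ' : V →ₗ[ℂ] ℂ) (h : ∀ y : V, ρ y = ρ' y) :
      formDet ![theta b hs v (vecs v) t 0, theta b hs v (vecs v) t 1, ρ] (baseVec hs (vecs v)) =
      formDet ![theta 0 hs x (vecs x) t 0, theta 0 hs x (vecs x) t 1, ρ']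
        (baseVec hs (vecs x)) := by
    simp only [formDet]
    congr 1
    ext k l
    rw [Matrix.of_apply, Matrix.of_apply, baseVec_lift he hvx]
    fin_cases k
    exacts [theta_lift he hvx _ _ _, theta_lift he hvx _ _ _, h _]
  unfold meetValue
  by_cases h1 : (i : ℕ) < e
  · rw [if_pos h1, if_pos h1]
    split_ifs with h2 h3
    · rfl
    · exact hdet _ _ fun y => hform (by omega) (by norm_num) y
    · rw [movingPoint_lift he hvx]
      exact hform (by omega) (by norm_num) _
  · rw [if_neg h1, if_neg h1]
    refine hdet _ _ fun y => ?_
    rw [movingPoint_lift he hvx, pencil_apply, pencil_apply]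
    split_ifs with h2
    · have hl : liftIdx e i = 0 := by rw [liftIdx, if_pos h2, plateau, if_neg h1]
      rw [hform (by omega) (by norm_num), hform (by omega) (by norm_num),
        hform (by omega) (by norm_num), hform (by omega) (by norm_num)]
    · have hl : liftIdx e i = 3 := by rw [liftIdx, if_neg h2]
      rw [hform (by omega) (by norm_num), hform (by omega) (by norm_num),
        hform (by omega) (by norm_num), hform (by omega) (by norm_num)]

theorem IsGoodFrame.lift [FiniteDimensional ℂ X] (hb : 2 ≤ b)
    (hz : ⊤ ≤ V ⊔ Submodule.span ℂ (Set.range z))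
    (hx : IsGoodFrame 0 hs x (vecs x)) : IsGoodFrame b hs v (vecs v) where
  toIsBaseFrame := hx.toIsBaseFrame.lift he hvx hz
  pivot_ne_zero t ht i := by
    have h := hx.pivot_ne_zero t ((isRoot_lift he hvx t).1 ht) i
    convert h using 2
    simp only [formDet]
    congr 2
    ext k l
    exact theta_pivot_lift he hvx hb t k i l
  meetValue_ne_zero t ht i := by
    rw [meetValue_lift he hvx]
    exact hx.meetValue_ne_zero t ((isRoot_lift he hvx t).1 ht) i

end LiftGood

end Lift

/-! ### An explicit tuple of flags in a five-dimensional space -/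

section Explicit

/-- The coordinates, with respect to a fixed basis, of the forms dual to the basis adapted to the
`i`-th flag of the explicit instance. -/
def explicitForms (e i : ℕ) : Matrix (Fin 5) (Fin 5) ℤ :=
  if e = 1 then
    if i = 0 then !![1, 0, 0, 0, 0; 0, 1, 0, 0, 0; 0, 0, 1, 0, 0; 0, 0, 0, 1, 0; 0, 0, 0, 0, 1]
    else if i = 1 then !![0, 0, 0, 0, -1; 0, 0, 0, 1, 0; 0, 0, 1, 0, 0; -1, 0, -1, 0, 1; 0, 1, 0, 0, 0]
    else if i = 2 then !![0, 0, 1, 0, 0; 0, 0, 0, 0, 1; 0, -1, 0, 0, 0; 1, 0, 0, 0, -1; 0, 1, 1, -1, 0]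
    else if i = 3 then !![0, 1, 0, 0, 0; 0, 0, 0, 0, 1; 0, 0, 1, 0, 0; 1, -1, 1, 0, 0; 0, -1, 0, -1, -1]
    else !![0, 0, 0, 0, 1; 0, 0, 0, 1, 0; 0, 0, 1, 0, 0; 1, 0, 0, 0, 0; 0, 1, 0, 0, 0]
  else
    if i = 0 then !![1, 0, 0, 0, 0; 0, 1, 0, 0, 0; 0, 0, 0, 0, 1; 0, 0, 0, 1, 0; 0, 0, 1, 0, 0]
    else if i = 1 then !![0, 0, 1, 0, 0; 0, 0, 0, 1, 0; 0, 0, 0, 0, 1; 1, 0, 0, 0, 0; 1, 1, 0, 0, 0]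
    else if i = 2 then !![0, 0, 0, -1, 0; 0, 0, -1, 0, 0; 1, 0, 0, 0, 0; 1, 0, 0, 1, -1; 1, 1, 1, 0, 0]
    else if i = 3 then !![0, 1, 0, 0, 0; -1, 0, 0, 0, 0; 0, 0, 0, 0, -1; -1, 1, 0, 1, 1; -1, 0, -1, 0, 0]
    else if i = 4 then !![0, -1, 0, 0, 0; 0, 0, 1, 0, 0; 1, 0, 0, 0, 0; 0, 1, 0, -1, 0; -1, 0, 0, 0, -1]
    else !![0, 1, 0, 0, 0; 0, 0, 1, 0, 0; 0, 0, 0, 1, 0; 1, 0, 0, 0, 0; 0, 0, 0, 0, 1]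

/-- The columns are the vectors of the basis adapted to the `i`-th flag of the explicit instance. -/
def explicitVecs (e i : ℕ) : Matrix (Fin 5) (Fin 5) ℤ :=
  if e = 1 then
    if i = 0 then !![1, 0, 0, 0, 0; 0, 1, 0, 0, 0; 0, 0, 1, 0, 0; 0, 0, 0, 1, 0; 0, 0, 0, 0, 1]
    else if i = 1 then !![-1, 0, -1, -1, 0; 0, 0, 0, 0, 1; 0, 0, 1, 0, 0; 0, 1, 0, 0, 0; -1, 0, 0, 0, 0]
    else if i = 2 then !![0, 1, 0, 1, 0; 0, 0, -1, 0, 0; 1, 0, 0, 0, 0; 1, 0, -1, 0, -1; 0, 1, 0, 0, 0]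
    else if i = 3 then !![1, 0, -1, 1, 0; 1, 0, 0, 0, 0; 0, 0, 1, 0, 0; -1, -1, 0, 0, -1; 0, 1, 0, 0, 0]
    else !![0, 0, 0, 1, 0; 0, 0, 0, 0, 1; 0, 0, 1, 0, 0; 0, 1, 0, 0, 0; 1, 0, 0, 0, 0]
  else
    if i = 0 then !![1, 0, 0, 0, 0; 0, 1, 0, 0, 0; 0, 0, 0, 0, 1; 0, 0, 0, 1, 0; 0, 0, 1, 0, 0]
    else if i = 1 then !![0, 0, 0, 1, 0; 0, 0, 0, -1, 1; 1, 0, 0, 0, 0; 0, 1, 0, 0, 0; 0, 0, 1, 0, 0]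
    else if i = 2 then !![0, 0, 1, 0, 0; 0, 1, -1, 0, 1; 0, -1, 0, 0, 0; -1, 0, 0, 0, 0; -1, 0, 1, -1, 0]
    else if i = 3 then !![0, -1, 0, 0, 0; 1, 0, 0, 0, 0; 0, 1, 0, 0, -1; -1, -1, 1, 1, 0; 0, 0, -1, 0, 0]
    else if i = 4 then !![0, 0, 1, 0, 0; -1, 0, 0, 0, 0; 0, 1, 0, 0, 0; -1, 0, 0, -1, 0; 0, 0, -1, 0, -1]
    else !![0, 0, 0, 1, 0; 1, 0, 0, 0, 0; 0, 1, 0, 0, 0; 0, 0, 1, 0, 0; 0, 0, 0, 0, 1]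

lemma explicitForms_mul_explicitVecs (e i : ℕ) : explicitForms e i * explicitVecs e i = 1 := by
  unfold explicitForms explicitVecs
  split_ifs <;> decide

/-- The value of the `k`-th form of the `i`-th flag. -/
def formZ (e i : ℕ) (k : Fin 5) (c : Fin 5 → ℤ) : ℤ :=
  explicitForms e i k 0 * c 0 + explicitForms e i k 1 * c 1 + explicitForms e i k 2 * c 2 +
    explicitForms e i k 3 * c 3 + explicitForms e i k 4 * c 4

/-- The `j`-th vector of the `i`-th flag. -/
def vecZ (e i j : ℕ) (l : Fin 5) : ℤ := explicitVecs e i l (Fin.ofNat 5 j)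

/-- The value of a pencil of forms. -/
def pencilZ (e i : ℕ) (k k' : Fin 5) (p c : Fin 5 → ℤ) : ℤ :=
  formZ e i k p * formZ e i k' c - formZ e i k' p * formZ e i k c

/-- The coordinates of `movingPoint`. -/
def pointZ (e : ℕ) (t : ℤ) (l : Fin 5) : ℤ := vecZ e 0 0 l + t * vecZ e 0 1 l

/-- The coordinates of `baseVec`. -/
def baseZ (e : ℕ) (l : Fin 3) : Fin 5 → ℤ := if e = 1 then vecZ e 0 (l + 1) else vecZ e 1 l

/-- The coordinates of `lastVec`. -/
def lastZ (e : ℕ) : Fin 5 → ℤ := if e = 1 then vecZ e 0 4 else vecZ e 0 1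

/-- The determinant of a matrix of integers. -/
def detZ (A : Fin 3 → Fin 3 → ℤ) : ℤ :=
  A 0 0 * A 1 1 * A 2 2 - A 0 0 * A 1 2 * A 2 1 - A 0 1 * A 1 0 * A 2 2 + A 0 1 * A 1 2 * A 2 0 +
    A 0 2 * A 1 0 * A 2 1 - A 0 2 * A 1 1 * A 2 0

/-- The value of `theta`. -/
def thetaZ (e : ℕ) (t : ℤ) (k : Fin 3) (c : Fin 5 → ℤ) : ℤ :=
  pencilZ e (e + k) 4 3 (pointZ e t) c

/-- The value of `meetValue`. -/
def meetZ (e : ℕ) (t : ℤ) (i : ℕ) : ℤ :=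
  if i < e then
    if e = 1 then 1
    else if i = 0 then
      detZ fun k l => ![thetaZ e t 0 (baseZ e l), thetaZ e t 1 (baseZ e l), formZ e i 4 (baseZ e l)] k
    else formZ e i 4 (pointZ e t)
  else detZ fun k l => ![thetaZ e t 0 (baseZ e l), thetaZ e t 1 (baseZ e l),
    pencilZ e i 4 (if i < e + 3 then 2 else 3) (pointZ e t) (baseZ e l)] k

variable {Y : Type*} [AddCommGroup Y] [Module ℂ Y] (w : Basis (Fin 5) ℂ Y) {s e : ℕ}

/-- The vector with the given integral coordinates. -/
def intVec (c : Fin 5 → ℤ) : Y := ∑ l, (c l : ℂ) • w l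

/-- The `i`-th basis of the explicit instance. -/
def explicitBasis (e i : ℕ) : Basis (Fin 5) ℂ Y :=
  Basis.ofEquivFun (w.equivFun.trans (Matrix.toLin'OfInv
    (M := (explicitVecs e i).map (Int.castRingHom ℂ))
    (M' := (explicitForms e i).map (Int.castRingHom ℂ))
    (by rw [← Matrix.map_mul, mul_eq_one_comm.1 (explicitForms_mul_explicitVecs e i)]; simp)
    (by rw [← Matrix.map_mul, explicitForms_mul_explicitVecs]; simp)))

lemma equivFun_intVec (c : Fin 5 → ℤ) : w.equivFun (intVec w c) = fun l => (c l : ℂ) := by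
  rw [intVec, ← w.equivFun_symm_apply, LinearEquiv.apply_symm_apply]

lemma coord_explicitBasis (e i : ℕ) (k : Fin 5) (c : Fin 5 → ℤ) :
    (explicitBasis w e i).coord k (intVec w c) = formZ e i k c := by
  rw [Basis.coord_apply, explicitBasis, Basis.ofEquivFun_repr_apply, LinearEquiv.trans_apply,
    equivFun_intVec, Matrix.toLin'OfInv_apply, Matrix.toLin'_apply]
  simp [Matrix.mulVec, dotProduct, Fin.sum_univ_five, formZ]

lemma explicitBasis_apply (e i : ℕ) (j : Fin 5) : explicitBasis w e i j = intVec w (vecZ e i j) := by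
  refine (Basis.ext_elem (explicitBasis w e i) fun k => ?_).symm
  rw [← Basis.coord_apply, coord_explicitBasis, Basis.repr_self, Finsupp.single_apply]
  have h := congrFun (congrFun (explicitForms_mul_explicitVecs e i) k) j
  rw [Matrix.mul_apply, Fin.sum_univ_five, Matrix.one_apply] at h
  have h2 : formZ e i k (vecZ e i j) = if k = j then 1 else 0 := by
    rw [← h]
    simp [formZ, vecZ, Fin.ofNat_eq_cast]
  rw [h2]
  simp [eq_comm]

/-- The bases of the explicit instance. -/
def explicitBases (s e : ℕ) (i : Fin s) : Basis (Fin 5) ℂ Y := explicitBasis w e i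

lemma vecAt_explicitBases (i : Fin s) {j : ℕ} (h : j < 5) :
    vecAt (vecs (explicitBases w s e)) i j = intVec w (vecZ e i j) := by
  rw [vecAt_eq _ _ h]
  exact explicitBasis_apply w e i ⟨j, h⟩

lemma coordForm_explicitBases (i : Fin s) (k : Fin 5) (c : Fin 5 → ℤ) :
    coordForm (explicitBases w s e) (vecs (explicitBases w s e)) i (0 + k) (intVec w c) =
      formZ e i k c := by
  rw [coordForm_self _ _ (by omega)]
  simp only [zero_add]
  exact coord_explicitBasis w e i k c

lemma movingPoint_explicitBases (hs : e + 3 ≤ s) (t : ℤ) :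
    movingPoint hs (vecs (explicitBases w s e)) t = intVec w (pointZ e t) := by
  rw [movingPoint, vecAt_explicitBases w _ (by norm_num), vecAt_explicitBases w _ (by norm_num)]
  simp only [intVec, pointZ, Int.cast_add, Int.cast_mul, add_smul, Finset.sum_add_distrib,
    Finset.smul_sum, mul_smul]
  rfl

lemma baseVec_explicitBases (hs : e + 3 ≤ s) (l : Fin 3) :
    baseVec hs (vecs (explicitBases w s e)) l = intVec w (baseZ e l) := by
  unfold baseVec baseZ
  split_ifs <;> exact vecAt_explicitBases w _ (by omega)

lemma lastVec_explicitBases (hs : e + 3 ≤ s) :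
    lastVec hs (vecs (explicitBases w s e)) = intVec w (lastZ e) := by
  unfold lastVec lastZ
  split_ifs <;> exact vecAt_explicitBases w _ (by omega)

lemma boxForm_explicitBases (hs : e + 3 ≤ s) (k : Fin 3) (p c : Fin 5 → ℤ) :
    boxForm 0 hs (explicitBases w s e) (vecs (explicitBases w s e)) k (intVec w p) (intVec w c) =
      pencilZ e (e + k) 4 3 p c := by
  have h4 (c : Fin 5 → ℤ) := coordForm_explicitBases w (e := e) (boxIdx hs k) 4 c
  have h3 (c : Fin 5 → ℤ) := coordForm_explicitBases w (e := e) (boxIdx hs k) 3 c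
  rw [boxForm, pencil_apply, pencilZ, Int.cast_sub, Int.cast_mul, Int.cast_mul]
  exact congrArg₂ _ (congrArg₂ _ (h4 p) (h3 c)) (congrArg₂ _ (h3 p) (h4 c))

lemma theta_explicitBases (hs : e + 3 ≤ s) (t : ℤ) (k : Fin 3) (c : Fin 5 → ℤ) :
    theta 0 hs (explicitBases w s e) (vecs (explicitBases w s e)) t k (intVec w c) =
      thetaZ e t k c := by
  rw [theta, movingPoint_explicitBases]
  exact boxForm_explicitBases w hs k _ c

lemma formDet_eq_detZ {ρ : Fin 3 → Y →ₗ[ℂ] ℂ} {x : Fin 3 → Y} {A : Fin 3 → Fin 3 → ℤ}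
    (h : ∀ k l, ρ k (x l) = A k l) : formDet ρ x = detZ A := by
  rw [formDet, Matrix.det_fin_three]
  simp [h, detZ]

lemma meetValue_explicitBases (hs : e + 3 ≤ s) (t : ℤ) (i : Fin s) :
    meetValue 0 hs (explicitBases w s e) (vecs (explicitBases w s e)) t i = meetZ e t i := by
  have hf (k : Fin 5) (c : Fin 5 → ℤ) := coordForm_explicitBases w (e := e) i k c
  have hp (k : Fin 5) (p c : Fin 5 → ℤ) : pencil
      (coordForm (explicitBases w s e) (vecs (explicitBases w s e)) i (0 + (4 : Fin 5)))
      (coordForm (explicitBases w s e) (vecs (explicitBases w s e)) i (0 + k))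
      (intVec w p) (intVec w c) = pencilZ e i 4 k p c := by
    rw [pencil_apply, hf, hf, hf, hf, pencilZ]
    push_cast
    rfl
  unfold meetValue meetZ
  split_ifs with h1 h2 h3 h4
  · simp
  · refine formDet_eq_detZ fun k l => ?_
    rw [baseVec_explicitBases]
    fin_cases k
    exacts [theta_explicitBases w hs t 0 _, theta_explicitBases w hs t 1 _, hf 4 _]
  · rw [movingPoint_explicitBases]
    exact hf 4 _
  all_goals
    refine formDet_eq_detZ fun k l => ?_
    rw [baseVec_explicitBases, movingPoint_explicitBases]
    fin_cases k
    · exact theta_explicitBases w hs t 0 _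
    · exact theta_explicitBases w hs t 1 _
    · first
      | simpa using hp 2 (pointZ e t) (baseZ e l)
      | simpa using hp 3 (pointZ e t) (baseZ e l)

lemma pivotIdx_lt_five (e i : ℕ) (l : Fin 3) : pivotIdx 0 e i l < 5 := by
  unfold pivotIdx
  split_ifs <;> fin_cases l <;> norm_num

lemma formDet_pivot_explicitBases (hs : e + 3 ≤ s) (t : ℤ) (i : Fin s) :
    formDet (theta 0 hs (explicitBases w s e) (vecs (explicitBases w s e)) t)
      (pivot 0 e (vecs (explicitBases w s e)) i) =
    detZ fun k l => thetaZ e t k (vecZ e i (pivotIdx 0 e i l)) := by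
  refine formDet_eq_detZ fun k l => ?_
  rw [pivot, vecAt_explicitBases w i (pivotIdx_lt_five e i l)]
  exact theta_explicitBases w hs t k _

lemma formDet_transverse_explicitBases (hs : e + 3 ≤ s) (t : ℤ) :
    formDet (theta 0 hs (explicitBases w s e) (vecs (explicitBases w s e)) t)
      ![baseVec hs (vecs (explicitBases w s e)) 1, baseVec hs (vecs (explicitBases w s e)) 2,
        lastVec hs (vecs (explicitBases w s e))] =
    detZ fun k l => thetaZ e t k (![baseZ e 1, baseZ e 2, lastZ e] l) := by
  refine formDet_eq_detZ fun k l => ?_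
  rw [← theta_explicitBases w hs]
  congr 1
  fin_cases l
  exacts [baseVec_explicitBases w hs 1, baseVec_explicitBases w hs 2, lastVec_explicitBases w hs]

/-- The matrices whose pencil determines the parameters of the base planes. -/
def boxMatZ (e j : ℕ) : Matrix (Fin 3) (Fin 3) ℤ :=
  Matrix.of fun k l => pencilZ e (e + k) 4 3 (vecZ e 0 j) (baseZ e l)

lemma rootCoeff_explicitBases (hs : e + 3 ≤ s) :
    rootCoeff 0 hs (explicitBases w s e) (vecs (explicitBases w s e)) =
      pencilCoeff (Matrix.of fun k l => (boxMatZ e 0 k l : ℂ))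
        (Matrix.of fun k l => (boxMatZ e 1 k l : ℂ)) := by
  rw [rootCoeff]
  congr 1 <;> ext k l <;>
    rw [Matrix.of_apply, Matrix.of_apply, vecAt_explicitBases w _ (by norm_num),
      baseVec_explicitBases] <;> exact boxForm_explicitBases w hs k _ _

end Explicit

section ExplicitGood

variable {Y : Type*} [AddCommGroup Y] [Module ℂ Y] (w : Basis (Fin 5) ℂ Y) {s e : ℕ}

lemma boxMatZ_one_zero : boxMatZ 1 0 = !![1, 0, 0; -1, -1, 1; 1, 0, 1] := by decide

lemma boxMatZ_one_one : boxMatZ 1 1 = !![0, -1, 0; 0, 0, 0; 0, -1, -1] := by decide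

lemma boxMatZ_two_zero : boxMatZ 2 0 = !![-1, 1, -1; -1, -1, -1; 0, 1, 0] := by decide

lemma boxMatZ_two_one : boxMatZ 2 1 = !![0, 1, -1; 1, 0, 0; 0, 0, 1] := by decide

/-- The parameters of the base planes of the explicit instance. -/
def explicitRoots (e : ℕ) : List ℤ := if e = 1 then [1, -1] else [0, 1, -2]

lemma rootCoeff_explicitBases_one (hs : 1 + 3 ≤ s) :
    rootCoeff 0 hs (explicitBases w s 1) (vecs (explicitBases w s 1)) 0 = -1 ∧
    rootCoeff 0 hs (explicitBases w s 1) (vecs (explicitBases w s 1)) 1 = 0 ∧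
    rootCoeff 0 hs (explicitBases w s 1) (vecs (explicitBases w s 1)) 2 = 1 := by
  rw [rootCoeff_explicitBases, boxMatZ_one_zero, boxMatZ_one_one]
  simp only [pencilCoeff, Matrix.det_fin_three, Matrix.add_apply, Matrix.sub_apply,
    Matrix.of_apply, Matrix.cons_val', Matrix.cons_val]
  norm_num

lemma rootCoeff_explicitBases_two (hs : 2 + 3 ≤ s) :
    rootCoeff 0 hs (explicitBases w s 2) (vecs (explicitBases w s 2)) 0 = 0 ∧
    rootCoeff 0 hs (explicitBases w s 2) (vecs (explicitBases w s 2)) 1 = 2 ∧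
    rootCoeff 0 hs (explicitBases w s 2) (vecs (explicitBases w s 2)) 2 = -1 ∧
    rootCoeff 0 hs (explicitBases w s 2) (vecs (explicitBases w s 2)) 3 = -1 := by
  rw [rootCoeff_explicitBases, boxMatZ_two_zero, boxMatZ_two_one]
  simp only [pencilCoeff, Matrix.det_fin_three, Matrix.add_apply, Matrix.sub_apply,
    Matrix.of_apply, Matrix.cons_val', Matrix.cons_val]
  norm_num

lemma exists_of_isRoot_explicitBases (he : e = 1 ∨ e = 2) (hs : e + 3 ≤ s) {t : ℂ}
    (ht : IsRoot 0 hs (explicitBases w s e) (vecs (explicitBases w s e)) t) :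
    ∃ r ∈ explicitRoots e, t = ((r : ℤ) : ℂ) := by
  rcases he with rfl | rfl
  · obtain ⟨h0, h1, h2⟩ := rootCoeff_explicitBases_one w hs
    simp only [IsRoot, Finset.sum_range_succ, Finset.range_zero, Finset.sum_empty, h0, h1, h2] at ht
    have h3 : (t - 1) * (t + 1) = 0 := by linear_combination ht
    rcases mul_eq_zero.1 h3 with h | h
    · exact ⟨1, by simp [explicitRoots], by simpa using sub_eq_zero.1 h⟩
    · exact ⟨-1, by simp [explicitRoots], by simpa using eq_neg_of_add_eq_zero_left h⟩
  · obtain ⟨h0, h1, h2, h3⟩ := rootCoeff_explicitBases_two w hs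
    simp only [IsRoot, Finset.sum_range_succ, Finset.range_zero, Finset.sum_empty, h0, h1, h2,
      h3] at ht
    have h4 : t * (t - 1) * (t + 2) = 0 := by linear_combination -ht
    rcases mul_eq_zero.1 h4 with h | h
    · rcases mul_eq_zero.1 h with h | h
      · exact ⟨0, by simp [explicitRoots], by simpa using h⟩
      · exact ⟨1, by simp [explicitRoots], by simpa using sub_eq_zero.1 h⟩
    · exact ⟨-2, by simp [explicitRoots], by simpa using eq_neg_of_add_eq_zero_left h⟩

lemma transverse_explicit (he : e = 1 ∨ e = 2) : ∀ t ∈ explicitRoots e,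
    (detZ fun k l => thetaZ e t k (![baseZ e 1, baseZ e 2, lastZ e] l)) ≠ 0 := by
  rcases he with rfl | rfl <;> decide

lemma explicitVecs_eq {i : ℕ} (he : e = 1 ∨ e = 2) (hi : e + 3 < i) :
    explicitVecs e i = explicitVecs e (e + 3) ∧ explicitForms e i = explicitForms e (e + 3) := by
  have h (m : ℕ) (hm : m < 5) : i ≠ m := by omega
  have h5 : e = 2 → i ≠ 5 := by omega
  unfold explicitVecs explicitForms
  rcases he with rfl | rfl <;> simp [h]

lemma pivot_explicit (he : e = 1 ∨ e = 2) (i : ℕ) : ∀ t ∈ explicitRoots e,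
    (detZ fun k l => thetaZ e t k (vecZ e i (pivotIdx 0 e i l))) ≠ 0 := by
  have key : ∀ i ≤ e + 3, ∀ t ∈ explicitRoots e,
      (detZ fun k l => thetaZ e t k (vecZ e i (pivotIdx 0 e i l))) ≠ 0 := by
    rcases he with rfl | rfl <;> decide
  by_cases hi : i ≤ e + 3
  · exact key i hi
  · have h1 := key (e + 3) le_rfl
    have h2 : pivotIdx 0 e (e + 3) = pivotIdx 0 e i := by
      simp only [pivotIdx]
      rw [if_neg (by omega), if_neg (by omega), if_neg (by omega), if_neg (by omega)]
    rw [h2] at h1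
    unfold vecZ at h1 ⊢
    rwa [(explicitVecs_eq he (not_le.1 hi)).1]

lemma meet_explicit (he : e = 1 ∨ e = 2) (i : ℕ) : ∀ t ∈ explicitRoots e, meetZ e t i ≠ 0 := by
  have key : ∀ i ≤ e + 3, ∀ t ∈ explicitRoots e, meetZ e t i ≠ 0 := by
    rcases he with rfl | rfl <;> decide
  by_cases hi : i ≤ e + 3
  · exact key i hi
  · intro t ht
    have h1 : meetZ e t i = meetZ e t (e + 3) := by
      simp only [meetZ, pencilZ, formZ, (explicitVecs_eq he (not_le.1 hi)).2,
        if_neg (show ¬ i < e by omega), if_neg (show ¬ i < e + 3 by omega),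
        if_neg (show ¬ e + 3 < e by omega), lt_irrefl, if_false]
    rw [h1]
    exact key _ le_rfl t ht

lemma intVec_single (j : Fin 5) : intVec w (Pi.single j 1) = w j := by
  rw [intVec, Finset.sum_eq_single j]
  · simp
  · intro k _ hk
    simp [Pi.single_eq_of_ne hk]
  · simp

lemma complFrame_explicit (he : e = 1 ∨ e = 2) (hs : e + 3 ≤ s) (i : Fin s)
    (hi : (i : ℕ) < e + 3) : ∃ β : Basis (Fin 5) ℂ Y,
      ∀ m, complFrame 0 hs (vecs (explicitBases w s e)) i m = β m := by
  rcases he with rfl | rfl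
  · refine ⟨explicitBasis w 1 0, fun m => ?_⟩
    by_cases h0 : (i : ℕ) = 0
    · obtain rfl : i = idxZero hs := Fin.ext h0
      rw [complFrame, if_pos (by simp [plateau, idxZero])]
      rfl
    · have hp : plateau 1 i = 0 := if_neg (by omega)
      rw [complFrame, hp, if_neg (by omega), complVec, if_pos rfl, vecAt_eq _ _ (by omega)]
      rfl
  · have h0 {j : ℕ} (hj : j < 2) :
        vecAt (vecs (explicitBases w s 2)) (idxZero hs) j = w (Fin.ofNat 5 j) := by
      rw [vecAt_explicitBases w _ (by omega), ← intVec_single]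
      congr 1
      simp only [idxZero]
      interval_cases j <;> decide
    have h1 {j : ℕ} (hj : j < 3) :
        vecAt (vecs (explicitBases w s 2)) (idxOne hs) j = w (Fin.ofNat 5 (j + 2)) := by
      rw [vecAt_explicitBases w _ (by omega), ← intVec_single]
      congr 1
      simp only [idxOne]
      interval_cases j <;> decide
    by_cases hi1 : (i : ℕ) = 1
    · obtain rfl : i = idxOne hs := Fin.ext hi1
      have hp : plateau 2 (idxOne hs) = 3 := rfl
      refine ⟨w.reindex (Equiv.addRight 2).symm, fun m => ?_⟩
      rw [complFrame, hp, Basis.reindex_apply]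
      split_ifs with hm
      · have := h1 (j := m) (by omega)
        rw [vecAt_eq _ _ m.2] at this
        refine this.trans (congrArg w ?_)
        fin_cases m <;> rfl
      · rw [complVec, if_neg (by norm_num), if_neg (by norm_num [idxOne]), if_pos hi1,
          h0 (by omega)]
        congr 1
        fin_cases m <;> first | rfl | exact absurd (by norm_num) hm
    · refine ⟨w, fun m => ?_⟩
      have hp : plateau 2 i = if (i : ℕ) = 0 then 2 else 0 := by
        rw [plateau]
        split_ifs <;> omega
      by_cases hi0 : (i : ℕ) = 0
      · obtain rfl : i = idxZero hs := Fin.ext hi0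
        rw [if_pos hi0] at hp
        rw [complFrame, hp]
        split_ifs with hm
        · have := h0 (j := m) (by omega)
          rw [vecAt_eq _ _ m.2] at this
          refine this.trans (congrArg w ?_)
          fin_cases m <;> rfl
        · rw [complVec, if_neg (by norm_num), if_pos hi0, h1 (by omega)]
          congr 1
          fin_cases m <;> first | rfl | exact absurd (by norm_num) hm
      · rw [if_neg hi0] at hp
        rw [complFrame, hp, if_neg (by omega), complVec, if_neg (by norm_num), if_neg hi0,
          if_neg hi1]
        split_ifs with hm
        · rw [h0 hm]
          congr 1
          fin_cases m <;> rfl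
        · rw [h1 (by omega)]
          congr 1
          fin_cases m <;> first | rfl | exact absurd (by norm_num) hm

theorem isGoodFrame_explicitBases (he : e = 1 ∨ e = 2) (hs : e + 3 ≤ s) :
    IsGoodFrame 0 hs (explicitBases w s e) (vecs (explicitBases w s e)) where
  compl i hi := by
    obtain ⟨β, hβ⟩ := complFrame_explicit w he hs i hi
    rw [show complFrame 0 hs (vecs (explicitBases w s e)) i = β from funext hβ]
    exact det_basis_ne_zero _ _
  lead := by
    rcases he with rfl | rfl
    · rw [(rootCoeff_explicitBases_one w hs).2.2]
      norm_num
    · rw [(rootCoeff_explicitBases_two w hs).2.2.2]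
      norm_num
  simple t ht := by
    obtain ⟨r, hr, rfl⟩ := exists_of_isRoot_explicitBases w he hs ht
    rcases he with rfl | rfl
    · obtain ⟨h0, h1, h2⟩ := rootCoeff_explicitBases_one w hs
      simp only [Finset.sum_range_succ, Finset.range_zero, Finset.sum_empty, h0, h1, h2]
      simp only [explicitRoots, if_pos, List.mem_cons, List.not_mem_nil, or_false] at hr
      rcases hr with rfl | rfl <;> norm_num
    · obtain ⟨h0, h1, h2, h3⟩ := rootCoeff_explicitBases_two w hs
      simp only [Finset.sum_range_succ, Finset.range_zero, Finset.sum_empty, h0, h1, h2, h3]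
      simp only [explicitRoots, OfNat.ofNat_ne_one, if_false, List.mem_cons, List.not_mem_nil,
        or_false] at hr
      rcases hr with rfl | rfl | rfl <;> norm_num
  transverse t ht := by
    obtain ⟨r, hr, rfl⟩ := exists_of_isRoot_explicitBases w he hs ht
    rw [formDet_transverse_explicitBases]
    exact_mod_cast transverse_explicit he r hr
  pivot_ne_zero t ht i := by
    obtain ⟨r, hr, rfl⟩ := exists_of_isRoot_explicitBases w he hs ht
    rw [formDet_pivot_explicitBases]
    exact_mod_cast pivot_explicit he i r hr
  meetValue_ne_zero t ht i := by
    obtain ⟨r, hr, rfl⟩ := exists_of_isRoot_explicitBases w he hs ht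
    rw [meetValue_explicitBases]
    exact_mod_cast meet_explicit he i r hr

end ExplicitGood

/-! ### The generic locus -/

section GenericLocus

variable {X : Type*} [AddCommGroup X] [Module ℂ X] {s e b : ℕ}

/-- The instances that have an adapted tuple of bases in general position. -/
def genericLocus (X : Type*) [AddCommGroup X] [Module ℂ X] (b : ℕ) (hs : e + 3 ≤ s) :
    Set (Fin s → CompleteFlag X) :=
  nonvanishingLocus fun β : Fin s → Basis (Fin (5 + b)) ℂ X => goodFun b hs β

lemma isZariskiOpen_genericLocus (hX : finrank ℂ X = 5 + b) (hs : e + 3 ≤ s) :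
    IsZariskiOpen (genericLocus X b hs) :=
  isZariskiOpen_nonvanishingLocus hX fun β => goodFun_mem_polyFun b hs β

lemma mem_genericLocus {hs : e + 3 ≤ s} {F : Fin s → CompleteFlag X} :
    F ∈ genericLocus X b hs ↔ ∃ β v : Fin s → Basis (Fin (5 + b)) ℂ X,
      F = flags v ∧ IsGoodFrame b hs β (vecs v) := by
  simp only [genericLocus, nonvanishingLocus, goodFun_ne_zero_iff, funext_iff]
  rfl

lemma isGenericInstance_of_mem [FiniteDimensional ℂ X] (he : e = 1 ∨ e = 2) {hs : e + 3 ≤ s}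
    {F : Fin s → CompleteFlag X} (hF : F ∈ genericLocus X b hs) : IsGenericInstance b hs F := by
  obtain ⟨β, v, rfl, hv⟩ := mem_genericLocus.1 hF
  exact hv.isGenericInstance he

theorem hasSchubertNumber_baseProblem (he : e = 1 ∨ e = 2) :
    HasSchubertNumber 2 5 (baseProblem e) (e + 1) := by
  have hX : finrank ℂ (Fin 5 → ℂ) = 5 := by simp
  refine ⟨nonvanishingLocus fun β : Fin (e + 3) → Basis (Fin (5 + 0)) ℂ (Fin 5 → ℂ) =>
    (exists_polyFun_isBaseFrame 0 le_rfl β).choose, ?_, isZariskiOpen_nonvanishingLocus hX fun β =>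
      (exists_polyFun_isBaseFrame 0 le_rfl β).choose_spec.1, ?_⟩
  · let x : Fin (e + 3) → Basis (Fin (5 + 0)) ℂ (Fin 5 → ℂ) :=
      explicitBases (Pi.basisFun ℂ (Fin 5)) (e + 3) e
    exact ⟨flags x, x, x, fun _ => rfl,
      ((exists_polyFun_isBaseFrame 0 le_rfl x).choose_spec.2 _).2
        (isGoodFrame_explicitBases (Pi.basisFun ℂ (Fin 5)) he le_rfl).toIsBaseFrame⟩
  · rintro F ⟨β, v, hF, hv⟩
    obtain rfl : F = flags v := funext hF
    have hv' := ((exists_polyFun_isBaseFrame 0 le_rfl β).choose_spec.2 _).1 hv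
    rw [← hv'.encard_isBasePlane he]
    congr 1
    ext h
    exact mem_schubertSolutions_baseProblem he hX _ h

end GenericLocus

/-! ### Every general base instance is induced -/

section BaseSurjective

variable {X : Type*} [AddCommGroup X] [Module ℂ X] {s e b : ℕ} {V : Submodule ℂ X}

lemma isPolyMap_liftFrame {M : Type*} [AddCommGroup M] [Module ℂ M] (z : Fin b → X)
    {x : M → Fin s → Fin 5 → V} (hx : ∀ i j, IsPolyMap fun y => x y i j) (i : Fin s)
    (m : Fin (5 + b)) : IsPolyMap fun y => liftFrame e z (x y) i m := by
  have h (j : ℕ) : IsPolyMap fun y => ((vecAt (x y) i j : V) : X) :=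
    (isPolyMap_vecAt hx i j).linear V.subtype
  unfold liftFrame
  split_ifs
  · exact h _
  · exact (isPolyMap_const _).add (h _)
  · exact (isPolyMap_const _).add (isPolyMap_const _)
  · exact h _

variable [FiniteDimensional ℂ X]

lemma exists_complement (hX : finrank ℂ X = 5 + b) (hV : finrank ℂ V = 5) :
    ∃ z : Fin b → X, ⊤ ≤ V ⊔ Submodule.span ℂ (Set.range z) := by
  have hW : finrank ℂ (X ⧸ V) = b := by
    have := Submodule.finrank_quotient_add_finrank V
    omega
  let w := finBasisOfFinrankEq ℂ (X ⧸ V) hW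
  choose z hz using fun j => V.mkQ_surjective (w j)
  refine ⟨z, ?_⟩
  rw [top_le_iff, ← Submodule.map_mkQ_eq_top, Submodule.map_span, ← Set.range_comp,
    show V.mkQ ∘ z = w from funext hz, w.span_eq]

variable {hs : e + 3 ≤ s} {z : Fin b → X} {x : Fin s → Basis (Fin 5) ℂ V}
  {v : Fin s → Basis (Fin (5 + b)) ℂ X}

omit [FiniteDimensional ℂ X] in
lemma flags_lift_le (he : e = 1 ∨ e = 2) (hvx : vecs v = liftFrame e z (vecs x)) (i : Fin s)
    (hi : (i : ℕ) < e + 3) {j : ℕ} (hj : j ≤ plateau e i) : (flags v i).space j ≤ V := by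
  refine flagOf_le_span_of_forall v i fun m hm => ?_
  have hl : liftIdx e i = plateau e i := if_pos hi
  rw [hvx, vecAt_liftFrame_of_lt z _ i he (by omega)]
  exact SetLike.coe_mem _

lemma baseSpace_lift (he : e = 1 ∨ e = 2) (hvx : vecs v = liftFrame e z (vecs x))
    {β : Fin s → Basis (Fin (5 + b)) ℂ X} (hv : IsBaseFrame b hs β (vecs v))
    (hV : finrank ℂ V = 5) : baseSpace hs (flags v) = V := by
  refine Submodule.eq_of_le_of_finrank_eq ?_ ((hv.finrank_baseSpace he).trans hV.symm)
  rcases he with rfl | rfl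
  · rw [baseSpace, if_pos rfl]
    exact flags_lift_le (Or.inl rfl) hvx _ (by simp [idxZero]) (by simp [plateau, idxZero])
  · rw [baseSpace, if_neg (by norm_num)]
    exact sup_le (flags_lift_le (Or.inr rfl) hvx _ (by simp [idxZero]) (by simp [plateau, idxZero]))
      (flags_lift_le (Or.inr rfl) hvx _ (by simp [idxOne]) (by simp [plateau, idxOne]))

omit [FiniteDimensional ℂ X] in
lemma flagOf_le_comap_lift (he : e = 1 ∨ e = 2) (hvx : vecs v = liftFrame e z (vecs x))
    (i : Fin s) (hi : (i : ℕ) < e + 3) (j : ℕ) :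
    (flagOf (x i)).space j ≤ ((flags v i).space (baseFlagIdx e b i j)).comap V.subtype := by
  refine flagOf_le_span_of_forall x i fun m hm => ?_
  by_cases h5 : m < 5
  swap
  · rw [vecAt_of_le _ _ (not_lt.1 h5)]
    exact zero_mem _
  rw [Submodule.mem_comap, Submodule.subtype_apply]
  have hl : liftIdx e i = plateau e i := if_pos hi
  have hl5 := plateau_le_five he i
  by_cases h : m < plateau e i
  · rw [← vecAt_liftFrame_of_lt z (vecs x) i he (by omega), ← hvx]
    refine vecAt_mem_flagOf v i (by omega) ?_
    unfold baseFlagIdx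
    split_ifs <;> omega
  · rw [← vecAt_liftFrame_of_le z (vecs x) i he (by omega) h5, ← hvx]
    refine vecAt_mem_flagOf v i (by omega) ?_
    rw [baseFlagIdx, if_neg (by omega)]
    omega

theorem exists_isZariskiOpen_base (hs : e + 3 ≤ s) (he : e = 1 ∨ e = 2) (hb : 2 ≤ b)
    (hX : finrank ℂ X = 5 + b) (hV : finrank ℂ V = 5) :
    ∃ O : Set (Fin (e + 3) → CompleteFlag V), O.Nonempty ∧ IsZariskiOpen O ∧ ∀ E ∈ O,
      ∃ F ∈ genericLocus X b hs, ∃ G, IsInducedDatum b hs F V E G := by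
  obtain ⟨z, hz⟩ := exists_complement hX hV
  let x₀ : Fin s → Basis (Fin 5) ℂ V := explicitBases (finBasisOfFinrankEq ℂ V hV) s e
  obtain ⟨v₀, hv₀⟩ := exists_liftBasis he hX hz x₀
  have hgood : IsGoodFrame b hs v₀ (vecs v₀) :=
    (isGoodFrame_explicitBases _ he hs).lift he hv₀ hb hz
  let ext (y : Fin (e + 3) → Fin 5 → V) (i : Fin s) : Fin 5 → V :=
    if h : (i : ℕ) < e + 3 then y ⟨i, h⟩ else vecs x₀ i
  let q (_ : Unit) (y : Fin (e + 3) → Fin 5 → V) : ℂ := goodFun b hs v₀ (liftFrame e z (ext y))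
  have hq (u : Unit) : q u ∈ polyFun _ := by
    refine comp_mem_polyFun (goodFun_mem_polyFun b hs v₀) (isPolyMap_pi fun i => isPolyMap_pi
      fun m => isPolyMap_liftFrame z (fun i j => ?_) i m)
    simp only [ext]
    split_ifs
    · exact isPolyMap_apply_apply _ _
    · exact isPolyMap_const _
  refine ⟨nonvanishingLocus q, ⟨fun i => flagOf (x₀ (Fin.castLE hs i)), (), fun i =>
    x₀ (Fin.castLE hs i), fun _ => rfl, ?_⟩, isZariskiOpen_nonvanishingLocus hV hq, ?_⟩
  · refine (goodFun_ne_zero_iff b hs v₀).2 ?_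
    convert hgood
    rw [hv₀]
    congr 1
    funext i
    simp only [ext]
    split_ifs <;> rfl
  · rintro E ⟨_, y, hE, hy⟩
    let x (i : Fin s) : Basis (Fin 5) ℂ V := if h : (i : ℕ) < e + 3 then y ⟨i, h⟩ else x₀ i
    have hxy : vecs x = ext (fun i j => y i j) := by
      funext i j
      simp only [vecs, x, ext]
      split_ifs <;> rfl
    obtain ⟨v, hv⟩ := exists_liftBasis he hX hz x
    have hgood' : IsGoodFrame b hs v₀ (vecs v) := by
      rw [hv, hxy, ← goodFun_ne_zero_iff]
      exact hy
    have hgen := hgood'.isGenericInstance he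
    have hVe : baseSpace hs (flags v) = V := baseSpace_lift he hv hgood'.toIsBaseFrame hV
    have hex := hgen.exists_isInducedDatum he hX
    rw [hVe] at hex
    obtain ⟨E', G, hD⟩ := hex
    refine ⟨flags v, mem_genericLocus.2 ⟨v₀, v, rfl, hgood'⟩, G, ?_⟩
    convert hD using 1
    funext i
    ext1
    funext j
    rw [hD.base, hE]
    have h1 := flagOf_le_comap_lift he hv (Fin.castLE hs i) i.2 j
    have h2 : x (Fin.castLE hs i) = y i := by
      simp only [x]
      rw [dif_pos (show ((Fin.castLE hs i : Fin s) : ℕ) < e + 3 from i.2)]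
      rfl
    rw [h2] at h1
    refine Submodule.eq_of_le_of_finrank_eq h1 ?_
    have h3 := hgen.finrank_base he hX (Fin.castLE hs i) i.2 j
    rw [hVe] at h3
    rw [(flagOf (y i)).finrank_space, hV]
    exact h3.symm

end BaseSurjective

/-! ### Shears along sections of the hull -/

section Shear

variable {X : Type*} [AddCommGroup X] [Module ℂ X]

lemma flagOf_map {Y : Type*} [AddCommGroup Y] [Module ℂ Y] {n : ℕ} (v : Basis (Fin n) ℂ X)
    (g : X ≃ₗ[ℂ] Y) (j : ℕ) :
    (flagOf (v.map g)).space j = ((flagOf v).space j).map g.toLinearMap := by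
  rw [flagOf_space, flagOf_space, Submodule.map_span, ← Set.image_comp]
  rfl

/-- The automorphism of `X` that is the identity on `V` and induces `γ` on `X / V`, and which
moves vectors along the section `σ` of the projection to `X / V`. -/
def shearEquiv (V : Submodule ℂ X) {σ : (X ⧸ V) →ₗ[ℂ] X} (hσ : ∀ y, V.mkQ (σ y) = y)
    (γ : (X ⧸ V) ≃ₗ[ℂ] (X ⧸ V)) : X ≃ₗ[ℂ] X :=
  LinearEquiv.ofLinearMap
    (LinearMap.id + σ ∘ₗ (γ.toLinearMap - LinearMap.id) ∘ₗ V.mkQ)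
    (LinearMap.id + σ ∘ₗ (γ.symm.toLinearMap - LinearMap.id) ∘ₗ V.mkQ)
    (by ext x; simp [hσ, -Submodule.mkQ_apply]; abel)
    (by ext x; simp [hσ, -Submodule.mkQ_apply]; abel)

variable {V : Submodule ℂ X} {σ : (X ⧸ V) →ₗ[ℂ] X} (hσ : ∀ y, V.mkQ (σ y) = y)
  (γ : (X ⧸ V) ≃ₗ[ℂ] (X ⧸ V))

lemma shearEquiv_apply (x : X) : shearEquiv V hσ γ x = x + σ (γ (V.mkQ x) - V.mkQ x) := rfl

lemma mkQ_shearEquiv (x : X) : V.mkQ (shearEquiv V hσ γ x) = γ (V.mkQ x) := by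
  rw [shearEquiv_apply, map_add, hσ]
  abel

lemma shearEquiv_of_mem {x : X} (hx : x ∈ V) : shearEquiv V hσ γ x = x := by
  have h : V.mkQ x = 0 := by simpa using hx
  rw [shearEquiv_apply, h, map_zero, sub_zero, map_zero, add_zero]

lemma shearEquiv_mem_iff {x : X} : shearEquiv V hσ γ x ∈ V ↔ x ∈ V := by
  have h (y : X) : y ∈ V ↔ V.mkQ y = 0 := by simp
  rw [h, mkQ_shearEquiv, LinearEquiv.map_eq_zero_iff, ← h]

lemma map_shearEquiv_of_le {S : Submodule ℂ X} (hS : S ≤ V) :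
    S.map (shearEquiv V hσ γ).toLinearMap = S := by
  ext x
  constructor
  · rintro ⟨y, hy, rfl⟩
    rw [LinearEquiv.coe_coe, shearEquiv_of_mem hσ γ (hS hy)]
    exact hy
  · exact fun hx => ⟨x, hx, shearEquiv_of_mem hσ γ (hS hx)⟩

lemma map_shearEquiv_of_forall_mem [FiniteDimensional ℂ X] {S : Submodule ℂ X}
    (hS : ∀ y, σ y ∈ S) : S.map (shearEquiv V hσ γ).toLinearMap = S := by
  refine Submodule.eq_of_le_of_finrank_eq ?_ (LinearEquiv.finrank_map_eq _ _)
  rintro _ ⟨y, hy, rfl⟩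
  exact add_mem hy (hS _)

lemma comap_map_shearEquiv (S : Submodule ℂ X) :
    (S.map (shearEquiv V hσ γ).toLinearMap).comap V.subtype = S.comap V.subtype := by
  ext x
  rw [Submodule.mem_comap, Submodule.mem_comap, Submodule.subtype_apply]
  constructor
  · rintro ⟨y, hy, h⟩
    have hyV : y ∈ V := (shearEquiv_mem_iff hσ γ).1 (by
      rw [← LinearEquiv.coe_coe, h]
      exact x.2)
    rw [LinearEquiv.coe_coe, shearEquiv_of_mem hσ γ hyV] at h
    rwa [← h]
  · exact fun hx => ⟨x, hx, shearEquiv_of_mem hσ γ x.2⟩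

end Shear

section HullShear

variable {X : Type*} [AddCommGroup X] [Module ℂ X] [FiniteDimensional ℂ X] {s e b : ℕ}
  {hs : e + 3 ≤ s} {F F' : Fin s → CompleteFlag X} {h : Submodule ℂ X}

lemma IsGenericInstance.exists_section (hF : IsGenericInstance b hs F) (he : e = 1 ∨ e = 2)
    (hX : finrank ℂ X = 5 + b) (hh : IsBasePlane b hs F h) :
    ∃ σ : Fin s → (X ⧸ baseSpace hs F) →ₗ[ℂ] X, (∀ i y, (baseSpace hs F).mkQ (σ i y) = y) ∧
      ∀ i y, σ i y ∈ (F i).space (offset e i + b) ⊓ hull b hs F h := by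
  have key (i : Fin s) : ∃ σ : (X ⧸ baseSpace hs F) →ₗ[ℂ] X,
      (∀ y, (baseSpace hs F).mkQ (σ y) = y) ∧
      ∀ y, σ y ∈ (F i).space (offset e i + b) ⊓ hull b hs F h := by
    set S := (F i).space (offset e i + b) ⊓ hull b hs F h with hS
    have h1 : S.map (baseSpace hs F).mkQ = ⊤ := by
      apply Submodule.eq_top_of_finrank_eq
      rw [hF.finrank_map_fiber he hX hh, hF.finrank_quotient hX, min_self]
    have h2 : LinearMap.range ((baseSpace hs F).mkQ.domRestrict S) = ⊤ := by
      rw [LinearMap.range_domRestrict, h1]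
    obtain ⟨τ, hτ⟩ := LinearMap.exists_rightInverse_of_surjective _ h2
    exact ⟨S.subtype ∘ₗ τ, fun y => LinearMap.congr_fun hτ y, fun y => (τ y).2⟩
  choose σ h1 h2 using key
  exact ⟨σ, h1, h2⟩

variable {σ : Fin s → (X ⧸ baseSpace hs F) →ₗ[ℂ] X}
  {hσ : ∀ i y, (baseSpace hs F).mkQ (σ i y) = y}
  {γ : Fin s → (X ⧸ baseSpace hs F) ≃ₗ[ℂ] (X ⧸ baseSpace hs F)}
  (hF' : ∀ i j, (F' i).space j =
    ((F i).space j).map (shearEquiv (baseSpace hs F) (hσ i) (γ i)).toLinearMap)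
include hF'

omit [FiniteDimensional ℂ X] in
lemma baseSpace_shear : baseSpace hs F' = baseSpace hs F := by
  have key (i : Fin s) (j : ℕ) (hij : (F i).space j ≤ baseSpace hs F) :
      (F' i).space j = (F i).space j := by
    rw [hF', map_shearEquiv_of_le _ _ hij]
  by_cases he : e = 1
  · have h0 : baseSpace hs F = (F (idxZero hs)).space 5 := if_pos he
    rw [show baseSpace hs F' = (F' (idxZero hs)).space 5 from if_pos he, key _ _ h0.ge, h0]
  · have h0 : baseSpace hs F = (F (idxZero hs)).space 2 ⊔ (F (idxOne hs)).space 3 := if_neg he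
    rw [show baseSpace hs F' = (F' (idxZero hs)).space 2 ⊔ (F' (idxOne hs)).space 3 from if_neg he,
      key _ _ (le_sup_left.trans h0.ge), key _ _ (le_sup_right.trans h0.ge), h0]

variable (hσ' : ∀ i y, σ i y ∈ (F i).space (offset e i + b) ⊓ hull b hs F h)
include hσ'

lemma space_box_shear (k : Fin 3) :
    (F' (boxIdx hs k)).space (b + 3) = (F (boxIdx hs k)).space (b + 3) := by
  rw [hF']
  refine map_shearEquiv_of_forall_mem _ _ fun y => (F _).mono ?_ (hσ' _ y).1
  rw [offset_boxIdx]
  omega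

lemma hull_shear (P : Submodule ℂ X) : hull b hs F' P = hull b hs F P := by
  unfold hull
  simp only [space_box_shear hF' hσ']

lemma isBasePlane_shear (P : Submodule ℂ X) : IsBasePlane b hs F' P ↔ IsBasePlane b hs F P := by
  have key (i : Fin s) (j : ℕ) (hij : (F i).space j ≤ baseSpace hs F) :
      (F' i).space j = (F i).space j := by
    rw [hF', map_shearEquiv_of_le _ _ hij]
  have h2 := key (idxZero hs) 2 (first_le_baseSpace F)
  have h4 (he : e = 1) : (F' (idxZero hs)).space 4 = (F (idxZero hs)).space 4 := by
    refine key _ _ ?_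
    rw [baseSpace, if_pos he]
    exact (F _).mono (by norm_num)
  have h3 (he : e = 2) : (F' (idxOne hs)).space 3 = (F (idxOne hs)).space 3 := by
    refine key _ _ ?_
    rw [baseSpace, if_neg (by omega)]
    exact le_sup_right
  have hbox := space_box_shear hF' hσ'
  constructor
  · rintro ⟨c1, c2, c3, c4, c5⟩
    exact ⟨c1, h2 ▸ c2, fun he => h4 he ▸ c3 he, fun he => h3 he ▸ c4 he, fun k => hbox k ▸ c5 k⟩
  · rintro ⟨c1, c2, c3, c4, c5⟩
    exact ⟨c1, h2 ▸ c2, fun he => h4 he ▸ c3 he, fun he => h3 he ▸ c4 he, fun k => hbox k ▸ c5 k⟩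

lemma map_inf_hull_shear (i : Fin s) (m : ℕ) :
    ((F' i).space m ⊓ hull b hs F h).map (baseSpace hs F).mkQ =
      (((F i).space m ⊓ hull b hs F h).map (baseSpace hs F).mkQ).map (γ i).toLinearMap := by
  have h1 : (F' i).space m ⊓ hull b hs F h = ((F i).space m ⊓ hull b hs F h).map
      (shearEquiv (baseSpace hs F) (hσ i) (γ i)).toLinearMap := by
    rw [Submodule.map_inf _ (LinearEquiv.injective _), hF',
      map_shearEquiv_of_forall_mem (S := hull b hs F h) _ _ fun y => (hσ' i y).2]
  rw [h1, ← Submodule.map_comp, ← Submodule.map_comp]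
  congr 1
  ext x
  exact mkQ_shearEquiv _ _ x

end HullShear

section FiberSurjective

variable {X : Type*} [AddCommGroup X] [Module ℂ X] [FiniteDimensional ℂ X] {s e b : ℕ}
  {hs : e + 3 ≤ s}

omit [FiniteDimensional ℂ X] in
lemma isPolyMap_constr {M : Type*} [AddCommGroup M] [Module ℂ M] {Y : Type*} [AddCommGroup Y]
    [Module ℂ Y] (u : Basis (Fin b) ℂ Y) {f : M → Fin b → X}
    (hf : ∀ k, IsPolyMap fun y => f y k) (x : Y) : IsPolyMap fun y => u.constr ℂ (f y) x := by
  simp only [Basis.constr_apply_fintype]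
  exact IsPolyMap.sum _ fun k _ => IsPolyMap.smul (const_mem_polyFun _) (hf k)

theorem exists_isZariskiOpen_fiber (he : e = 1 ∨ e = 2) (hX : finrank ℂ X = 5 + b)
    {F : Fin s → CompleteFlag X} (hF : F ∈ genericLocus X b hs) {V : Submodule ℂ X}
    {E : Fin (e + 3) → CompleteFlag V} {G : Submodule ℂ V → Fin s → CompleteFlag (X ⧸ V)}
    (hD : IsInducedDatum b hs F V E G) {h : Submodule ℂ V}
    (hh : IsBasePlane b hs F (h.map V.subtype)) :
    ∃ O : Set (Fin s → CompleteFlag (X ⧸ V)), O.Nonempty ∧ IsZariskiOpen O ∧ ∀ G₀ ∈ O,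
      ∃ F' ∈ genericLocus X b hs, ∃ G', IsInducedDatum b hs F' V E G' ∧ G' h = G₀ := by
  obtain ⟨β, v, rfl, hv⟩ := mem_genericLocus.1 hF
  have hgen := hv.isGenericInstance he
  obtain rfl := hD.eq_baseSpace
  have hW := hgen.finrank_quotient hX
  obtain ⟨σ, hσ, hσ'⟩ := hgen.exists_section he hX hh
  choose u₀ hu₀ using fun i => exists_flagOf_eq hW (G h i)
  let q (_ : Unit) (u : Fin s → Fin b → X ⧸ baseSpace hs (flags v)) : ℂ :=
    goodFun b hs β fun i j => v i j + σ i ((u₀ i).constr ℂ (u i)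
      ((baseSpace hs (flags v)).mkQ (v i j)) - (baseSpace hs (flags v)).mkQ (v i j))
  have hq (k : Unit) : q k ∈ polyFun _ := by
    refine comp_mem_polyFun (goodFun_mem_polyFun b hs β) (isPolyMap_pi fun i => isPolyMap_pi
      fun j => (isPolyMap_const _).add (IsPolyMap.linear (IsPolyMap.sub ?_ (isPolyMap_const _)) _))
    exact isPolyMap_constr (u₀ i) (fun k => isPolyMap_apply_apply i k) _
  refine ⟨nonvanishingLocus q, ⟨fun i => flagOf (u₀ i), (), u₀, fun _ => rfl, ?_⟩,
    isZariskiOpen_nonvanishingLocus hW hq, ?_⟩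
  · refine (goodFun_ne_zero_iff b hs β).2 ?_
    convert hv using 3 with i j
    have : (u₀ i).constr ℂ (u₀ i) = LinearMap.id := (u₀ i).ext fun k => by simp
    rw [this]
    simp
  · rintro G₀ ⟨_, u, hG₀, hu⟩
    let γ (i : Fin s) := (u₀ i).equiv (u i) (Equiv.refl _)
    let v' (i : Fin s) := (v i).map (shearEquiv (baseSpace hs (flags v)) (hσ i) (γ i))
    have hgood : IsGoodFrame b hs β (vecs v') := by
      rw [← goodFun_ne_zero_iff]
      convert hu using 3 with i j
      have : (u₀ i).constr ℂ (u i) = (γ i).toLinearMap := (u₀ i).ext fun k => by simp [γ]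
      rw [this]
      rfl
    have hF' (i : Fin s) (j : ℕ) : (flags v' i).space j = ((flags v i).space j).map
        (shearEquiv (baseSpace hs (flags v)) (hσ i) (γ i)).toLinearMap := flagOf_map _ _ _
    have hbase := baseSpace_shear hF'
    have hex := (hgood.isGenericInstance he).exists_isInducedDatum he hX
    rw [hbase] at hex
    obtain ⟨E', G', hD'⟩ := hex
    have hE : E' = E := by
      funext i
      ext1
      funext j
      rw [hD.base, hD'.base, hF', comap_map_shearEquiv]
    subst hE
    refine ⟨flags v', mem_genericLocus.2 ⟨β, v', rfl, hgood⟩, G', hD', ?_⟩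
    funext i
    ext1
    funext m
    have hh' := (isBasePlane_shear hF' hσ' _).2 hh
    rw [hD'.fiber h hh', hull_shear hF' hσ', map_inf_hull_shear hF' hσ', ← hD.fiber h hh, hu₀, hG₀,
      ← flagOf_map]
    congr 2
    refine Basis.eq_of_apply_eq fun k => ?_
    simp [γ]

end FiberSurjective

/-! ### Explicit bases of the fibers -/

section HullProj

variable {X : Type*} [AddCommGroup X] [Module ℂ X] {s e b n : ℕ}

/-- A multiple of the projection to the common kernel of three forms along three vectors. -/
def kernelProj (ρ : Fin 3 → X →ₗ[ℂ] ℂ) (τ : Fin 3 → X) : X →ₗ[ℂ] X :=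
  formDet ρ τ • LinearMap.id - ∑ l, (LinearMap.proj l ∘ₗ
    Matrix.cramer (Matrix.of fun k l => ρ k (τ l)) ∘ₗ LinearMap.pi ρ).smulRight (τ l)

lemma kernelProj_apply (ρ : Fin 3 → X →ₗ[ℂ] ℂ) (τ : Fin 3 → X) (x : X) :
    kernelProj ρ τ x = formDet ρ τ • x -
      ∑ l, ((Matrix.of fun k l => ρ k (τ l)).updateCol l fun k => ρ k x).det • τ l := by
  simp only [kernelProj, LinearMap.sub_apply, LinearMap.smul_apply, LinearMap.id_apply,
    LinearMap.sum_apply, LinearMap.smulRight_apply]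
  rfl

lemma apply_kernelProj (ρ : Fin 3 → X →ₗ[ℂ] ℂ) (τ : Fin 3 → X) (k : Fin 3) (x : X) :
    ρ k (kernelProj ρ τ x) = 0 := by
  have h := congrFun (Matrix.mulVec_cramer (Matrix.of fun k l => ρ k (τ l)) fun k => ρ k x) k
  rw [kernelProj_apply, map_sub, map_smul, map_sum, sub_eq_zero]
  simp only [Matrix.mulVec, dotProduct, Matrix.of_apply, Matrix.cramer_apply, Pi.smul_apply,
    smul_eq_mul] at h
  rw [smul_eq_mul, formDet, ← h]
  exact Finset.sum_congr rfl fun l _ => by rw [map_smul, smul_eq_mul, mul_comm]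

lemma kernelProj_eq_smul {ρ : Fin 3 → X →ₗ[ℂ] ℂ} {τ : Fin 3 → X} {x : X} (hx : ∀ k, ρ k x = 0) :
    kernelProj ρ τ x = formDet ρ τ • x := by
  rw [kernelProj_apply, sub_eq_self]
  refine Finset.sum_eq_zero fun l _ => ?_
  rw [Matrix.det_eq_zero_of_column_eq_zero l, zero_smul]
  intro k
  simp [hx]

lemma isPolyMap_kernelProj {M : Type*} [AddCommGroup M] [Module ℂ M]
    {ρ : M → Fin 3 → X →ₗ[ℂ] ℂ} {τ : M → Fin 3 → X} {x : M → X}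
    (hτ : ∀ l, IsPolyMap fun y => τ y l) (hx : IsPolyMap x)
    (hρτ : ∀ k l, (fun y => ρ y k (τ y l)) ∈ polyFun M)
    (hρx : ∀ k, (fun y => ρ y k (x y)) ∈ polyFun M) :
    IsPolyMap fun y => kernelProj (ρ y) (τ y) (x y) := by
  simp only [kernelProj_apply]
  refine IsPolyMap.sub (IsPolyMap.smul (formDet_mem_polyFun hρτ) hx)
    (IsPolyMap.sum _ fun l _ => IsPolyMap.smul (matrix_det_mem_polyFun fun k l' => ?_) (hτ l))
  by_cases h : l' = l
  · subst h
    simpa using hρx k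
  · simpa [Matrix.updateCol_ne h] using hρτ k l'

lemma kernelProj_map {ρ ρ' : Fin 3 → X →ₗ[ℂ] ℂ} {τ : Fin 3 → X} {c : Fin 3 → ℂ} (g : X →ₗ[ℂ] X)
    (h : ∀ k x, ρ' k (g x) = c k * ρ k x) (x : X) :
    kernelProj ρ' (fun l => g (τ l)) (g x) = (∏ k, c k) • g (kernelProj ρ τ x) := by
  have h1 : formDet ρ' (fun l => g (τ l)) = (∏ k, c k) * formDet ρ τ := by
    rw [formDet, formDet, ← Matrix.det_mul_column]
    simp only [h, Matrix.of_apply]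
  have h2 (l : Fin 3) : ((Matrix.of fun k l => ρ' k (g (τ l))).updateCol l fun k => ρ' k (g x)).det
      = (∏ k, c k) * ((Matrix.of fun k l => ρ k (τ l)).updateCol l fun k => ρ k x).det := by
    rw [← Matrix.det_mul_column]
    congr 1
    ext k l'
    by_cases hl : l' = l
    · subst hl
      simp [h]
    · simp [Matrix.updateCol_ne hl, h]
  rw [kernelProj_apply, kernelProj_apply, h1, map_sub, smul_sub, map_smul, smul_smul, map_sum,
    Finset.smul_sum]
  simp only [h2, map_smul, smul_smul]

/-- A multiple of the projection to the hull, which preserves the subspaces of the `i`-th flag that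
define the flag in the fiber. -/
def hullProj (b : ℕ) (hs : e + 3 ≤ s) (β : Fin s → Basis (Fin n) ℂ X) (v : Fin s → Fin n → X)
    (t : ℂ) (i : Fin s) : X →ₗ[ℂ] X :=
  kernelProj (theta b hs β v t) (pivot b e v i)

/-- Vectors of the hull that represent a basis adapted to the `i`-th flag of the fiber. -/
def fiberVec (b : ℕ) (hs : e + 3 ≤ s) (β : Fin s → Basis (Fin n) ℂ X) (v : Fin s → Fin n → X)
    (t : ℂ) (i : Fin s) (m : Fin b) : X :=
  hullProj b hs β v t i (vecAt v i (offset e i + m))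

lemma isPolyMap_fiberVec {M : Type*} [AddCommGroup M] [Module ℂ M] {v : M → Fin s → Fin n → X}
    (hv : ∀ i j, IsPolyMap fun y => v y i j) {t : M → ℂ} (ht : t ∈ polyFun M) (hs : e + 3 ≤ s)
    (β : Fin s → Basis (Fin n) ℂ X) (i : Fin s) (m : Fin b) :
    IsPolyMap fun y => fiberVec b hs β (v y) (t y) i m :=
  isPolyMap_kernelProj (fun l => isPolyMap_pivot hv i l) (isPolyMap_vecAt hv _ _)
    (fun k l => theta_mem_polyFun hv ht hs β k (isPolyMap_pivot hv i l))
    (fun k => theta_mem_polyFun hv ht hs β k (isPolyMap_vecAt hv _ _))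

end HullProj

section FiberBasis

variable {X : Type*} [AddCommGroup X] [Module ℂ X] {s e b : ℕ}
  {hs : e + 3 ≤ s} {β v : Fin s → Basis (Fin (5 + b)) ℂ X}

lemma pivot_mem_offset (he : e = 1 ∨ e = 2) (v : Fin s → Basis (Fin (5 + b)) ℂ X) (i : Fin s)
    (l : Fin 3) (hl : e ≤ i → (i : ℕ) < e + 3 → l ≠ 2) :
    pivot b e (vecs v) i l ∈ (flags v i).space (offset e i) := by
  refine vecAt_mem_flagOf v i ?_ ?_ <;>
  · unfold pivotIdx
    try unfold offset
    rcases he with rfl | rfl <;> split_ifs <;> fin_cases l <;> simp at hl ⊢ <;> omega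

lemma hullProj_mem (he : e = 1 ∨ e = 2) (t : ℂ) (i : Fin s) {m : ℕ} (h1 : offset e i ≤ m)
    (h2 : m ≤ offset e i + b) {x : X} (hx : x ∈ (flags v i).space m) :
    hullProj b hs β (vecs v) t i x ∈ (flags v i).space m := by
  rw [hullProj, kernelProj_apply]
  refine sub_mem (Submodule.smul_mem _ _ hx) (Submodule.sum_mem _ fun l _ => ?_)
  by_cases hl : e ≤ i → (i : ℕ) < e + 3 → l ≠ 2
  · exact Submodule.smul_mem _ _ ((flags v i).mono h1 (pivot_mem_offset he v i l hl))
  push Not at hl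
  obtain ⟨hi, hi', rfl⟩ := hl
  obtain ⟨k, rfl⟩ : ∃ k, i = boxIdx hs k :=
    ⟨⟨i - e, by omega⟩, Fin.ext (by simp only [boxIdx]; omega)⟩
  rw [offset_boxIdx] at h1 h2
  have hθ (y : X) (hy : y ∈ (flags v (boxIdx hs k)).space m) :
      theta b hs β (vecs v) t k y = 0 :=
    theta_eq_zero_of_mem β v t k ((flags v _).mono (by omega) hy)
  have hpiv (l : Fin 3) (hl : l ≠ 2) :
      pivot b e (vecs v) (boxIdx hs k) l ∈ (flags v (boxIdx hs k)).space m := by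
    refine (flags v _).mono ?_ (pivot_mem_offset he v (boxIdx hs k) l fun _ _ => hl)
    rwa [offset_boxIdx]
  rw [Matrix.det_eq_zero_of_row_eq_zero k, zero_smul]
  · exact zero_mem _
  · intro l
    by_cases hl : l = 2
    · subst hl
      simp [hθ x hx]
    · simp [Matrix.updateCol_ne hl, hθ _ (hpiv l hl)]

variable [FiniteDimensional ℂ X]

lemma IsGoodFrame.exists_fiberBasis (hv : IsGoodFrame b hs β (vecs v)) (he : e = 1 ∨ e = 2)
    {t : ℂ} (ht : IsRoot b hs β (vecs v) t) (i : Fin s) :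
    ∃ u : Basis (Fin b) ℂ (X ⧸ baseSpace hs (flags v)),
      (∀ m, u m = (baseSpace hs (flags v)).mkQ (fiberVec b hs β (vecs v) t i m)) ∧
      ∀ j, (flagOf u).space j = ((flags v i).space (offset e i + j) ⊓
        hull b hs (flags v) (rootPlane hs β v t)).map (baseSpace hs (flags v)).mkQ := by
  have hX : finrank ℂ X = 5 + b := by
    rw [finrank_eq_card_basis (v i), Fintype.card_fin]
  have hgen := hv.isGenericInstance he
  have hbp := hv.isBasePlane_rootPlane he ht
  have hhull := hv.hull_rootPlane ht
  set V := baseSpace hs (flags v) with hV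
  set Z := hull b hs (flags v) (rootPlane hs β v t) with hZ
  have hW : finrank ℂ (X ⧸ V) = b := hgen.finrank_quotient hX
  have hdim (m : ℕ) : finrank ℂ (((flags v i).space (offset e i + m) ⊓ Z).map V.mkQ) = min m b :=
    hgen.finrank_map_fiber he hX hbp i m
  have ho := offset_le_five he i
  have hprojZ (x : X) : hullProj b hs β (vecs v) t i x ∈ Z := by
    rw [hhull, Submodule.mem_iInf]
    exact fun k => apply_kernelProj _ _ k x
  have hmem (m : Fin b) (j : ℕ) (hmj : (m : ℕ) < j) : V.mkQ (fiberVec b hs β (vecs v) t i m) ∈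
      ((flags v i).space (offset e i + j) ⊓ Z).map V.mkQ := by
    refine Submodule.mem_map_of_mem ⟨?_, hprojZ _⟩
    refine (flags v i).mono (show offset e i + (m + 1) ≤ _ by omega) ?_
    exact hullProj_mem he t i (by omega) (by omega)
      (vecAt_mem_flagOf v i (by omega) (by omega))
  have htop : ⊤ ≤ Submodule.span ℂ
      (Set.range fun m => V.mkQ (fiberVec b hs β (vecs v) t i m)) := by
    have h1 : ((flags v i).space (offset e i + b) ⊓ Z).map V.mkQ = ⊤ := by
      apply Submodule.eq_top_of_finrank_eq
      rw [hdim, hW, min_self]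
    rw [← h1, Submodule.map_le_iff_le_comap]
    rintro x ⟨hxF, hxZ⟩
    rw [Submodule.mem_comap]
    have hx0 : hullProj b hs β (vecs v) t i x =
        formDet (theta b hs β (vecs v) t) (pivot b e (vecs v) i) • x :=
      kernelProj_eq_smul fun k => by
        rw [SetLike.mem_coe, hhull, Submodule.mem_iInf] at hxZ
        exact hxZ k
    rw [← Submodule.smul_mem_iff _ (hv.pivot_ne_zero t ht i), ← map_smul, ← hx0]
    obtain ⟨c, rfl⟩ := exists_sum_of_mem_flagOf v i hxF
    simp only [map_sum, map_smul]
    refine Submodule.sum_mem _ fun j hj => Submodule.smul_mem _ _ ?_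
    rw [Finset.mem_range] at hj
    by_cases hjo : j < offset e i
    · have h2 : hullProj b hs β (vecs v) t i (vecAt (vecs v) i j) ∈ V :=
        hgen.offset_inf_le _ hbp i ⟨hullProj_mem he t i le_rfl (by omega)
          (vecAt_mem_flagOf v i (by omega) hjo), hprojZ _⟩
      rw [(Submodule.Quotient.mk_eq_zero V).2 h2 |> fun h => (show V.mkQ _ = 0 from h)]
      exact zero_mem _
    · refine Submodule.subset_span ⟨⟨j - offset e i, by omega⟩, ?_⟩
      simp only [fiberVec]
      rw [Nat.add_sub_of_le (not_lt.1 hjo)]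
  refine ⟨basisOfTopLeSpanOfCardEqFinrank _ htop (by simp [hW]), fun m => by simp, fun j => ?_⟩
  refine Submodule.eq_of_le_of_finrank_eq ?_ ?_
  · rw [flagOf_space, Submodule.span_le]
    rintro _ ⟨m, hm, rfl⟩
    rw [coe_basisOfTopLeSpanOfCardEqFinrank]
    exact hmem m j hm
  · rw [hdim, (flagOf _).finrank_space, hW]

end FiberBasis

/-! ### Tuples of bases moved by automorphisms that fix `V` -/

section FrameMap

variable {X : Type*} [AddCommGroup X] [Module ℂ X] {s e b n : ℕ}

lemma vecAt_map (g : Fin s → X →ₗ[ℂ] X) (v : Fin s → Fin n → X) (i : Fin s) (j : ℕ) :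
    vecAt (fun i j => g i (v i j)) i j = g i (vecAt v i j) := by
  unfold vecAt
  split_ifs
  · rfl
  · rw [map_zero]

lemma coordForm_map (g : Fin s → X →ₗ[ℂ] X) (β : Fin s → Basis (Fin n) ℂ X)
    (v : Fin s → Fin n → X) (i : Fin s) (k : ℕ) (x : X) :
    coordForm β (fun i j => g i (v i j)) i k (g i x) =
      LinearMap.det (g i) * coordForm β v i k x := by
  by_cases h : k < n
  · rw [coordForm_apply _ _ _ h, coordForm_apply _ _ _ h, ← Basis.det_comp]
    congr 1
    funext j
    by_cases hj : j = ⟨k, h⟩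
    · subst hj
      simp
    · simp [Function.update_of_ne hj]
  · simp [coordForm, dif_neg h]

end FrameMap

section FrameMap

variable {X : Type*} [AddCommGroup X] [Module ℂ X] {s e b : ℕ} {hs : e + 3 ≤ s}
  {β v : Fin s → Basis (Fin (5 + b)) ℂ X} {g : Fin s → X →ₗ[ℂ] X}

lemma complVec_boxIdx_mem (he : e = 1 ∨ e = 2) (v : Fin s → Basis (Fin (5 + b)) ℂ X) (k : Fin 3)
    {j : ℕ} (hj : j < 5) : complVec hs (vecs v) (boxIdx hs k) j ∈ baseSpace hs (flags v) := by
  rcases he with rfl | rfl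
  · rw [complVec, if_pos rfl, baseSpace, if_pos rfl]
    exact vecAt_mem_flagOf v _ (by omega) hj
  · have h0 : ((boxIdx hs k : Fin s) : ℕ) ≠ 0 := by simp [boxIdx]
    have h1 : ((boxIdx hs k : Fin s) : ℕ) ≠ 1 := by simp only [boxIdx]; omega
    rw [complVec, if_neg (by norm_num), if_neg h0, if_neg h1, baseSpace, if_neg (by norm_num)]
    split_ifs with h
    · exact Submodule.mem_sup_left (vecAt_mem_flagOf v _ (by omega) h)
    · exact Submodule.mem_sup_right (vecAt_mem_flagOf v _ (by omega) (by omega))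

variable (hg : ∀ i, ∀ x ∈ baseSpace hs (flags v), g i x = x)
include hg

lemma movingPoint_map (t : ℂ) :
    movingPoint hs (fun i j => g i (v i j)) t = movingPoint hs (vecs v) t := by
  have h (j : ℕ) (hj : j < 2) : vecAt (fun i j => g i (v i j)) (idxZero hs) j =
      vecAt (vecs v) (idxZero hs) j := by
    rw [vecAt_map g (vecs v)]
    exact hg _ _ (first_le_baseSpace _ (vecAt_mem_flagOf v _ (by omega) hj))
  rw [movingPoint, movingPoint, h 0 (by norm_num), h 1 (by norm_num)]

lemma baseVec_map (he : e = 1 ∨ e = 2) (l : Fin 3) :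
    baseVec hs (fun i j => g i (v i j)) l = baseVec hs (vecs v) l := by
  have h := baseVec_mem_baseSpace (hs := hs) v he l
  unfold baseVec at h ⊢
  split_ifs at h ⊢ <;>
  · rw [vecAt_map g (vecs v)]
    exact hg _ _ h

lemma complVec_boxIdx_map (he : e = 1 ∨ e = 2) (k : Fin 3) {j : ℕ} (hj : j < 5) :
    complVec hs (fun i j => g i (v i j)) (boxIdx hs k) j =
      complVec hs (vecs v) (boxIdx hs k) j := by
  have h := complVec_boxIdx_mem (hs := hs) he v k hj
  unfold complVec at h ⊢
  split_ifs at h ⊢ <;>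
  · rw [vecAt_map g (vecs v)]
    exact hg _ _ h

lemma theta_map (t : ℂ) (k : Fin 3) (x : X) :
    theta b hs β (fun i j => g i (v i j)) t k (g (boxIdx hs k) x) =
      LinearMap.det (g (boxIdx hs k)) ^ 2 * theta b hs β (vecs v) t k x := by
  have h := hg (boxIdx hs k) _ (movingPoint_mem_baseSpace v t)
  rw [theta, theta, movingPoint_map hg, boxForm, boxForm, pencil_apply, pencil_apply, ← h,
    coordForm_map g β (vecs v), coordForm_map g β (vecs v), coordForm_map g β (vecs v),
    coordForm_map g β (vecs v), h]
  ring

lemma isRoot_map (he : e = 1 ∨ e = 2) (hdet : ∀ i, LinearMap.det (g i) ≠ 0) (t : ℂ) :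
    IsRoot b hs β (fun i j => g i (v i j)) t ↔ IsRoot b hs β (vecs v) t := by
  rw [IsRoot, IsRoot, sum_rootCoeff hs β _ he, sum_rootCoeff hs β _ he]
  have h : formDet (theta b hs β (fun i j => g i (v i j)) t)
      (baseVec hs fun i j => g i (v i j)) =
      (∏ k, LinearMap.det (g (boxIdx hs k)) ^ 2) *
        formDet (theta b hs β (vecs v) t) (baseVec hs (vecs v)) := by
    rw [formDet, formDet, ← Matrix.det_mul_column]
    congr 1
    ext k l
    simp only [Matrix.of_apply]
    rw [baseVec_map hg he, ← theta_map hg, hg _ _ (baseVec_mem_baseSpace v he l)]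
  rw [h, mul_eq_zero, or_iff_right]
  exact Finset.prod_ne_zero_iff.2 fun k _ => pow_ne_zero _ (hdet _)

lemma fiberVec_map (hsurj : ∀ i, Function.Surjective (g i)) {t : ℂ}
    (hθ : ∀ i k x, theta b hs β (vecs v) t k (g i x) = theta b hs β (vecs v) t k x)
    (i : Fin s) (m : Fin b) : fiberVec b hs β (fun i j => g i (v i j)) t i m =
      (∏ k, LinearMap.det (g (boxIdx hs k)) ^ 2) • g i (fiberVec b hs β (vecs v) t i m) := by
  have h1 : pivot b e (fun i j => g i (v i j)) i = fun l => g i (pivot b e (vecs v) i l) := by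
    funext l
    exact vecAt_map g (vecs v) _ _
  rw [fiberVec, hullProj, h1, vecAt_map g (vecs v), fiberVec, hullProj]
  refine kernelProj_map (g i) (fun k x => ?_) _
  obtain ⟨y, hy⟩ := hsurj (boxIdx hs k) (g i x)
  rw [← hy, theta_map hg, ← hθ (boxIdx hs k), hy, hθ]

end FrameMap

section QuotientCoordinates

variable {X : Type*} [AddCommGroup X] [Module ℂ X] {s e b : ℕ}

/-- The given `b` vectors, followed by a basis of `V`. -/
def quotFrame (hs : e + 3 ≤ s) (z : Fin b → X) (v : Fin s → Fin (5 + b) → X)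
    (j : Fin (5 + b)) : X :=
  if h : (j : ℕ) < b then z ⟨j, h⟩ else complVec hs v (boxIdx hs 0) (j - b)

/-- A multiple of the coordinates modulo `V` with respect to the vectors `z`. -/
def quotCoord (hs : e + 3 ≤ s) (β : Fin s → Basis (Fin (5 + b)) ℂ X) (z : Fin b → X)
    (v : Fin s → Fin (5 + b) → X) : X →ₗ[ℂ] Fin b → ℂ :=
  LinearMap.pi fun m => coordForm β (fun _ => quotFrame hs z v) (boxIdx hs 0) m

lemma isPolyMap_quotFrame {M : Type*} [AddCommGroup M] [Module ℂ M]
    {v : M → Fin s → Fin (5 + b) → X} (hv : ∀ i j, IsPolyMap fun y => v y i j) (hs : e + 3 ≤ s)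
    (z : Fin b → X) (j : Fin (5 + b)) : IsPolyMap fun y => quotFrame hs z (v y) j := by
  unfold quotFrame
  split_ifs
  · exact isPolyMap_const _
  · exact isPolyMap_complVec hv hs _ _

lemma isPolyMap_quotCoord {M : Type*} [AddCommGroup M] [Module ℂ M]
    {v : M → Fin s → Fin (5 + b) → X} (hv : ∀ i j, IsPolyMap fun y => v y i j) (hs : e + 3 ≤ s)
    (β : Fin s → Basis (Fin (5 + b)) ℂ X) (z : Fin b → X) {x : M → X} (hx : IsPolyMap x) :
    IsPolyMap fun y => quotCoord hs β z (v y) (x y) := by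
  refine isPolyMap_pi fun m => ?_
  have h := coordForm_mem_polyFun (v := fun y _ => quotFrame hs z (v y))
    (fun _ j => isPolyMap_quotFrame hv hs z j) β (boxIdx hs 0) m hx
  exact fun φ => comp_mem_polyFun (dual_mem_polyFun φ) fun ψ => by
    have : (fun y => ψ ((quotCoord hs β z (v y) (x y)) m)) = fun y => ψ 1 *
      coordForm β (fun _ => quotFrame hs z (v y)) (boxIdx hs 0) m (x y) := by
      funext y
      conv_lhs => rw [← mul_one ((quotCoord hs β z (v y) (x y)) m), ← smul_eq_mul, map_smul,
        smul_eq_mul, mul_comm]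
      rfl
    rw [this]
    exact mul_mem_polyFun (const_mem_polyFun _) h

variable {hs : e + 3 ≤ s} {β v : Fin s → Basis (Fin (5 + b)) ℂ X} {z : Fin b → X}

lemma quotCoord_of_mem (he : e = 1 ∨ e = 2) {x : X} (hx : x ∈ baseSpace hs (flags v)) :
    quotCoord hs β z (vecs v) x = 0 := by
  have h0 : plateau e (boxIdx hs 0 : Fin s) = 0 := by simp [plateau, boxIdx]
  have h1 := IsBaseFrame.baseSpace_le he (boxIdx hs 0) (by simp [boxIdx]) hx
  rw [h0, flagOf_space_zero, bot_sup_eq] at h1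
  refine LinearMap.mem_ker.1 (Submodule.span_le.2 ?_ h1)
  rintro _ ⟨j, hj, rfl⟩
  rw [SetLike.mem_coe, LinearMap.mem_ker]
  funext m
  have hj' : j < 5 := hj
  change coordForm β _ (boxIdx hs 0) m _ = 0
  rw [coordForm_apply _ _ _ (show (m : ℕ) < 5 + b by omega)]
  have h2 : complVec hs (vecs v) (boxIdx hs 0) j =
      quotFrame hs z (vecs v) ⟨b + j, by omega⟩ := by
    rw [quotFrame, dif_neg (by simp)]
    simp
  rw [h2]
  exact AlternatingMap.map_update_self _ _ (by simp [Fin.ext_iff]; omega)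

lemma quotCoord_surjective (h : (β (boxIdx hs 0)).det (quotFrame hs z (vecs v)) ≠ 0) :
    Function.Surjective (quotCoord hs β z (vecs v)) := by
  set B := quotFrame hs z (vecs v) with hB
  intro c
  refine ⟨∑ m, (c m / (β (boxIdx hs 0)).det B) • z m, ?_⟩
  have hz (m : Fin b) : z m = B ⟨m, by omega⟩ := by rw [hB, quotFrame, dif_pos m.2]
  funext l
  rw [map_sum, Finset.sum_apply, Finset.sum_eq_single l]
  · rw [map_smul, Pi.smul_apply]
    have : quotCoord hs β z (vecs v) (z l) l = (β (boxIdx hs 0)).det B := by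
      change coordForm β _ (boxIdx hs 0) l _ = _
      rw [coordForm_apply _ _ _ (show (l : ℕ) < 5 + b by omega), hz]
      exact congrArg _ (Function.update_eq_self _ _)
    rw [this, smul_eq_mul, div_mul_cancel₀ _ h]
  · intro m _ hm
    rw [map_smul, Pi.smul_apply]
    have : quotCoord hs β z (vecs v) (z m) l = 0 := by
      change coordForm β _ (boxIdx hs 0) l _ = _
      rw [coordForm_apply _ _ _ (show (l : ℕ) < 5 + b by omega), hz]
      exact AlternatingMap.map_update_self _ _ (by simpa [Fin.ext_iff] using Ne.symm (by simpa [Fin.ext_iff] using hm))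
    rw [this, smul_zero]
  · simp

lemma exists_quotEquiv [FiniteDimensional ℂ X] (he : e = 1 ∨ e = 2)
    (hW : finrank ℂ (X ⧸ baseSpace hs (flags v)) = b)
    (h : (β (boxIdx hs 0)).det (quotFrame hs z (vecs v)) ≠ 0) :
    ∃ E : (X ⧸ baseSpace hs (flags v)) ≃ₗ[ℂ] (Fin b → ℂ),
      ∀ x, E ((baseSpace hs (flags v)).mkQ x) = quotCoord hs β z (vecs v) x := by
  let L := (baseSpace hs (flags v)).liftQ (quotCoord hs β z (vecs v))
    fun x hx => quotCoord_of_mem he hx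
  have hL : Function.Surjective L := fun c => by
    obtain ⟨x, hx⟩ := quotCoord_surjective h c
    exact ⟨(baseSpace hs (flags v)).mkQ x, hx⟩
  have hd : finrank ℂ (X ⧸ baseSpace hs (flags v)) = finrank ℂ (Fin b → ℂ) := by simp [hW]
  exact ⟨LinearEquiv.ofBijective L
    ⟨(LinearMap.injective_iff_surjective_of_finrank_eq_finrank hd).2 hL, hL⟩, fun x => rfl⟩

lemma quotFrame_map (he : e = 1 ∨ e = 2) {g : Fin s → X →ₗ[ℂ] X}
    (hg : ∀ i, ∀ x ∈ baseSpace hs (flags v), g i x = x) :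
    quotFrame hs z (fun i j => g i (v i j)) = quotFrame hs z (vecs v) := by
  funext j
  unfold quotFrame
  split_ifs
  · rfl
  · exact complVec_boxIdx_map hg he 0 (by omega)

end QuotientCoordinates

/-! ### The induced instances in the fiber are general -/

section FiberGeneral

variable {X : Type*} [AddCommGroup X] [Module ℂ X] {s e b : ℕ}

/-- The value of `p` at bases of `ℂᵇ` that represent the instance in the fiber over the base plane
with parameter `t`. -/
def fiberValue (hs : e + 3 ≤ s) (β : Fin s → Basis (Fin (5 + b)) ℂ X) (z : Fin b → X)
    (p : (Fin s → Fin b → Fin b → ℂ) → ℂ) (v : Fin s → Fin (5 + b) → X) (t c : ℂ) : ℂ :=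
  p fun i m => c • quotCoord hs β z v (fiberVec b hs β v t i m)

lemma fiberValue_mem_polyFun {M : Type*} [AddCommGroup M] [Module ℂ M]
    {v : M → Fin s → Fin (5 + b) → X} (hv : ∀ i j, IsPolyMap fun y => v y i j) {t c : M → ℂ}
    (ht : t ∈ polyFun M) (hc : c ∈ polyFun M) (hs : e + 3 ≤ s)
    (β : Fin s → Basis (Fin (5 + b)) ℂ X) (z : Fin b → X)
    {p : (Fin s → Fin b → Fin b → ℂ) → ℂ} (hp : p ∈ polyFun _) :
    (fun y => fiberValue hs β z p (v y) (t y) (c y)) ∈ polyFun M := by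
  refine comp_mem_polyFun hp (isPolyMap_pi fun i => isPolyMap_pi fun m => IsPolyMap.smul hc ?_)
  exact isPolyMap_quotCoord hv hs β z (isPolyMap_fiberVec hv ht hs β i m)

variable [FiniteDimensional ℂ X] {hs : e + 3 ≤ s} {β v : Fin s → Basis (Fin (5 + b)) ℂ X}
  {z : Fin b → X} {p : (Fin s → Fin b → Fin b → ℂ) → ℂ}

lemma IsGoodFrame.exists_fiberEquiv (hv : IsGoodFrame b hs β (vecs v)) (he : e = 1 ∨ e = 2)
    (hX : finrank ℂ X = 5 + b) (hz : (β (boxIdx hs 0)).det (quotFrame hs z (vecs v)) ≠ 0) {c : ℂ}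
    (hc : c ≠ 0) {t : ℂ} (ht : IsRoot b hs β (vecs v) t)
    (hp : fiberValue hs β z p (vecs v) t c ≠ 0) :
    ∃ (y : Fin s → Basis (Fin b) ℂ (Fin b → ℂ))
      (f : (X ⧸ baseSpace hs (flags v)) ≃ₗ[ℂ] (Fin b → ℂ)), p (fun i m => y i m) ≠ 0 ∧
      ∀ i j, (flagOf (y i)).space j = (((flags v i).space (offset e i + j) ⊓
        hull b hs (flags v) (rootPlane hs β v t)).map (baseSpace hs (flags v)).mkQ).map
          f.toLinearMap := by
  obtain ⟨f, hf⟩ := exists_quotEquiv he ((hv.isGenericInstance he).finrank_quotient hX) hz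
  choose u hu hu' using hv.exists_fiberBasis he ht
  let f' := f.trans (LinearEquiv.smulOfNeZero ℂ (Fin b → ℂ) c hc)
  refine ⟨fun i => (u i).map f', f', ?_, fun i j => ?_⟩
  · convert hp using 1
    refine congrArg p (funext fun i => funext fun m => ?_)
    change c • f (u i m) = _
    rw [hu, hf]
  · rw [flagOf_map, hu']

/-- The endomorphism `x ↦ x + φ x` that is the identity on `V`. -/
def idAddQuot (V : Submodule ℂ X) (φ : (X ⧸ V) →ₗ[ℂ] X) : X →ₗ[ℂ] X :=
  LinearMap.id + φ ∘ₗ V.mkQ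

omit [FiniteDimensional ℂ X] in
lemma idAddQuot_of_mem {V : Submodule ℂ X} (φ : (X ⧸ V) →ₗ[ℂ] X) {x : X} (hx : x ∈ V) :
    idAddQuot V φ x = x := by
  have h : V.mkQ x = 0 := by simpa using hx
  change x + φ (V.mkQ x) = x
  rw [h, map_zero, add_zero]

lemma IsGoodFrame.exists_fiberValue_ne_zero (hv : IsGoodFrame b hs β (vecs v))
    (he : e = 1 ∨ e = 2) (hX : finrank ℂ X = 5 + b)
    (hz : (β (boxIdx hs 0)).det (quotFrame hs z (vecs v)) ≠ 0) {t : ℂ}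
    (ht : IsRoot b hs β (vecs v) t) {y : Fin s → Basis (Fin b) ℂ (Fin b → ℂ)}
    (hy : p (fun i m => y i m) ≠ 0) :
    ∃ (ν : Fin s → (X ⧸ baseSpace hs (flags v)) →ₗ[ℂ] X) (c : ℂ),
      fiberValue hs β z p (fun i j => idAddQuot (baseSpace hs (flags v)) (ν i) (v i j)) t c ≠ 0 := by
  have hgen := hv.isGenericInstance he
  have hbp := hv.isBasePlane_rootPlane he ht
  obtain ⟨f, hf⟩ := exists_quotEquiv he (hgen.finrank_quotient hX) hz
  choose u hu hu' using hv.exists_fiberBasis he ht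
  obtain ⟨σ, hσ, hσ'⟩ := hgen.exists_section he hX hbp
  let γ (i : Fin s) := (u i).equiv ((y i).map f.symm) (Equiv.refl _)
  let g (i : Fin s) : X →ₗ[ℂ] X := (shearEquiv (baseSpace hs (flags v)) (hσ i) (γ i)).toLinearMap
  have hg (i : Fin s) (x : X) (hx : x ∈ baseSpace hs (flags v)) : g i x = x :=
    shearEquiv_of_mem (hσ i) (γ i) hx
  have hθ (i : Fin s) (k : Fin 3) (x : X) :
      theta b hs β (vecs v) t k (g i x) = theta b hs β (vecs v) t k x := by
    have h1 : σ i (γ i ((baseSpace hs (flags v)).mkQ x) - (baseSpace hs (flags v)).mkQ x) ∈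
        ⨅ k, LinearMap.ker (theta b hs β (vecs v) t k) := hull_rootPlane_le t (hσ' i _).2
    rw [Submodule.mem_iInf] at h1
    change theta b hs β (vecs v) t k (shearEquiv _ _ _ x) = _
    rw [shearEquiv_apply, map_add, LinearMap.mem_ker.1 (h1 k), add_zero]
  have hdet (i : Fin s) : LinearMap.det (g i) ≠ 0 :=
    (LinearEquiv.isUnit_det' (shearEquiv (baseSpace hs (flags v)) (hσ i) (γ i))).ne_zero
  refine ⟨fun i => σ i ∘ₗ ((γ i).toLinearMap - LinearMap.id),
    (∏ k, LinearMap.det (g (boxIdx hs k)) ^ 2)⁻¹, ?_⟩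
  convert hy using 1
  change fiberValue hs β z p (fun i j => g i (v i j)) t _ = _
  rw [fiberValue]
  congr 1
  funext i m
  rw [fiberVec_map hg (fun i => LinearEquiv.surjective _) hθ, quotCoord, quotFrame_map he hg,
    ← quotCoord, map_smul, smul_smul, inv_mul_cancel₀, one_smul, ← hf]
  · change f ((baseSpace hs (flags v)).mkQ (shearEquiv _ _ _ _)) = _
    rw [mkQ_shearEquiv, ← hu]
    simp [γ]
  · exact Finset.prod_ne_zero_iff.2 fun k _ => pow_ne_zero _ (hdet _)

omit [FiniteDimensional ℂ X] in
/-- The polynomial function whose non-vanishing expresses that `v` spans a generic instance, that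
`z` spans a complement of `V`, and that the instances in the fiber are in general position. -/
lemma exists_polyFun_fiberValue (hs : e + 3 ≤ s) (β : Fin s → Basis (Fin (5 + b)) ℂ X)
    (z : Fin b → X) (c : ℂ) (hp : p ∈ polyFun _) : ∃ q ∈ polyFun (Fin s → Fin (5 + b) → X), ∀ v,
      q v ≠ 0 ↔ IsGoodFrame b hs β v ∧ (β (boxIdx hs 0)).det (quotFrame hs z v) ≠ 0 ∧ c ≠ 0 ∧
        ∀ t, IsRoot b hs β v t → fiberValue hs β z p v t c ≠ 0 := by
  obtain ⟨R, hR, hR'⟩ := exists_polyFun_forall_isRoot b hs β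
    (fiberValue_mem_polyFun (v := fun y : (Fin s → Fin (5 + b) → X) × ℂ => y.1)
      isPolyMap_fst_apply_apply snd_mem_polyFun (const_mem_polyFun c) hs β z hp)
  refine ⟨fun v => goodFun b hs β v * (β (boxIdx hs 0)).det (quotFrame hs z v) * c * R v,
    mul_mem_polyFun (mul_mem_polyFun (mul_mem_polyFun (goodFun_mem_polyFun b hs β)
      (IsPolyMap.det _ fun j => isPolyMap_quotFrame isPolyMap_apply_apply hs z j))
      (const_mem_polyFun c)) hR, fun v => ?_⟩
  simp only [mul_ne_zero_iff, hR', goodFun_ne_zero_iff]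
  constructor
  · rintro ⟨⟨⟨h1, h2⟩, h3⟩, -, h4⟩
    exact ⟨h1, h2, h3, h4⟩
  · rintro ⟨h1, h2, h3, h4⟩
    exact ⟨⟨⟨h1, h2⟩, h3⟩, h1.lead, h4⟩

lemma IsGoodFrame.exists_general (hv : IsGoodFrame b hs β (vecs v)) (he : e = 1 ∨ e = 2)
    (hX : finrank ℂ X = 5 + b) (hp : p ∈ polyFun _) {y : Fin s → Basis (Fin b) ℂ (Fin b → ℂ)}
    (hy : p (fun i m => y i m) ≠ 0) :
    ∃ (z : Fin b → X) (c : ℂ) (v' : Fin s → Basis (Fin (5 + b)) ℂ X),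
      IsGoodFrame b hs β (vecs v') ∧ (β (boxIdx hs 0)).det (quotFrame hs z (vecs v')) ≠ 0 ∧ c ≠ 0 ∧
        ∀ t, IsRoot b hs β (vecs v') t → fiberValue hs β z p (vecs v') t c ≠ 0 := by
  let z (j : Fin b) : X := v (boxIdx hs 0) ⟨j, by omega⟩
  have hplat : plateau e (boxIdx hs 0 : Fin s) = 0 := by simp [plateau, boxIdx]
  have hzf : quotFrame hs z (vecs v) = complFrame b hs (vecs v) (boxIdx hs 0) := by
    funext j
    unfold quotFrame complFrame
    rw [hplat, add_zero]
    split_ifs <;> rfl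
  have hz : (β (boxIdx hs 0)).det (quotFrame hs z (vecs v)) ≠ 0 := by
    rw [hzf]
    exact hv.compl _ (by simp [boxIdx])
  set V := baseSpace hs (flags v) with hV
  let M := (Fin s → (X ⧸ V) →ₗ[ℂ] X) × ℂ
  let w (y : M) (i : Fin s) (j : Fin (5 + b)) : X := idAddQuot V (y.1 i) (v i j)
  have hw (i : Fin s) (j : Fin (5 + b)) : IsPolyMap fun y : M => w y i j := by
    exact (isPolyMap_const (v i j)).add (LinearMap.applyₗ (V.mkQ (v i j)) ∘ₗ
      LinearMap.proj (φ := fun _ : Fin s => (X ⧸ V) →ₗ[ℂ] X) i ∘ₗ LinearMap.fst ℂ _ ℂ).isPolyMap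
  have hfin : {t | IsRoot b hs β (vecs v) t}.Finite := by
    refine Set.finite_of_encard_eq_coe (k := e + 1) ?_
    exact encard_roots_eq hv.lead hv.simple
  have hw0 : w (0, 1) = vecs v := by
    funext i j
    simp [w, idAddQuot]
  have hg (ν : Fin s → (X ⧸ V) →ₗ[ℂ] X) (i : Fin s) (x : X) (hx : x ∈ baseSpace hs (flags v)) :
      idAddQuot V (ν i) x = x := idAddQuot_of_mem _ hx
  obtain ⟨y, hy1⟩ := exists_mul_ne_zero_of_polyFun (M := M)
    (f := fun y => goodFun b hs β (w y) * (∏ i, (β i).det (w y i)) * y.2)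
    (g := fun y => ∏ t ∈ hfin.toFinset, fiberValue hs β z p (w y) t y.2)
    (mul_mem_polyFun (mul_mem_polyFun (comp_mem_polyFun (goodFun_mem_polyFun b hs β)
      (isPolyMap_pi fun i => isPolyMap_pi fun j => hw i j))
      (prod_mem_polyFun _ fun i _ => IsPolyMap.det _ fun j => hw i j)) snd_mem_polyFun)
    (prod_mem_polyFun _ fun t _ => fiberValue_mem_polyFun hw (const_mem_polyFun t) snd_mem_polyFun
      hs β z hp)
    ⟨(0, 1), by
      simp only [hw0, mul_ne_zero_iff, goodFun_ne_zero_iff, Finset.prod_ne_zero_iff]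
      exact ⟨⟨hv, fun i _ => det_basis_ne_zero _ _⟩, one_ne_zero⟩⟩
    (exists_prod_ne_zero_of_polyFun _ (fun t _ => fiberValue_mem_polyFun hw (const_mem_polyFun t)
      snd_mem_polyFun hs β z hp) fun t ht => by
        obtain ⟨ν, c, h⟩ := hv.exists_fiberValue_ne_zero he hX hz (hfin.mem_toFinset.1 ht) hy
        exact ⟨(ν, c), h⟩)
  simp only [mul_ne_zero_iff, goodFun_ne_zero_iff, Finset.prod_ne_zero_iff,
    Set.Finite.mem_toFinset, Set.mem_ofPred_eq, Finset.mem_univ, true_imp_iff] at hy1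
  obtain ⟨⟨⟨h1, h2⟩, h3⟩, h4⟩ := hy1
  have hbasis (i : Fin s) := (β i).is_basis_iff_det.2 (isUnit_iff_ne_zero.2 (h2 i))
  let v' (i : Fin s) : Basis (Fin (5 + b)) ℂ X := Basis.mk (hbasis i).1 (hbasis i).2.ge
  have hv' : vecs v' = w y := by
    funext i j
    exact Basis.mk_apply _ _ _
  refine ⟨z, y.2, v', ?_⟩
  rw [hv']
  refine ⟨h1, ?_, h3, fun t ht => h4 t ?_⟩
  · have h5 : quotFrame hs z (w y) = quotFrame hs z (vecs v) := quotFrame_map he (hg y.1)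
    rwa [h5]
  · refine (isRoot_map (hg y.1) he (fun i h0 => h2 i ?_) t).1 ht
    have h5 := Basis.det_comp (β i) (idAddQuot V (y.1 i)) (v i)
    rw [h0, zero_mul] at h5
    exact h5

theorem exists_isZariskiOpen_general (he : e = 1 ∨ e = 2) (hX : finrank ℂ X = 5 + b)
    (hne : (genericLocus X b hs).Nonempty) {O : Set (Fin s → CompleteFlag (Fin b → ℂ))}
    (hO : IsZariskiOpen O) (hO' : O.Nonempty) :
    ∃ U ⊆ genericLocus X b hs, U.Nonempty ∧ IsZariskiOpen U ∧ ∀ F ∈ U,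
      ∀ (V : Submodule ℂ X) (E : Fin (e + 3) → CompleteFlag V)
        (G : Submodule ℂ V → Fin s → CompleteFlag (X ⧸ V)), IsInducedDatum b hs F V E G →
      ∀ h : Submodule ℂ V, IsBasePlane b hs F (h.map V.subtype) →
        ∃ f : (X ⧸ V) ≃ₗ[ℂ] (Fin b → ℂ), ∃ G₀ ∈ O,
          ∀ i j, (G₀ i).space j = ((G h i).space j).map f.toLinearMap := by
  obtain ⟨p, hp, ⟨y, hy⟩, hpO⟩ := exists_polyFun_of_isZariskiOpen (n := b) (by simp) hO hO'
  choose q hq hq' using fun k : (Fin s → Basis (Fin (5 + b)) ℂ X) × (Fin b → X) × ℂ =>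
    exists_polyFun_fiberValue hs k.1 k.2.1 k.2.2 hp
  refine ⟨nonvanishingLocus q, ?_, ?_, isZariskiOpen_nonvanishingLocus hX hq, ?_⟩
  · rintro F ⟨k, v, hF, hv⟩
    exact mem_genericLocus.2 ⟨k.1, v, funext hF, ((hq' k _).1 hv).1⟩
  · obtain ⟨F, hF⟩ := hne
    obtain ⟨β, v, -, hv⟩ := mem_genericLocus.1 hF
    obtain ⟨z, c, v', h⟩ := hv.exists_general he hX hp hy
    exact ⟨flags v', (β, z, c), v', fun _ => rfl, (hq' (β, z, c) _).2 h⟩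
  · rintro F ⟨⟨β, z, c⟩, v, hF, hv⟩ V E G hD h hh
    obtain rfl : F = flags v := funext hF
    obtain ⟨h1, h2, h3, h4⟩ := (hq' _ _).1 hv
    obtain rfl := hD.eq_baseSpace
    obtain ⟨t, ht, hht⟩ := (h1.isBasePlane_iff he).1 hh
    obtain ⟨y', f, hy', hf⟩ := h1.exists_fiberEquiv he hX h2 h3 ht (h4 t ht)
    refine ⟨f, _, hpO y' hy', fun i j => ?_⟩
    rw [hf, hD.fiber h hh, hht]

end FiberGeneral

/-! ### The lists of partitions are Schubert problems -/

section SchubertProblems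

variable {a b e s : ℕ}

lemma antitone_consRow {r : ℕ} {lam : ℕ → ℕ} (h : Antitone lam) (hr : lam 0 ≤ r) :
    Antitone (consRow r lam) :=
  antitone_nat_of_succ_le fun j => by
    cases j with
    | zero => exact hr
    | succ j => exact h (Nat.le_succ j)

lemma antitone_addColumn {lam : ℕ → ℕ} (h : Antitone lam) (m : ℕ) :
    Antitone (addColumn m lam) :=
  antitone_nat_of_succ_le fun j => by
    have : lam (j + 1) ≤ lam j := h (Nat.le_succ j)
    unfold addColumn
    split_ifs <;> omega

lemma isPartitionFor_fiberedFamily (he : e = 1 ∨ e = 2) (hab : a < b) {nu : Fin s → ℕ → ℕ}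
    (i : Fin s) (h : IsPartitionFor a b (nu i)) :
    IsPartitionFor (2 + a) (5 + b) (fiberedFamily e a b nu i) := by
  obtain ⟨h1, h2, h3⟩ := h
  have h4 : nu i (a + 1) = 0 := Nat.le_zero.1 (h3 ▸ h1 (Nat.le_succ a))
  have h5 : nu i (a + 2) = 0 := Nat.le_zero.1 (h4 ▸ h1 (Nat.le_succ (a + 1)))
  have e1 (r : ℕ) (lam : ℕ → ℕ) : consRow r lam 0 = r := rfl
  have e2 (r : ℕ) (lam : ℕ → ℕ) (j : ℕ) : consRow r lam (j + 1) = lam j := rfl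
  unfold fiberedFamily
  rw [add_comm 2 a]
  split_ifs
  · refine ⟨antitone_consRow (antitone_consRow h1 (by omega)) ?_, ?_, h3⟩ <;>
    · rw [e1]
      omega
  · refine ⟨antitone_consRow h1 (by omega), ?_, ?_⟩
    · rw [e1]
      omega
    · rw [e2, h4]
  · refine ⟨antitone_addColumn h1 _, ?_, ?_⟩ <;> unfold addColumn <;> split_ifs <;> omega
  · exact ⟨h1, by omega, h5⟩

lemma sum_fiberedFamily {nu : Fin s → ℕ → ℕ} (i : Fin s)
    (h : IsPartitionFor a b (nu i)) :
    ∑ j ∈ Finset.range (2 + a), fiberedFamily e a b nu i j =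
      (if (i : ℕ) < e then (if e = 1 then 2 * (b - a) + 3 else b - a + 2 - i)
        else if (i : ℕ) < e + 3 then a + 1 else 0) + ∑ j ∈ Finset.range a, nu i j := by
  obtain ⟨h1, h2, h3⟩ := h
  have h4 : nu i (a + 1) = 0 := Nat.le_zero.1 (h3 ▸ h1 (Nat.le_succ a))
  have e1 (r : ℕ) (lam : ℕ → ℕ) : consRow r lam 0 = r := rfl
  have e2 (r : ℕ) (lam : ℕ → ℕ) (j : ℕ) : consRow r lam (j + 1) = lam j := rfl
  unfold fiberedFamily
  rw [add_comm 2 a]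
  split_ifs
  · simp only [Finset.sum_range_succ', e1, e2]
    omega
  · rw [Finset.sum_range_succ', Finset.sum_range_succ]
    simp only [e1, e2, h3]
    omega
  · have h5 : ∑ j ∈ Finset.range (a + 2), (if j < a + 1 then 1 else 0) = a + 1 := by
      rw [Finset.sum_range_succ, if_neg (by omega),
        Finset.sum_congr rfl fun j hj => if_pos (Finset.mem_range.1 hj)]
      simp
    simp only [addColumn, Finset.sum_add_distrib]
    rw [h5, Finset.sum_range_succ _ (a + 1), Finset.sum_range_succ, h3, h4, add_zero, add_zero]
  · rw [Finset.sum_range_succ, Finset.sum_range_succ, h3, h4]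
    omega

lemma isSchubertProblem_fiberedFamily (he : e = 1 ∨ e = 2) (hab : a < b) (hs : e + 3 ≤ s)
    {nu : Fin s → ℕ → ℕ} (hnu : IsSchubertProblem a b nu) :
    IsSchubertProblem (2 + a) (5 + b) (fiberedFamily e a b nu) := by
  refine ⟨fun i => isPartitionFor_fiberedFamily he hab i (hnu.1 i), ?_⟩
  rw [Finset.sum_congr rfl fun i _ => sum_fiberedFamily i (hnu.1 i),
    Finset.sum_add_distrib, hnu.2]
  rw [Fin.sum_univ_eq_sum_range (fun i => if i < e then (if e = 1 then 2 * (b - a) + 3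
    else b - a + 2 - i) else if i < e + 3 then a + 1 else 0) s,
    ← Finset.sum_subset (Finset.range_mono hs) fun i _ hi => ?_]
  · obtain ⟨d, rfl⟩ := Nat.exists_eq_add_of_lt hab
    have h1 : a + d + 1 - a = d + 1 := by omega
    have h2 : 5 + (a + d + 1) - (2 + a) = d + 4 := by omega
    rw [h1, h2]
    rcases he with rfl | rfl <;> simp [Finset.sum_range_succ] <;> ring
  · rw [Finset.mem_range] at hi
    rw [if_neg (by omega), if_neg (by omega)]

lemma isSchubertProblem_baseProblem (he : e = 1 ∨ e = 2) :
    IsSchubertProblem 2 5 (baseProblem e) := by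
  have h1 : IsPartitionFor 2 5 (partition [1]) :=
    ⟨antitone_nat_of_succ_le fun j => by rcases j with _ | j <;> simp [partition],
      by simp [partition], by simp [partition]⟩
  have h2 : IsPartitionFor 2 5 (partition [2]) :=
    ⟨antitone_nat_of_succ_le fun j => by rcases j with _ | j <;> simp [partition],
      by simp [partition], by simp [partition]⟩
  have h3 : IsPartitionFor 2 5 (partition [2, 1]) :=
    ⟨antitone_nat_of_succ_le fun j => by rcases j with _ | _ | j <;> simp [partition],
      by simp [partition], by simp [partition]⟩
  refine ⟨fun i => ?_, ?_⟩
  · unfold baseProblem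
    split_ifs <;> assumption
  · rcases he with rfl | rfl <;> simp [Fin.sum_univ_succ, baseProblem, Finset.sum_range_succ, partition]

end SchubertProblems

/-! ### The fibration -/

section Fibration

variable {a b e s : ℕ}

lemma genericLocus_nonempty (he : e = 1 ∨ e = 2) (hb : 2 ≤ b) (hs : e + 3 ≤ s) :
    (genericLocus (Fin (5 + b) → ℂ) b hs).Nonempty := by
  have hX : finrank ℂ (Fin (5 + b) → ℂ) = 5 + b := by simp
  have h5 := (flagOf (Pi.basisFun ℂ (Fin (5 + b)))).finrank_space 5
  rw [hX, min_eq_left (by omega)] at h5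
  obtain ⟨O, ⟨E, hE⟩, -, h⟩ := exists_isZariskiOpen_base hs he hb hX h5
  obtain ⟨F, hF, -⟩ := h E hE
  exact ⟨F, hF⟩

theorem isFiberedOver_baseProblem (he : e = 1 ∨ e = 2) (ha : 0 < a) (hab : a < b) (hs : e + 3 ≤ s)
    {nu : Fin s → ℕ → ℕ} (hnu : IsSchubertProblem a b nu) :
    IsFiberedOver 2 5 a b (fiberedFamily e a b nu) (baseProblem e) nu := by
  have hX : finrank ℂ (Fin (5 + b) → ℂ) = 5 + b := by simp
  have hb : 2 ≤ b := by omega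
  have hne := genericLocus_nonempty he hb hs
  have hex (F : Fin s → CompleteFlag (Fin (5 + b) → ℂ)) :
      ∃ D : FibrationDatum (5 + b) (e + 3) s, F ∈ genericLocus (Fin (5 + b) → ℂ) b hs →
        IsInducedDatum b hs F D.V D.E D.G := by
    by_cases hF : F ∈ genericLocus (Fin (5 + b) → ℂ) b hs
    · obtain ⟨E, G, h⟩ := (isGenericInstance_of_mem he hF).exists_isInducedDatum he hX
      exact ⟨⟨_, E, G⟩, fun _ => h⟩
    · obtain ⟨F₀, hF₀⟩ := hne
      obtain ⟨E, G, -⟩ := (isGenericInstance_of_mem he hF₀).exists_isInducedDatum he hX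
      exact ⟨⟨_, E, G⟩, fun h => absurd h hF⟩
  choose D hD using hex
  have hDV (F) (hF : F ∈ genericLocus (Fin (5 + b) → ℂ) b hs) : finrank ℂ (D F).V = 5 := by
    rw [(hD F hF).eq_baseSpace]
    exact (isGenericInstance_of_mem he hF).finrank_baseSpace
  have hDeq (F) (hF : F ∈ genericLocus (Fin (5 + b) → ℂ) b hs) {V : Submodule ℂ (Fin (5 + b) → ℂ)}
      {E : Fin (e + 3) → CompleteFlag V} {G} (h : IsInducedDatum b hs F V E G) :
      ∃ G', D F = ⟨V, E, G'⟩ ∧ ∀ p, IsBasePlane b hs F (p.map V.subtype) → G' p = G p := by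
    have h' := hD F hF
    generalize D F = DF at h'
    obtain ⟨V', E', G'⟩ := DF
    obtain rfl : V' = V := h'.eq_baseSpace.trans h.eq_baseSpace.symm
    obtain rfl := h'.base_unique h
    exact ⟨G', rfl, fun p hp => h'.fiber_unique h hp⟩
  refine ⟨isSchubertProblem_fiberedFamily he hab hs hnu, isSchubertProblem_baseProblem he, hnu,
    genericLocus _ b hs, D, hne, isZariskiOpen_genericLocus hX hs, fun F hF =>
      isFiberDecomposition (isGenericInstance_of_mem he hF) he hab hnu.1 (hD F hF), fun V hV => ?_,
      fun O hO' hO => ?_⟩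
  · obtain ⟨O, hO', hO, h⟩ := exists_isZariskiOpen_base hs he hb hX hV
    refine ⟨O, hO', hO, fun E hE => ?_⟩
    obtain ⟨F, hF, G, hG⟩ := h E hE
    refine ⟨?_, fun p hp => ?_⟩
    · obtain ⟨G', h', -⟩ := hDeq F hF hG
      exact ⟨F, hF, G', h'⟩
    · obtain ⟨O', h1, h2, h3⟩ := exists_isZariskiOpen_fiber he hX hF hG ((hG.mem_iff hV he p).1 hp)
      refine ⟨O', h1, h2, fun G₀ hG₀ => ?_⟩
      obtain ⟨F', hF', G', hG', rfl⟩ := h3 G₀ hG₀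
      obtain ⟨G'', h4, h5⟩ := hDeq F' hF' hG'
      exact ⟨F', hF', G'', h4, h5 p ((hG'.mem_iff hV he p).1 hp)⟩
  · obtain ⟨U, hU, hU1, hU2, h⟩ := exists_isZariskiOpen_general he hX hne hO hO'
    refine ⟨U, hU, hU1, hU2, fun F hF p hp => ?_⟩
    have hI := hD F (hU hF)
    exact h F hF _ _ _ hI p ((hI.mem_iff (hDV F (hU hF)) he p).1 hp)

end Fibration

end

theorem theorem3p5 (a b : ℕ) (ha : 0 < a) (hab : a < b) (s : ℕ) (nu : Fin s → ℕ → ℕ)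
    (hnu : IsSchubertProblem a b nu) :
    (4 ≤ s →
      IsSchubertProblem (2 + a) (5 + b) (familyOne a b nu) ∧
      HasSchubertNumber 2 5 baseOne 2 ∧
      IsFiberedOver 2 5 a b (familyOne a b nu) baseOne nu) ∧
    (5 ≤ s →
      IsSchubertProblem (2 + a) (5 + b) (familyTwo a b nu) ∧
      HasSchubertNumber 2 5 baseTwo 3 ∧
      IsFiberedOver 2 5 a b (familyTwo a b nu) baseTwo nu) := by
  refine ⟨fun hs => ?_, fun hs => ?_⟩
  · rw [← fiberedFamily_one, ← baseProblem_one]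
    exact ⟨isSchubertProblem_fiberedFamily (Or.inl rfl) hab hs hnu,
      hasSchubertNumber_baseProblem (Or.inl rfl), isFiberedOver_baseProblem (Or.inl rfl) ha hab hs hnu⟩
  · rw [← fiberedFamily_two, ← baseProblem_two]
    exact ⟨isSchubertProblem_fiberedFamily (Or.inr rfl) hab hs hnu,
      hasSchubertNumber_baseProblem (Or.inr rfl), isFiberedOver_baseProblem (Or.inr rfl) ha hab hs hnu⟩
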